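/- Let $(E,d)$ be a locally compact separable metric space and $\mu$ a positive Borel measure on $E$ with full support that is finite on compact sets. Let $(\mathcal E,\mathcal F)$ be a symmetric, strongly local, regular Dirichlet form on $L^2(E,\mu)$ that admits a carré du champ $\Gamma$: a positive semidefinite symmetric bilinear map $\Gamma:\mathcal F\times\mathcal F\to L^1(E,\mu)$ such that $\mathcal E(f,g)=\int_E\Gamma(f,g)\,d\mu$ for $f,g\in\mathcal F$, and $2\int_E h\,\Gamma(f,g)\,d\mu=\mathcal E(fh,g)+\mathcal E(gh,f)-\mathcal E(h,fg)$ for all bounded $f,g,h\in\mathcal F$. Here strongly local means that $\mathcal E(u,v)=0$ whenever $u\in\mathcal F$ is constant on a neighbourhood of the support of $v\in\mathcal F$. Let $\mathcal F_{loc}$ be the set of measurable functions $u$ such that for every relatively compact open $V\subset E$ there is $v\in\mathcal F$ with $u=v$ $\mu$-a.e. on $V$; by locality, $\Gamma(u,u)$ is extended to $u\in\mathcal F_{loc}$ by $\Gamma(u,u)=\Gamma(v,v)$ $\mu$-a.e. on $V$. Let $(T_t)_{t>0}$ be the $C_0$-semigroup of contractions on $L^2(E,\mu)$ associated with $(\mathcal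 E,\mathcal F)$, i.e. the one whose generator $L$ is given by: $u\in D(L)$ and $Lu=w$ if and only if $u\in\mathcal F$ and $\mathcal E(u,v)=-\int_E wv\,d\mu$ for all $v\in\mathcal F$. It is called conservative if $T_t1=1$ $\mu$-a.e. for every $t>0$, where $T_t1:=\lim_{n\to\infty}T_tf_n$ $\mu$-a.e. for any $f_n\in L^2(E,\mu)\cap L^\infty(E,\mu)$ with $f_n\nearrow1$ $\mu$-a.e. Fix $x_0\in E$, write $d(x):=d(x,x_0)$ and $E_r:=\{x\in E: d(x)<r\}$. Assume that $d\in\mathcal F_{loc}$, that $E_r$ is relatively compact for every $r>0$, and that there is a compact set $K_0\subset E$ with $\Gamma(d,d)\in L^\infty_{loc}(E\setminus K_0,\mu)$. (i) Assume that there are constants $M,N>0$, $0\le\beta\le2$ and a compact set $K\supset K_0$ such that $$\Gamma(d,d)\le M(d+1)^2\left(\log(d+1)\right)^\beta\quad\mu\text{-a.e. on }E\setminus K,$$ and that for all sufficiently large $n\in\mathbb N$ $$\mu(E_{4n}\setminus E_{2n})\le\exp\left(2N(\log(n+1))^{2-\beta}\right)\ \text{ if }0\le\beta<2,\qquad \mu(E_{4n}\setminus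 E_{2n})\le(\log(n+1))^{2N}\ \text{ if }\beta=2.$$ Then $(T_t)_{t>0}$ is conservative. (ii) Assume that there are constants $M,N>0$ and a compact set $K\supset K_0$ such that $\Gamma(d,d)\le M$ $\mu$-a.e. on $E\setminus K$, and that $\mu(E_{4n}\setminus E_{2n})\le\exp(2Nn^2)$ for all sufficiently large $n\in\mathbb N$. Then $(T_t)_{t>0}$ is conservative. -/

import Mathlib

open MeasureTheory Filter Topology
open scoped ENNReal

section DirichletForms

variable {X : Type*} [MeasurableSpace X]

/-- A symmetric Dirichlet form on `L²(X, μ)`: a densely defined, symmetric, nonnegative bilinear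
form whose domain is complete for `𝓔₁(u, u) = 𝓔(u, u) + (u, u)` and on which the unit
contraction `u ↦ (0 ∨ u) ∧ 1` operates. -/
structure SymmDirichletForm (μ : Measure X) where
  /-- The domain of the form. -/
  domain : Submodule ℝ (Lp ℝ 2 μ)
  /-- The bilinear form. -/
  form : domain →ₗ[ℝ] domain →ₗ[ℝ] ℝ
  dense_domain : Dense (domain : Set (Lp ℝ 2 μ))
  symm : ∀ u v : domain, form u v = form v u
  nonneg : ∀ u : domain, 0 ≤ form u u
  closed : ∀ u : ℕ → domain,
    (∀ ε > 0, ∃ n₀ : ℕ, ∀ m ≥ n₀, ∀ n ≥ n₀,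
      form (u m - u n) (u m - u n) + ‖(u m : Lp ℝ 2 μ) - u n‖ ^ 2 < ε) →
    ∃ v : domain, Tendsto
      (fun n => form (u n - v) (u n - v) + ‖(u n : Lp ℝ 2 μ) - v‖ ^ 2) atTop (𝓝 0)
  markov : ∀ (u : domain) (v : Lp ℝ 2 μ),
    (v =ᵐ[μ] fun x => min (max ((u : Lp ℝ 2 μ) x) 0) 1) →
    ∃ hv : v ∈ domain, form ⟨v, hv⟩ ⟨v, hv⟩ ≤ form u u

namespace SymmDirichletForm

variable {μ : Measure X} (𝓔 : SymmDirichletForm μ)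

/-- Regularity: `C₀(X) ∩ 𝓕` is dense in `𝓕` for `𝓔₁`, and dense in `C₀(X)` for the uniform norm,
where `C₀(X)` is the space of continuous functions with compact support. -/
def IsRegular [TopologicalSpace X] : Prop :=
  (∀ u : 𝓔.domain, ∀ ε > 0, ∃ (v : 𝓔.domain) (φ : X → ℝ), Continuous φ ∧ HasCompactSupport φ ∧
    (v : Lp ℝ 2 μ) =ᵐ[μ] φ ∧ 𝓔.form (u - v) (u - v) + ‖(u : Lp ℝ 2 μ) - v‖ ^ 2 < ε) ∧
  (∀ φ : X → ℝ, Continuous φ → HasCompactSupport φ → ∀ ε > 0,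
    ∃ (v : 𝓔.domain) (ψ : X → ℝ), Continuous ψ ∧ HasCompactSupport ψ ∧
      (v : Lp ℝ 2 μ) =ᵐ[μ] ψ ∧ ∀ x, |φ x - ψ x| < ε)

/-- The support of the measure `|u| dμ`. -/
def essSupport [TopologicalSpace X] (μ : Measure X) (u : X → ℝ) : Set X :=
  {x | ∀ U ∈ 𝓝 x, ¬ (u =ᵐ[μ.restrict U] 0)}

/-- Strong locality: `𝓔(u, v) = 0` whenever `u` is constant on a neighbourhood of `supp v`. -/
def IsStronglyLocal [TopologicalSpace X] : Prop :=
  ∀ (u v : 𝓔.domain) (U : Set X) (c : ℝ), IsOpen U → essSupport μ (v : Lp ℝ 2 μ) ⊆ U →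
    ((u : Lp ℝ 2 μ) =ᵐ[μ.restrict U] fun _ => c) → 𝓔.form u v = 0

/-- `Γ` is the carré du champ of `𝓔`, normalised so that `𝓔(u, v) = ∫ Γ(u, v) dμ`: a symmetric,
positive semidefinite, `L¹`-valued bilinear map on `𝓕` with
`2 ∫ h Γ(f, g) dμ = 𝓔(fh, g) + 𝓔(gh, f) - 𝓔(h, fg)` for all bounded `f, g, h ∈ 𝓕`. -/
structure IsCarreDuChamp (Γ : 𝓔.domain →ₗ[ℝ] 𝓔.domain →ₗ[ℝ] Lp ℝ 1 μ) : Prop where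
  symm : ∀ u v, Γ u v = Γ v u
  nonneg : ∀ u, ∀ᵐ x ∂μ, 0 ≤ Γ u u x
  form_eq : ∀ u v, 𝓔.form u v = ∫ x, Γ u v x ∂μ
  density : ∀ f g h fh gh fg : 𝓔.domain,
    MemLp (f : Lp ℝ 2 μ) ∞ μ → MemLp (g : Lp ℝ 2 μ) ∞ μ → MemLp (h : Lp ℝ 2 μ) ∞ μ →
    ((fh : Lp ℝ 2 μ) =ᵐ[μ] fun x => (f : Lp ℝ 2 μ) x * (h : Lp ℝ 2 μ) x) →
    ((gh : Lp ℝ 2 μ) =ᵐ[μ] fun x => (g : Lp ℝ 2 μ) x * (h : Lp ℝ 2 μ) x) →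
    ((fg : Lp ℝ 2 μ) =ᵐ[μ] fun x => (f : Lp ℝ 2 μ) x * (g : Lp ℝ 2 μ) x) →
    𝓔.form fh g + 𝓔.form gh f - 𝓔.form h fg = 2 * ∫ x, (h : Lp ℝ 2 μ) x * Γ f g x ∂μ

/-- `u ∈ 𝓕_loc`: `u` is measurable and coincides a.e. on each relatively compact open set with
some element of `𝓕`. -/
def MemLoc [TopologicalSpace X] (u : X → ℝ) : Prop :=
  Measurable u ∧ ∀ V : Set X, IsOpen V → IsCompact (closure V) →
    ∃ v : 𝓔.domain, (v : Lp ℝ 2 μ) =ᵐ[μ.restrict V] u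

/-- An element of `𝓕` that coincides a.e. on `V` with `u` (if there is one). -/
noncomputable def localRep (u : X → ℝ) (V : Set X) : 𝓔.domain :=
  Classical.epsilon fun v : 𝓔.domain => (v : Lp ℝ 2 μ) =ᵐ[μ.restrict V] u

/-- The extension of `u ↦ Γ(u, u)` to `u ∈ 𝓕_loc`. With `K₀ ⊆ K₁ ⊆ …` a compact exhaustion of `X`,
`K_n ⊆ interior K_{n+1}`, and `v_n ∈ 𝓕` equal to `u` a.e. on `interior K_{n+1}`, the value is that
of `Γ(v_n, v_n)` at the points of `K_n` outside `K_{n-1}`. By locality of `Γ` another exhaustion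
or other `v_n` change it only on a null set. -/
noncomputable def energyLoc [TopologicalSpace X] [WeaklyLocallyCompactSpace X]
    [SigmaCompactSpace X] (Γ : 𝓔.domain →ₗ[ℝ] 𝓔.domain →ₗ[ℝ] Lp ℝ 1 μ) (u : X → ℝ) : X → ℝ :=
  fun x =>
    let K := CompactExhaustion.choice X
    let v := 𝓔.localRep u (interior (K (K.find x + 1)))
    Γ v v x

/-- The graph of the generator `L` of `𝓔`: `u ∈ D(L)` and `L u = w` if and only if `u ∈ 𝓕` and
`𝓔(u, v) = (-w, v)` for all `v ∈ 𝓕`. -/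
def IsGenerator (u w : Lp ℝ 2 μ) : Prop :=
  ∃ hu : u ∈ 𝓔.domain, ∀ v : 𝓔.domain, 𝓔.form ⟨u, hu⟩ v = - inner ℝ w (v : Lp ℝ 2 μ)

/-- `(T_t)_{t ≥ 0}` is the strongly continuous contraction semigroup on `L²(X, μ)` associated with
`𝓔`, i.e. the one whose infinitesimal generator is the generator of `𝓔`. (The values of `T` at
negative times play no role.) -/
structure IsSemigroup (T : ℝ → Lp ℝ 2 μ →L[ℝ] Lp ℝ 2 μ) : Prop where
  zero : T 0 = ContinuousLinearMap.id ℝ (Lp ℝ 2 μ)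
  add : ∀ s t, 0 ≤ s → 0 ≤ t → T (s + t) = (T s).comp (T t)
  contraction : ∀ t, 0 ≤ t → ‖T t‖ ≤ 1
  continuous : ∀ f, Tendsto (fun t => T t f) (𝓝[>] 0) (𝓝 f)
  generator : ∀ u w : Lp ℝ 2 μ,
    Tendsto (fun t : ℝ => t⁻¹ • (T t u - u)) (𝓝[>] 0) (𝓝 w) ↔ 𝓔.IsGenerator u w

end SymmDirichletForm

/-- `T_t 1 = 1` a.e. for every `t > 0`, where `T_t 1 = lim T_t f_n` a.e. for
`f_n ∈ L² ∩ L^∞` with `f_n ↗ 1` a.e. -/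
def IsConservative {μ : Measure X} (T : ℝ → Lp ℝ 2 μ →L[ℝ] Lp ℝ 2 μ) : Prop :=
  ∀ t > 0, ∀ f : ℕ → Lp ℝ 2 μ, (∀ n, MemLp (f n) ∞ μ) →
    (∀ᵐ x ∂μ, Monotone fun n => f n x) →
    (∀ᵐ x ∂μ, Tendsto (fun n => f n x) atTop (𝓝 1)) →
    ∀ᵐ x ∂μ, Tendsto (fun n => T t (f n) x) atTop (𝓝 1)

end DirichletForms

/-!
Let `f` be bounded and supported in `{ρ ≤ R}`, where `ρ` is the distance to `x₀`, and let `w` be a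
function of `ρ` that equals `1` for `ρ < R`, equals its maximum `Y` for `ρ > 2n`, and satisfies
`Γ(log w, log w) ≤ Λ`. Differentiating `∫ w (T_s f)² dμ` in `s` bounds this integral, together with
the weighted dissipation `∫₀ᵗ ∫ w Γ(T_s f, T_s f) dμ ds`, by a multiple of `exp(Λ t) ‖f‖²`. Let `φ`
be a cutoff that decreases from `1` to `0` across the annulus `2n < ρ < 4n`. There `w = Y`, so the
Cauchy–Schwarz inequality gives `(T_t f - f, φ)² ≤ exp(Λ t) ‖f‖² t 𝓔(φ, φ) / Y`, where `𝓔(φ, φ)` is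
at most `n⁻²` times the measure of the annulus and the supremum of `Γ(ρ, ρ)` on it. If the right
side tends to `0` as `n → ∞`, then `∫ T_t f dμ = ∫ f dμ`, and by symmetry `T_t 1 = 1`.

It remains to choose `w`, up to a constant factor, so that `Y` beats the growth of the volume: as
`exp(λ ρ)` with `λ` proportional to `n` in (ii), as a power of `ρ + 1` with exponent proportional to
`log(2n + 1) ^ (1 - β)` in (i) for `β < 2`, and as a fixed power of `log(ρ + 1)` for `β = 2`. When
`Λ` depends on `n`, the factor `exp(Λ t)` is only affordable for small `t`, and the semigroup
property extends the conclusion to all `t`.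
-/

open scoped NNReal

section SquareIntegrable

variable {X : Type*} [MeasurableSpace X] {μ : Measure X}

theorem inner_Lp_two_eq_integral (f g : Lp ℝ 2 μ) : inner ℝ f g = ∫ x, f x * g x ∂μ := by
  simp only [L2.inner_def, RCLike.inner_apply, conj_trivial, mul_comm]

theorem integrable_mul_Lp_two (f g : Lp ℝ 2 μ) : Integrable (fun x => f x * g x) μ :=
  (Lp.memLp f).integrable_mul (Lp.memLp g)

theorem norm_sq_Lp_two_eq_integral (f : Lp ℝ 2 μ) : ‖f‖ ^ 2 = ∫ x, f x ^ 2 ∂μ := by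
  rw [← real_inner_self_eq_norm_sq, inner_Lp_two_eq_integral]
  simp only [sq]

theorem norm_sub_sq_Lp_two_eq_integral (f g : Lp ℝ 2 μ) :
    ‖f - g‖ ^ 2 = ∫ x, (f x - g x) ^ 2 ∂μ := by
  rw [norm_sq_Lp_two_eq_integral]
  refine integral_congr_ae ?_
  filter_upwards [Lp.coeFn_sub f g] with x hx
  rw [hx, Pi.sub_apply]

theorem tendsto_Lp_two_of_dominated {F : ℕ → Lp ℝ 2 μ} {G g : Lp ℝ 2 μ}
    (hbound : ∀ n, ∀ᵐ x ∂μ, |F n x| ≤ |g x|)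
    (hlim : ∀ᵐ x ∂μ, Tendsto (fun n => F n x) atTop (𝓝 (G x))) :
    Tendsto F atTop (𝓝 G) := by
  suffices h : Tendsto (fun n => ∫ x, (F n x - G x) ^ 2 ∂μ) atTop (𝓝 (∫ _, (0 : ℝ) ∂μ)) by
    rw [tendsto_iff_norm_sub_tendsto_zero]
    simpa [← norm_sub_sq_Lp_two_eq_integral] using h.sqrt
  refine tendsto_integral_of_dominated_convergence (fun x => 4 * (g x * g x))
    (fun n => ((Lp.memLp (F n)).1.sub (Lp.memLp G).1).pow 2)
    ((integrable_mul_Lp_two g g).const_mul 4) (fun n => ?_) ?_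
  · filter_upwards [ae_all_iff.2 hbound, hlim] with x hFx hlimx
    have hGx : |G x| ≤ |g x| := le_of_tendsto hlimx.abs (Eventually.of_forall hFx)
    rw [Real.norm_eq_abs, abs_pow]
    calc |F n x - G x| ^ 2 ≤ (2 * |g x|) ^ 2 := by
          gcongr
          linarith [abs_sub (F n x) (G x), hFx n]
      _ = 4 * (g x * g x) := by rw [mul_pow, sq_abs]; ring
  · filter_upwards [hlim] with x hx
    simpa using (hx.sub_const (G x)).pow 2

end SquareIntegrable

section Clip

/-- The truncation of a real number to the interval `[0, c]`. -/
def clip (c : ℝ≥0) (x : ℝ) : ℝ := min (max x 0) c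

theorem clip_nonneg (c : ℝ≥0) (x : ℝ) : 0 ≤ clip c x := le_min (le_max_right _ _) c.2

theorem clip_le (c : ℝ≥0) (x : ℝ) : clip c x ≤ c := min_le_right _ _

theorem clip_le_max (c : ℝ≥0) (x : ℝ) : clip c x ≤ max x 0 := min_le_left _ _

theorem abs_clip_le_abs (c : ℝ≥0) (x : ℝ) : |clip c x| ≤ |x| := by
  rw [abs_of_nonneg (clip_nonneg c x)]
  exact (clip_le_max c x).trans (max_le (le_abs_self x) (abs_nonneg x))

theorem clip_zero (c : ℝ≥0) : clip c 0 = 0 := by simp [clip]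

theorem clip_of_nonneg {c : ℝ≥0} {x : ℝ} (hx : 0 ≤ x) : clip c x = min x c := by
  rw [clip, max_eq_left hx]

theorem clip_of_mem_Icc {c : ℝ≥0} {x : ℝ} (hx : x ∈ Set.Icc 0 (c : ℝ)) : clip c x = x := by
  rw [clip_of_nonneg hx.1, min_eq_left hx.2]

theorem clip_of_nonpos {c : ℝ≥0} {x : ℝ} (hx : x ≤ 0) : clip c x = 0 := by
  rw [clip, max_eq_right hx, min_eq_left c.coe_nonneg]

theorem clip_of_le {c : ℝ≥0} {x : ℝ} (hx : c ≤ x) : clip c x = c := by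
  rw [clip_of_nonneg (c.coe_nonneg.trans hx), min_eq_right hx]

theorem le_clip {c : ℝ≥0} {x : ℝ} (hx : x ≤ c) : x ≤ clip c x := le_min (le_max_left _ _) hx

theorem lipschitzWith_clip (c : ℝ≥0) : LipschitzWith 1 (clip c) :=
  (LipschitzWith.id.max_const 0).min_const (c : ℝ)

theorem clip_mul {c : ℝ≥0} (x : ℝ) : clip c (c * x) = c * clip 1 x := by
  have hc : (0 : ℝ) ≤ c := c.2
  simp only [clip, mul_min_of_nonneg _ _ hc, mul_max_of_nonneg _ _ hc, NNReal.coe_one, mul_one,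
    mul_zero]

theorem clip_clip_add_mul_sub (c : ℝ≥0) (x : ℝ) {s : ℝ} (hs : 0 ≤ s) :
    clip c (clip c x + s * (x - clip c x)) = clip c x := by
  rcases le_total x 0 with hx | hx
  · rw [clip_of_nonpos hx, clip_of_nonpos (by nlinarith)]
  · rcases le_total x c with hxc | hxc
    · rw [clip_of_mem_Icc ⟨hx, hxc⟩, sub_self, mul_zero, add_zero, clip_of_mem_Icc ⟨hx, hxc⟩]
    · rw [clip_of_le hxc, clip_of_le (by nlinarith)]

theorem tendsto_clip_natCast (x : ℝ) :
    Tendsto (fun n : ℕ => clip n x) atTop (𝓝 (max x 0)) := by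
  refine tendsto_const_nhds.congr' ?_
  obtain ⟨N, hN⟩ := exists_nat_ge (max x 0)
  filter_upwards [eventually_ge_atTop N] with n hn
  exact (min_eq_left (hN.trans (by exact_mod_cast hn))).symm

variable {X : Type*} [MeasurableSpace X] {μ : Measure X}

/-- The pointwise truncation of an `Lᵖ` function to the interval `[0, c]`. -/
noncomputable def clipLp {p : ℝ≥0∞} (c : ℝ≥0) (u : Lp ℝ p μ) : Lp ℝ p μ :=
  (lipschitzWith_clip c).compLp (clip_zero c) u

theorem coeFn_clipLp {p : ℝ≥0∞} (c : ℝ≥0) (u : Lp ℝ p μ) :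
    clipLp c u =ᵐ[μ] fun x => clip c (u x) :=
  LipschitzWith.coeFn_compLp _ _ u

theorem memLp_top_clipLp {p : ℝ≥0∞} (c : ℝ≥0) (u : Lp ℝ p μ) : MemLp (clipLp c u) ∞ μ := by
  refine memLp_top_of_bound (Lp.aestronglyMeasurable _) c ?_
  filter_upwards [coeFn_clipLp c u] with x hx
  rw [hx, Real.norm_of_nonneg (clip_nonneg _ _)]
  exact clip_le _ _

theorem tendsto_clipLp_natCast (u : Lp ℝ 2 μ) :
    Tendsto (fun n : ℕ => clipLp n u) atTop (𝓝 (Lp.posPart u)) := by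
  refine tendsto_Lp_two_of_dominated (g := u) (fun n => ?_) ?_
  · filter_upwards [coeFn_clipLp n u] with x hx
    rw [hx]
    exact abs_clip_le_abs _ _
  · filter_upwards [ae_all_iff.2 fun n : ℕ => coeFn_clipLp n u, Lp.coeFn_posPart u] with x hx hpos
    simpa only [hx, hpos] using tendsto_clip_natCast (u x)

theorem abs_sub_clip_le (c : ℝ≥0) (x y : ℝ) : |x - clip c x| ≤ |x - clip c y| := by
  have hy := clip_nonneg c y
  have hyc := clip_le c y
  rcases le_total x 0 with hx | hx
  · rw [clip_of_nonpos hx, abs_of_nonpos (by linarith), abs_of_nonpos (by linarith)]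
    linarith
  rcases le_total x c with hxc | hxc
  · rw [clip_of_mem_Icc ⟨hx, hxc⟩, sub_self, abs_zero]
    exact abs_nonneg _
  · rw [clip_of_le hxc, abs_of_nonneg (by linarith), abs_of_nonneg (by linarith)]
    linarith

theorem continuous_clipLp (c : ℝ≥0) : Continuous (clipLp c : Lp ℝ 2 μ → Lp ℝ 2 μ) :=
  (lipschitzWith_clip c).continuous_compLp (clip_zero c)

theorem norm_sub_clipLp_le (c : ℝ≥0) (u v : Lp ℝ 2 μ) :
    ‖u - clipLp c u‖ ≤ ‖u - clipLp c v‖ := by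
  refine Lp.norm_le_norm_of_ae_le ?_
  filter_upwards [coeFn_clipLp c u, coeFn_clipLp c v, Lp.coeFn_sub u (clipLp c u),
    Lp.coeFn_sub u (clipLp c v)] with x hu hv hsub_u hsub_v
  rw [hsub_u, hsub_v, Pi.sub_apply, Pi.sub_apply, hu, hv]
  exact abs_sub_clip_le c _ _

theorem clipLp_nonneg (c : ℝ≥0) (u : Lp ℝ 2 μ) : 0 ≤ clipLp c u := by
  rw [← Lp.coeFn_nonneg]
  filter_upwards [coeFn_clipLp c u] with x hx
  rw [hx]
  exact clip_nonneg c _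

theorem clipLp_clipLp (c : ℝ≥0) (u : Lp ℝ 2 μ) : clipLp c (clipLp c u) = clipLp c u := by
  refine Lp.ext ?_
  filter_upwards [coeFn_clipLp c (clipLp c u), coeFn_clipLp c u] with x hclip hx
  rw [hclip, hx, clip_of_mem_Icc ⟨clip_nonneg c _, clip_le c _⟩]

theorem isClosed_ae_mem {s : Set ℝ} (hs : IsClosed s) :
    IsClosed {f : Lp ℝ 2 μ | ∀ᵐ x ∂μ, f x ∈ s} := by
  refine IsSeqClosed.isClosed fun F G hF hFG => ?_
  obtain ⟨n, -, hlim⟩ := (tendstoInMeasure_of_tendsto_Lp hFG).exists_seq_tendsto_ae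
  filter_upwards [hlim, ae_all_iff.2 hF] with x hx hmem
  exact hs.mem_of_tendsto hx (Eventually.of_forall fun i => hmem (n i))

theorem convex_ae_mem {s : Set ℝ} (hs : Convex ℝ s) :
    Convex ℝ {f : Lp ℝ 2 μ | ∀ᵐ x ∂μ, f x ∈ s} := by
  intro f hf g hg a b ha hb hab
  filter_upwards [hf, hg, Lp.coeFn_add (a • f) (b • g), Lp.coeFn_smul a f, Lp.coeFn_smul b g]
    with x hfx hgx hadd hsmul_f hsmul_g
  rw [hadd, Pi.add_apply, hsmul_f, hsmul_g]
  exact hs hfx hgx ha hb hab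

end Clip

namespace SymmDirichletForm

variable {X : Type*} [MeasurableSpace X] {μ : Measure X} (𝓔 : SymmDirichletForm μ)

theorem form_add_self (u v : 𝓔.domain) :
    𝓔.form (u + v) (u + v) = 𝓔.form u u + 2 * 𝓔.form u v + 𝓔.form v v := by
  simp only [map_add, LinearMap.add_apply]
  rw [𝓔.symm v u]; ring

theorem form_sub_self (u v : 𝓔.domain) :
    𝓔.form (u - v) (u - v) = 𝓔.form u u - 2 * 𝓔.form u v + 𝓔.form v v := by
  simp only [map_sub, LinearMap.sub_apply]
  rw [𝓔.symm v u]; ring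

theorem form_smul_self (c : ℝ) (u : 𝓔.domain) :
    𝓔.form (c • u) (c • u) = c ^ 2 * 𝓔.form u u := by
  simp only [map_smul, LinearMap.smul_apply, smul_eq_mul]; ring

theorem form_sq_le (u v : 𝓔.domain) : 𝓔.form u v ^ 2 ≤ 𝓔.form u u * 𝓔.form v v :=
  LinearMap.BilinForm.apply_sq_le_of_symm 𝓔.form 𝓔.nonneg ⟨fun u v => by simpa using 𝓔.symm u v⟩ u v

theorem abs_form_le (u v : 𝓔.domain) :
    |𝓔.form u v| ≤ √(𝓔.form u u) * √(𝓔.form v v) := by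
  rw [← Real.sqrt_mul (𝓔.nonneg u)]
  exact Real.abs_le_sqrt (𝓔.form_sq_le u v)

theorem sqrt_form_add_le (u v : 𝓔.domain) :
    √(𝓔.form (u + v) (u + v)) ≤ √(𝓔.form u u) + √(𝓔.form v v) := by
  rw [Real.sqrt_le_left (by positivity), form_add_self]
  have hcross := (le_abs_self _).trans (𝓔.abs_form_le u v)
  nlinarith [Real.sq_sqrt (𝓔.nonneg u), Real.sq_sqrt (𝓔.nonneg v)]

theorem sqrt_form_sum_le {ι : Type*} (s : Finset ι) (u : ι → 𝓔.domain) :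
    √(𝓔.form (∑ i ∈ s, u i) (∑ i ∈ s, u i)) ≤ ∑ i ∈ s, √(𝓔.form (u i) (u i)) :=
  Finset.le_sum_of_subadditive (fun u => √(𝓔.form u u)) (by simp) 𝓔.sqrt_form_add_le s u

theorem form_sub_self_le (u v : 𝓔.domain) :
    𝓔.form (u - v) (u - v) ≤ 2 * 𝓔.form u u + 2 * 𝓔.form v v := by
  have hsum := 𝓔.nonneg (u + v)
  rw [form_add_self] at hsum
  rw [form_sub_self]
  linarith

theorem tendsto_form_of_tendsto_form_sub {u : ℕ → 𝓔.domain} {w : 𝓔.domain}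
    (hu : Tendsto (fun n => 𝓔.form (u n - w) (u n - w)) atTop (𝓝 0)) (v : 𝓔.domain) :
    Tendsto (fun n => 𝓔.form v (u n)) atTop (𝓝 (𝓔.form v w)) := by
  rw [tendsto_iff_norm_sub_tendsto_zero]
  refine squeeze_zero (fun _ => norm_nonneg _) (fun n => ?_)
    (by simpa only [Real.sqrt_zero, mul_zero] using hu.sqrt.const_mul √(𝓔.form v v))
  rw [← map_sub]
  exact 𝓔.abs_form_le v (u n - w)

theorem tendsto_form_self_of_tendsto_form_sub {u : ℕ → 𝓔.domain} {w : 𝓔.domain}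
    (hu : Tendsto (fun n => 𝓔.form (u n - w) (u n - w)) atTop (𝓝 0)) :
    Tendsto (fun n => 𝓔.form (u n) (u n)) atTop (𝓝 (𝓔.form w w)) := by
  have h := (hu.add ((𝓔.tendsto_form_of_tendsto_form_sub hu w).const_mul 2)).sub_const (𝓔.form w w)
  refine (h.congr fun n => ?_).trans_eq (by ring_nf)
  rw [form_sub_self, 𝓔.symm w (u n)]
  ring

theorem exists_tendsto_form_sub {u : ℕ → 𝓔.domain} {w : Lp ℝ 2 μ} {b : ℕ → ℝ}
    (hu : Tendsto (fun n => (u n : Lp ℝ 2 μ)) atTop (𝓝 w)) (hb : Tendsto b atTop (𝓝 0))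
    (hcauchy : ∀ k m n, k ≤ m → k ≤ n → 𝓔.form (u m - u n) (u m - u n) ≤ b k) :
    ∃ z : 𝓔.domain, (z : Lp ℝ 2 μ) = w ∧
      Tendsto (fun n => 𝓔.form (u n - z) (u n - z)) atTop (𝓝 0) := by
  obtain ⟨z, hz⟩ := 𝓔.closed u fun ε hε => by
    obtain ⟨k, hk⟩ := (hb.eventually (gt_mem_nhds (half_pos hε))).exists
    obtain ⟨N, hN⟩ := Metric.cauchySeq_iff.1 hu.cauchySeq (√(ε / 2)) (by positivity)
    refine ⟨max k N, fun m hm n hn => ?_⟩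
    have hform := hcauchy k m n (le_of_max_le_left hm) (le_of_max_le_left hn)
    have hnorm := hN m (le_of_max_le_right hm) n (le_of_max_le_right hn)
    rw [dist_eq_norm, Real.lt_sqrt (norm_nonneg _)] at hnorm
    linarith
  have hnorm : Tendsto (fun n => ‖(u n : Lp ℝ 2 μ) - z‖ ^ 2) atTop (𝓝 0) :=
    squeeze_zero (fun _ => by positivity) (fun n => by linarith [𝓔.nonneg (u n - z)]) hz
  refine ⟨z, tendsto_nhds_unique ?_ hu, squeeze_zero (fun n => 𝓔.nonneg _)
    (fun n => le_add_of_nonneg_right (sq_nonneg _)) hz⟩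
  rw [tendsto_iff_norm_sub_tendsto_zero]
  simpa using hnorm.sqrt

/-- The infimum of the energy over the ball of radius `r` around `w`. Its limit as `r → 0` is the
lower semicontinuous relaxation of the energy at `w`. -/
noncomputable def relaxedEnergy (w : Lp ℝ 2 μ) (r : ℝ) : ℝ :=
  sInf ((fun v => 𝓔.form v v) '' {v : 𝓔.domain | ‖(v : Lp ℝ 2 μ) - w‖ ≤ r})

variable {𝓔} in
theorem relaxedEnergy_le {w : Lp ℝ 2 μ} {r : ℝ} {v : 𝓔.domain} (hv : ‖(v : Lp ℝ 2 μ) - w‖ ≤ r) :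
    𝓔.relaxedEnergy w r ≤ 𝓔.form v v :=
  csInf_le ⟨0, by rintro _ ⟨v, -, rfl⟩; exact 𝓔.nonneg v⟩ ⟨v, hv, rfl⟩

theorem exists_form_lt_relaxedEnergy_add (w : Lp ℝ 2 μ) {r ε : ℝ} (hr : 0 < r) (hε : 0 < ε) :
    ∃ v : 𝓔.domain, ‖(v : Lp ℝ 2 μ) - w‖ ≤ r ∧ 𝓔.form v v < 𝓔.relaxedEnergy w r + ε := by
  obtain ⟨v, hv, hvr⟩ := Metric.dense_iff.1 𝓔.dense_domain w r hr
  obtain ⟨_, ⟨v, hv, rfl⟩, hlt⟩ := exists_lt_of_csInf_lt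
    (Set.Nonempty.image _ ⟨⟨v, hvr⟩, (mem_ball_iff_norm.1 hv).le⟩)
    (lt_add_of_pos_right (𝓔.relaxedEnergy w r) hε)
  exact ⟨v, hv, hlt⟩

theorem relaxedEnergy_anti (w : Lp ℝ 2 μ) {r s : ℝ} (hr : 0 < r) (hrs : r ≤ s) :
    𝓔.relaxedEnergy w s ≤ 𝓔.relaxedEnergy w r := by
  refine le_of_forall_pos_lt_add fun ε hε => ?_
  obtain ⟨v, hv, hlt⟩ := 𝓔.exists_form_lt_relaxedEnergy_add w hr hε
  exact (relaxedEnergy_le (hv.trans hrs)).trans_lt hlt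

theorem form_sub_self_le_sub_relaxedEnergy {w : Lp ℝ 2 μ} {r : ℝ} {u v : 𝓔.domain}
    (hu : ‖(u : Lp ℝ 2 μ) - w‖ ≤ r) (hv : ‖(v : Lp ℝ 2 μ) - w‖ ≤ r) :
    𝓔.form (u - v) (u - v) ≤ 2 * 𝓔.form u u + 2 * 𝓔.form v v - 4 * 𝓔.relaxedEnergy w r := by
  have hmid : ‖(((2⁻¹ : ℝ) • (u + v) : 𝓔.domain) : Lp ℝ 2 μ) - w‖ ≤ r := by
    have h : (((2⁻¹ : ℝ) • (u + v) : 𝓔.domain) : Lp ℝ 2 μ) - w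
        = (2⁻¹ : ℝ) • ((u.1 - w) + (v.1 - w)) := by
      push_cast
      module
    rw [h, norm_smul, Real.norm_of_nonneg (by norm_num)]
    linarith [norm_add_le (u.1 - w) (v.1 - w)]
  have hle := relaxedEnergy_le hmid
  rw [form_smul_self, form_add_self] at hle
  rw [form_sub_self]
  linarith

/-- Elements that nearly minimise the energy over shrinking balls around `w` form an `𝓔`-Cauchy
sequence, by the parallelogram identity. -/
theorem mem_domain_of_relaxedEnergy_le {w : Lp ℝ 2 μ} {C : ℝ}
    (hC : ∀ r > 0, 𝓔.relaxedEnergy w r ≤ C) :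
    ∃ hw : w ∈ 𝓔.domain, 𝓔.form ⟨w, hw⟩ ⟨w, hw⟩ ≤ C := by
  let r : ℕ → ℝ := fun n => 1 / ((n : ℝ) + 1)
  have hr_pos : ∀ n, 0 < r n := fun n => by positivity
  have hr_anti : ∀ k n, k ≤ n → r n ≤ r k := fun k n h => by simp only [r]; gcongr
  have hr_lim : Tendsto r atTop (𝓝 0) := tendsto_one_div_add_atTop_nhds_zero_nat
  choose v hv hlt using fun n => 𝓔.exists_form_lt_relaxedEnergy_add w (hr_pos n) (hr_pos n)
  let m : ℕ → ℝ := fun n => 𝓔.relaxedEnergy w (r n)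
  have hm_mono : Monotone m := fun k n h => 𝓔.relaxedEnergy_anti w (hr_pos n) (hr_anti k n h)
  have hm_bdd : BddAbove (Set.range m) := ⟨C, by rintro _ ⟨n, rfl⟩; exact hC _ (hr_pos n)⟩
  let M := ⨆ n, m n
  have hform_le : ∀ k n, k ≤ n → 𝓔.form (v n) (v n) ≤ M + r k := fun k n h => by
    linarith [hlt n, le_ciSup hm_bdd n, hr_anti k n h]
  obtain ⟨z, rfl, hz⟩ := 𝓔.exists_tendsto_form_sub (b := fun k => 4 * (M - m k + r k))
    (tendsto_iff_norm_sub_tendsto_zero.2 (squeeze_zero (fun _ => norm_nonneg _) hv hr_lim))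
    (by simpa [M] using (((tendsto_atTop_ciSup hm_mono hm_bdd).const_sub M).add hr_lim).const_mul 4)
    fun k i j hi hj => by
      have hdiff := 𝓔.form_sub_self_le_sub_relaxedEnergy ((hv i).trans (hr_anti k i hi))
        ((hv j).trans (hr_anti k j hj))
      linarith [hform_le k i hi, hform_le k j hj]
  refine ⟨z.2, (le_of_tendsto_of_tendsto' (𝓔.tendsto_form_self_of_tendsto_form_sub hz)
    (by simpa using hr_lim.const_add M) fun n => hform_le n n le_rfl).trans
    (ciSup_le fun n => hC _ (hr_pos n))⟩

theorem mem_domain_of_tendsto {u : ℕ → 𝓔.domain} {w : Lp ℝ 2 μ} {C : ℝ}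
    (hu : Tendsto (fun n => (u n : Lp ℝ 2 μ)) atTop (𝓝 w)) (hC : ∀ n, 𝓔.form (u n) (u n) ≤ C) :
    ∃ hw : w ∈ 𝓔.domain, 𝓔.form ⟨w, hw⟩ ⟨w, hw⟩ ≤ C := by
  refine 𝓔.mem_domain_of_relaxedEnergy_le fun r hr => ?_
  obtain ⟨n, hn⟩ := ((tendsto_iff_norm_sub_tendsto_zero.1 hu).eventually (gt_mem_nhds hr)).exists
  exact (relaxedEnergy_le hn.le).trans (hC n)

theorem exists_relaxedEnergy_gt (w : 𝓔.domain) {ε : ℝ} (hε : 0 < ε) :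
    ∃ r > 0, 𝓔.form w w - ε < 𝓔.relaxedEnergy w r := by
  by_contra! hle
  obtain ⟨_, h⟩ := 𝓔.mem_domain_of_relaxedEnergy_le hle
  exact absurd h (not_le.2 (sub_lt_self _ hε))

theorem tendsto_form_sub_of_le {u : ℕ → 𝓔.domain} {w : 𝓔.domain}
    (hu : Tendsto (fun n => (u n : Lp ℝ 2 μ)) atTop (𝓝 w))
    (hle : ∀ n, 𝓔.form (u n) (u n) ≤ 𝓔.form w w) :
    Tendsto (fun n => 𝓔.form (u n - w) (u n - w)) atTop (𝓝 0) := by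
  refine tendsto_order.2 ⟨fun a ha => Eventually.of_forall fun n => ha.trans_le (𝓔.nonneg _),
    fun ε hε => ?_⟩
  obtain ⟨r, hr, hlt⟩ := 𝓔.exists_relaxedEnergy_gt w (ε := ε / 4) (by positivity)
  filter_upwards [(tendsto_iff_norm_sub_tendsto_zero.1 hu).eventually (gt_mem_nhds hr)] with n hn
  have hdiff := 𝓔.form_sub_self_le_sub_relaxedEnergy hn.le
    (show ‖(w : Lp ℝ 2 μ) - w‖ ≤ r by simpa using hr.le)
  linarith [hle n]

end SymmDirichletForm

theorem sub_clip {c : ℝ≥0} {x : ℝ} (hx : 0 ≤ x) : x - clip c x = max (x - c) 0 := by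
  rw [clip_of_nonneg hx, sub_inf, sub_self, sup_comm]

theorem clip_max_zero (c : ℝ≥0) (x : ℝ) : clip c (max x 0) = clip c x := by
  simp only [clip, max_assoc, max_self]

theorem abs_sum_max_sub_sq_le {δ : ℝ} (hδ : 0 ≤ δ) (k : ℕ) {x : ℝ} (hx : 0 ≤ x) (hxk : x ≤ k * δ) :
    |2 * δ * ∑ i ∈ Finset.range k, max (x - i * δ) 0 - x ^ 2| ≤ 2 * δ * x := by
  induction k generalizing x with
  | zero =>
    obtain rfl : x = 0 := le_antisymm (by simpa using hxk) hx
    simp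
  | succ k ih =>
    push_cast at hxk
    have hsum : ∑ i ∈ Finset.range (k + 1), max (x - i * δ) 0
        = x + ∑ i ∈ Finset.range k, max ((x - δ) - i * δ) 0 := by
      rw [Finset.sum_range_succ', add_comm]
      push_cast
      simp only [zero_mul, sub_zero, max_eq_left hx, add_mul, one_mul, sub_sub, add_comm δ]
    rw [hsum]
    rcases le_total 0 (x - δ) with h | h
    · have hrec := ih h (by linarith)
      rw [abs_le] at hrec ⊢
      constructor <;> nlinarith
    · have hzero : ∑ i ∈ Finset.range k, max ((x - δ) - i * δ) 0 = 0 :=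
        Finset.sum_eq_zero fun i _ => max_eq_right (by linarith [mul_nonneg i.cast_nonneg hδ])
      rw [hzero, abs_le]
      constructor <;> nlinarith

namespace SymmDirichletForm

variable {X : Type*} [MeasurableSpace X] {μ : Measure X} (𝓔 : SymmDirichletForm μ)

theorem coeFn_domain_add (u v : 𝓔.domain) : (u + v).1 =ᵐ[μ] fun x => u.1 x + v.1 x :=
  Lp.coeFn_add u.1 v.1

theorem coeFn_domain_sub (u v : 𝓔.domain) : (u - v).1 =ᵐ[μ] fun x => u.1 x - v.1 x :=
  Lp.coeFn_sub u.1 v.1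

theorem coeFn_domain_smul (c : ℝ) (u : 𝓔.domain) : (c • u).1 =ᵐ[μ] fun x => c * u.1 x :=
  Lp.coeFn_smul c u.1

theorem coeFn_domain_neg (u : 𝓔.domain) : (-u).1 =ᵐ[μ] fun x => -u.1 x :=
  Lp.coeFn_neg u.1

theorem coeFn_domain_sum {ι : Type*} (s : Finset ι) (u : ι → 𝓔.domain) :
    (∑ i ∈ s, u i).1 =ᵐ[μ] fun x => ∑ i ∈ s, (u i).1 x := by
  rw [AddSubmonoidClass.coe_finsetSum]
  filter_upwards [Lp.coeFn_finsetSum s fun i => (u i).1] with x hx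
  rw [hx, Finset.sum_apply]

variable {𝓔} in
theorem domain_ext {u v : 𝓔.domain} (h : u.1 =ᵐ[μ] v.1) : u = v :=
  Subtype.ext (Lp.ext h)

theorem clipLp_mem_domain (c : ℝ≥0) (u : 𝓔.domain) :
    ∃ h : clipLp c u.1 ∈ 𝓔.domain, 𝓔.form ⟨_, h⟩ ⟨_, h⟩ ≤ 𝓔.form u u := by
  rcases eq_or_ne c 0 with rfl | hc
  · have hzero : clipLp 0 u.1 = 0 := by
      refine Lp.ext ?_
      filter_upwards [coeFn_clipLp 0 u.1, Lp.coeFn_zero ℝ 2 μ] with x hx h0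
      rw [hx, h0]
      exact le_antisymm (clip_le 0 _) (clip_nonneg 0 _)
    refine ⟨hzero ▸ 𝓔.domain.zero_mem, ?_⟩
    calc _ = 𝓔.form 0 0 := by simp only [hzero, ZeroMemClass.zero_def]
      _ ≤ 𝓔.form u u := by simpa using 𝓔.nonneg u
  have hc' : (c : ℝ) ≠ 0 := by exact_mod_cast hc
  obtain ⟨hmem, hle⟩ := 𝓔.markov ((c : ℝ)⁻¹ • u) _ (coeFn_clipLp 1 _)
  have hclip : clipLp c u.1 = (c : ℝ) • clipLp 1 ((c : ℝ)⁻¹ • u : 𝓔.domain).1 := by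
    refine Lp.ext ?_
    filter_upwards [coeFn_clipLp c u.1, Lp.coeFn_smul (c : ℝ) (clipLp 1 ((c : ℝ)⁻¹ • u).1),
      coeFn_clipLp 1 ((c : ℝ)⁻¹ • u).1, 𝓔.coeFn_domain_smul (c : ℝ)⁻¹ u] with x h₁ h₂ h₃ h₄
    rw [h₁, h₂, Pi.smul_apply, smul_eq_mul, h₃, h₄, ← clip_mul, mul_inv_cancel_left₀ hc']
  refine ⟨hclip ▸ 𝓔.domain.smul_mem _ hmem, ?_⟩
  calc _ = 𝓔.form ((c : ℝ) • ⟨_, hmem⟩) ((c : ℝ) • ⟨_, hmem⟩) := by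
        simp only [hclip, SetLike.mk_smul_mk]
    _ ≤ (c : ℝ) ^ 2 * ((c : ℝ)⁻¹ ^ 2 * 𝓔.form u u) := by
        rw [← form_smul_self _ (c : ℝ)⁻¹, form_smul_self]
        gcongr
    _ = 𝓔.form u u := by field_simp

/-- The truncation of an element of the domain to the interval `[0, c]`. -/
noncomputable def truncate (c : ℝ≥0) (u : 𝓔.domain) : 𝓔.domain :=
  ⟨clipLp c u.1, (𝓔.clipLp_mem_domain c u).1⟩

theorem coeFn_truncate (c : ℝ≥0) (u : 𝓔.domain) :
    (𝓔.truncate c u).1 =ᵐ[μ] fun x => clip c (u.1 x) :=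
  coeFn_clipLp c u.1

theorem memLp_top_truncate (c : ℝ≥0) (u : 𝓔.domain) : MemLp (𝓔.truncate c u).1 ∞ μ :=
  memLp_top_clipLp c u.1

theorem form_truncate_le (c : ℝ≥0) (u : 𝓔.domain) :
    𝓔.form (𝓔.truncate c u) (𝓔.truncate c u) ≤ 𝓔.form u u :=
  (𝓔.clipLp_mem_domain c u).2

theorem posPart_mem_domain (u : 𝓔.domain) : Lp.posPart u.1 ∈ 𝓔.domain :=
  (𝓔.mem_domain_of_tendsto (tendsto_clipLp_natCast u.1) fun n => 𝓔.form_truncate_le n u).1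

/-- The positive part of an element of the domain. -/
noncomputable def posPart (u : 𝓔.domain) : 𝓔.domain := ⟨Lp.posPart u.1, 𝓔.posPart_mem_domain u⟩

theorem coeFn_posPart (u : 𝓔.domain) : (𝓔.posPart u).1 =ᵐ[μ] fun x => max (u.1 x) 0 :=
  Lp.coeFn_posPart u.1

theorem posPart_sub_posPart_neg (u : 𝓔.domain) : 𝓔.posPart u - 𝓔.posPart (-u) = u := by
  refine domain_ext ?_
  filter_upwards [𝓔.coeFn_domain_sub (𝓔.posPart u) (𝓔.posPart (-u)), 𝓔.coeFn_posPart u,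
    𝓔.coeFn_posPart (-u), 𝓔.coeFn_domain_neg u] with x h₁ h₂ h₃ h₄
  rw [h₁, h₂, h₃, h₄]
  exact max_zero_sub_max_neg_zero_eq_self (u.1 x)

theorem exists_abs (u : 𝓔.domain) : ∃ w : 𝓔.domain, w.1 =ᵐ[μ] fun x => |u.1 x| := by
  refine ⟨𝓔.posPart u + 𝓔.posPart (-u), ?_⟩
  filter_upwards [𝓔.coeFn_domain_add (𝓔.posPart u) (𝓔.posPart (-u)), 𝓔.coeFn_posPart u,
    𝓔.coeFn_posPart (-u), 𝓔.coeFn_domain_neg u] with x h₁ h₂ h₃ h₄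
  rw [h₁, h₂, h₃, h₄]
  exact max_zero_add_max_neg_zero_eq_abs_self (u.1 x)

theorem truncate_posPart (c : ℝ≥0) (u : 𝓔.domain) :
    𝓔.truncate c (𝓔.posPart u) = 𝓔.truncate c u := by
  refine domain_ext ?_
  filter_upwards [𝓔.coeFn_truncate c (𝓔.posPart u), 𝓔.coeFn_truncate c u, 𝓔.coeFn_posPart u]
    with x h₁ h₂ h₃
  rw [h₁, h₂, h₃, clip_max_zero]

theorem tendsto_form_truncate_sub_posPart (u : 𝓔.domain) :
    Tendsto (fun n : ℕ => 𝓔.form (𝓔.truncate n u - 𝓔.posPart u) (𝓔.truncate n u - 𝓔.posPart u))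
      atTop (𝓝 0) :=
  𝓔.tendsto_form_sub_of_le (tendsto_clipLp_natCast u.1) fun n => by
    rw [← truncate_posPart]
    exact 𝓔.form_truncate_le n _

theorem tendsto_form_truncate_sub_truncate_neg (u : 𝓔.domain) :
    Tendsto (fun n : ℕ => 𝓔.form (𝓔.truncate n u - 𝓔.truncate n (-u) - u)
      (𝓔.truncate n u - 𝓔.truncate n (-u) - u)) atTop (𝓝 0) := by
  have hbound := ((𝓔.tendsto_form_truncate_sub_posPart u).const_mul 2).add
    ((𝓔.tendsto_form_truncate_sub_posPart (-u)).const_mul 2)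
  rw [mul_zero, add_zero] at hbound
  refine squeeze_zero (fun n => 𝓔.nonneg _) (fun n => ?_) hbound
  have hdiff : 𝓔.truncate n u - 𝓔.truncate n (-u) - u = (𝓔.truncate n u - 𝓔.posPart u)
      - (𝓔.truncate n (-u) - 𝓔.posPart (-u)) := by
    rw [sub_sub_sub_comm, 𝓔.posPart_sub_posPart_neg]
  rw [hdiff]
  exact 𝓔.form_sub_self_le _ _

theorem truncate_truncate_add_smul_sub (c : ℝ≥0) (u : 𝓔.domain) {s : ℝ} (hs : 0 ≤ s) :
    𝓔.truncate c (𝓔.truncate c u + s • (u - 𝓔.truncate c u)) = 𝓔.truncate c u := by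
  refine domain_ext ?_
  filter_upwards [𝓔.coeFn_truncate c (𝓔.truncate c u + s • (u - 𝓔.truncate c u)),
    𝓔.coeFn_truncate c u, 𝓔.coeFn_domain_add (𝓔.truncate c u) (s • (u - 𝓔.truncate c u)),
    𝓔.coeFn_domain_smul s (u - 𝓔.truncate c u), 𝓔.coeFn_domain_sub u (𝓔.truncate c u)]
    with x h₁ h₂ h₃ h₄ h₅
  rw [h₁, h₃, h₄, h₅, h₂, clip_clip_add_mul_sub c _ hs]

theorem form_truncate_sub_nonneg (c : ℝ≥0) (u : 𝓔.domain) :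
    0 ≤ 𝓔.form (𝓔.truncate c u) (u - 𝓔.truncate c u) := by
  set v := 𝓔.truncate c u
  -- All points of the ray from `v` through `u` truncate to `v`, so the energy is minimal at `v`.
  have hmin : ∀ s > (0 : ℝ),
      0 ≤ 2 * 𝓔.form v (u - v) + s * 𝓔.form (u - v) (u - v) := by
    intro s hs
    have hle := 𝓔.form_truncate_le c (v + s • (u - v))
    rw [𝓔.truncate_truncate_add_smul_sub c u hs.le, form_add_self, form_smul_self, map_smul,
      smul_eq_mul] at hle
    nlinarith
  have hlim : Tendsto (fun s : ℝ => 2 * 𝓔.form v (u - v) + s * 𝓔.form (u - v) (u - v)) (𝓝[>] 0)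
      (𝓝 (2 * 𝓔.form v (u - v) + 0 * 𝓔.form (u - v) (u - v))) :=
    ((tendsto_id.mono_left nhdsWithin_le_nhds).mul_const _).const_add _
  have hnonneg := ge_of_tendsto hlim (eventually_of_mem self_mem_nhdsWithin hmin)
  linarith

theorem form_sub_truncate_le (c : ℝ≥0) (u : 𝓔.domain) :
    𝓔.form (u - 𝓔.truncate c u) (u - 𝓔.truncate c u) ≤ 𝓔.form u u := by
  have hadd := 𝓔.form_add_self (𝓔.truncate c u) (u - 𝓔.truncate c u)
  rw [add_sub_cancel] at hadd
  linarith [𝓔.nonneg (𝓔.truncate c u), 𝓔.form_truncate_sub_nonneg c u]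

theorem form_sub_truncate_nonneg (c : ℝ≥0) (u : 𝓔.domain) :
    0 ≤ 𝓔.form u (u - 𝓔.truncate c u) := by
  have hadd : 𝓔.form u (u - 𝓔.truncate c u) = 𝓔.form (𝓔.truncate c u) (u - 𝓔.truncate c u)
      + 𝓔.form (u - 𝓔.truncate c u) (u - 𝓔.truncate c u) := by
    rw [← LinearMap.add_apply, ← map_add, add_sub_cancel]
  linarith [𝓔.nonneg (u - 𝓔.truncate c u), 𝓔.form_truncate_sub_nonneg c u]

/-- A Riemann sum for `f² = ∫₀^∞ 2 (f - t)⁺ dt` with step `δ`, for nonnegative `f`. Its terms lie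
in the domain and have at most the energy of `f`. -/
noncomputable def sqRiemannSum (f : 𝓔.domain) (δ : ℝ≥0) (k : ℕ) : 𝓔.domain :=
  (2 * δ : ℝ) • ∑ i ∈ Finset.range k, (f - 𝓔.truncate (i * δ) f)

variable {𝓔} in
theorem abs_sqRiemannSum_sub_sq_le {f : 𝓔.domain} (hf : ∀ᵐ x ∂μ, 0 ≤ f.1 x) {δ : ℝ≥0} {k : ℕ}
    (hfk : ∀ᵐ x ∂μ, f.1 x ≤ k * δ) :
    ∀ᵐ x ∂μ, |(𝓔.sqRiemannSum f δ k).1 x - f.1 x ^ 2| ≤ 2 * δ * f.1 x := by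
  filter_upwards [hf, hfk,
    𝓔.coeFn_domain_smul (2 * δ) (∑ i ∈ Finset.range k, (f - 𝓔.truncate (i * δ) f)),
    𝓔.coeFn_domain_sum (Finset.range k) fun i => f - 𝓔.truncate (i * δ) f,
    ae_all_iff.2 fun i : ℕ => 𝓔.coeFn_domain_sub f (𝓔.truncate (i * δ) f),
    ae_all_iff.2 fun i : ℕ => 𝓔.coeFn_truncate (i * δ) f] with x h0 hk hsmul hsum hsub htrunc
  rw [sqRiemannSum, hsmul, hsum]
  simp only [hsub, htrunc, sub_clip h0, NNReal.coe_mul, NNReal.coe_natCast]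
  exact abs_sum_max_sub_sq_le δ.2 k h0 hk

theorem form_sqRiemannSum_le (f : 𝓔.domain) (δ : ℝ≥0) (k : ℕ) :
    𝓔.form (𝓔.sqRiemannSum f δ k) (𝓔.sqRiemannSum f δ k) ≤ (2 * (k * δ)) ^ 2 * 𝓔.form f f := by
  have hsum : √(𝓔.form (∑ i ∈ Finset.range k, (f - 𝓔.truncate (i * δ) f))
      (∑ i ∈ Finset.range k, (f - 𝓔.truncate (i * δ) f))) ≤ k * √(𝓔.form f f) := by
    refine (𝓔.sqrt_form_sum_le _ _).trans ((Finset.sum_le_card_nsmul _ _ (√(𝓔.form f f))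
      fun i _ => Real.sqrt_le_sqrt (𝓔.form_sub_truncate_le _ f)).trans ?_)
    simp
  rw [Real.sqrt_le_left (by positivity), mul_pow, Real.sq_sqrt (𝓔.nonneg f)] at hsum
  rw [sqRiemannSum, form_smul_self]
  calc _ ≤ (2 * δ : ℝ) ^ 2 * ((k : ℝ) ^ 2 * 𝓔.form f f) := by gcongr
    _ = (2 * (k * δ)) ^ 2 * 𝓔.form f f := by ring

variable {𝓔} in
theorem exists_sq_of_nonneg {f : 𝓔.domain} (hf : ∀ᵐ x ∂μ, 0 ≤ f.1 x) {c : ℝ≥0}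
    (hfc : ∀ᵐ x ∂μ, f.1 x ≤ c) : ∃ g : 𝓔.domain, g.1 =ᵐ[μ] fun x => f.1 x ^ 2 := by
  have hsq_mem : MemLp (fun x => f.1 x ^ 2) 2 μ := by
    refine (Lp.memLp f.1).of_le_mul (c := c) ((Lp.aestronglyMeasurable f.1).pow 2) ?_
    filter_upwards [hf, hfc] with x h0 hc
    rw [Real.norm_of_nonneg (by positivity), Real.norm_of_nonneg h0, sq]
    gcongr
  let δ : ℕ → ℝ≥0 := fun k => c / (k + 1)
  have hδ : ∀ k : ℕ, ((k + 1 : ℕ) : ℝ≥0) * δ k = c := fun k => by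
    simp only [δ]; push_cast; field_simp
  have hδ_lim : Tendsto (fun k => (δ k : ℝ)) atTop (𝓝 0) := by
    simpa only [δ, NNReal.coe_div, NNReal.coe_add, NNReal.coe_natCast, NNReal.coe_one,
      mul_one_div, mul_zero] using tendsto_one_div_add_atTop_nhds_zero_nat.const_mul (c : ℝ)
  have hlim : Tendsto (fun k => (𝓔.sqRiemannSum f (δ k) (k + 1)).1) atTop (𝓝 hsq_mem.toLp) := by
    rw [tendsto_iff_norm_sub_tendsto_zero]
    refine squeeze_zero (fun _ => norm_nonneg _) (fun k => ?_)
      (by simpa using (hδ_lim.const_mul 2).mul_const ‖f.1‖)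
    refine Lp.norm_le_mul_norm_of_ae_le_mul ?_
    filter_upwards [Lp.coeFn_sub (𝓔.sqRiemannSum f (δ k) (k + 1)).1 hsq_mem.toLp,
      hsq_mem.coeFn_toLp, hf, abs_sqRiemannSum_sub_sq_le hf (δ := δ k) (k := k + 1)
        (by simpa only [← NNReal.coe_natCast, ← NNReal.coe_mul, hδ] using hfc)]
      with x hsub hsq h0 hle
    rwa [hsub, Pi.sub_apply, hsq, Real.norm_of_nonneg h0]
  have henergy : ∀ k, 𝓔.form (𝓔.sqRiemannSum f (δ k) (k + 1)) (𝓔.sqRiemannSum f (δ k) (k + 1))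
      ≤ (2 * c) ^ 2 * 𝓔.form f f := fun k => by
    refine (𝓔.form_sqRiemannSum_le f (δ k) (k + 1)).trans_eq ?_
    rw [← NNReal.coe_natCast, ← NNReal.coe_mul, hδ]
  exact ⟨⟨_, (𝓔.mem_domain_of_tendsto hlim henergy).1⟩, hsq_mem.coeFn_toLp⟩

variable {𝓔} in
theorem exists_sq {u : 𝓔.domain} (hu : MemLp u.1 ∞ μ) :
    ∃ w : 𝓔.domain, w.1 =ᵐ[μ] fun x => u.1 x ^ 2 := by
  obtain ⟨v, hv⟩ := 𝓔.exists_abs u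
  obtain ⟨w, hw⟩ := exists_sq_of_nonneg (f := v) (c := ⟨lpNorm u.1 ∞ μ, lpNorm_nonneg⟩)
    (by filter_upwards [hv] with x hx; rw [hx]; positivity)
    (by filter_upwards [hv, ae_le_lpNorm_exponent_top hu] with x hx hle; rwa [hx])
  refine ⟨w, ?_⟩
  filter_upwards [hw, hv] with x h₁ h₂
  rw [h₁, h₂, sq_abs]

variable {𝓔} in
theorem exists_mul {u v : 𝓔.domain} (hu : MemLp u.1 ∞ μ) (hv : MemLp v.1 ∞ μ) :
    ∃ w : 𝓔.domain, w.1 =ᵐ[μ] (fun x => u.1 x * v.1 x) ∧ MemLp w.1 ∞ μ := by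
  obtain ⟨p, hp⟩ := exists_sq (u := u + v) ((memLp_congr_ae (𝓔.coeFn_domain_add u v)).2 (hu.add hv))
  obtain ⟨m, hm⟩ := exists_sq (u := u - v) ((memLp_congr_ae (𝓔.coeFn_domain_sub u v)).2 (hu.sub hv))
  have hmul : ((1 / 4 : ℝ) • (p - m)).1 =ᵐ[μ] fun x => u.1 x * v.1 x := by
    filter_upwards [hp, hm, 𝓔.coeFn_domain_smul (1 / 4 : ℝ) (p - m), 𝓔.coeFn_domain_sub p m,
      𝓔.coeFn_domain_add u v, 𝓔.coeFn_domain_sub u v] with x h₁ h₂ h₃ h₄ h₅ h₆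
    rw [h₃, h₄, h₁, h₂, h₅, h₆]; ring
  exact ⟨_, hmul, (memLp_congr_ae hmul).2 (hv.mul hu)⟩

end SymmDirichletForm

theorem sq_le_mul_of_forall_rat {a b c : ℝ} (h : ∀ r : ℚ, 0 ≤ a + 2 * r * b + (r : ℝ) ^ 2 * c) :
    b ^ 2 ≤ a * c := by
  have hreal : ∀ r : ℝ, 0 ≤ a + 2 * r * b + r ^ 2 * c := fun r =>
    Rat.denseRange_cast.induction_on (p := fun r : ℝ => 0 ≤ a + 2 * r * b + r ^ 2 * c) r
      (isClosed_le continuous_const (by fun_prop)) h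
  have hdiscrim := discrim_le_zero (a := c) (b := 2 * b) (c := a) fun r => by linarith [hreal r]
  rw [discrim] at hdiscrim
  linarith

namespace SymmDirichletForm

section CarreDuChamp

variable {X : Type*} [MeasurableSpace X] {μ : Measure X} {𝓔 : SymmDirichletForm μ}
  {Γ : 𝓔.domain →ₗ[ℝ] 𝓔.domain →ₗ[ℝ] Lp ℝ 1 μ}

theorem integrable_carre (Γ : 𝓔.domain →ₗ[ℝ] 𝓔.domain →ₗ[ℝ] Lp ℝ 1 μ) (u v : 𝓔.domain) :
    Integrable (fun x => Γ u v x) μ :=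
  L1.integrable_coeFn (Γ u v)

theorem integrable_mul_carre (Γ : 𝓔.domain →ₗ[ℝ] 𝓔.domain →ₗ[ℝ] Lp ℝ 1 μ) {h : X → ℝ}
    (hh : MemLp h ∞ μ) (u v : 𝓔.domain) : Integrable (fun x => h x * Γ u v x) μ :=
  (integrable_carre Γ u v).bdd_mul hh.1 (c := lpNorm h ∞ μ) (ae_le_lpNorm_exponent_top hh)

theorem IsCarreDuChamp.add_smul_self (hΓ : 𝓔.IsCarreDuChamp Γ) (u v : 𝓔.domain) (c : ℝ) :
    ∀ᵐ x ∂μ, Γ (u + c • v) (u + c • v) x = Γ u u x + 2 * c * Γ u v x + c ^ 2 * Γ v v x := by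
  have hexpand : Γ (u + c • v) (u + c • v) = Γ u u + (2 * c) • Γ u v + c ^ 2 • Γ v v := by
    simp only [map_add, map_smul, LinearMap.add_apply, LinearMap.smul_apply]
    rw [hΓ.symm v u]
    module
  rw [hexpand]
  filter_upwards [Lp.coeFn_add (Γ u u + (2 * c) • Γ u v) (c ^ 2 • Γ v v),
    Lp.coeFn_add (Γ u u) ((2 * c) • Γ u v), Lp.coeFn_smul (2 * c) (Γ u v),
    Lp.coeFn_smul (c ^ 2) (Γ v v)] with x h₁ h₂ h₃ h₄
  rw [h₁, Pi.add_apply, h₂, Pi.add_apply, h₃, h₄, Pi.smul_apply, Pi.smul_apply, smul_eq_mul,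
    smul_eq_mul]

theorem IsCarreDuChamp.sq_le (hΓ : 𝓔.IsCarreDuChamp Γ) (u v : 𝓔.domain) :
    ∀ᵐ x ∂μ, Γ u v x ^ 2 ≤ Γ u u x * Γ v v x := by
  filter_upwards [ae_all_iff.2 fun r : ℚ => hΓ.add_smul_self u v r,
    ae_all_iff.2 fun r : ℚ => hΓ.nonneg (u + (r : ℝ) • v)] with x hexpand hnonneg
  exact sq_le_mul_of_forall_rat fun r => hexpand r ▸ hnonneg r

theorem IsCarreDuChamp.sub_self_le (hΓ : 𝓔.IsCarreDuChamp Γ) (u v : 𝓔.domain) :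
    ∀ᵐ x ∂μ, Γ (u - v) (u - v) x ≤ 2 * Γ u u x + 2 * Γ v v x := by
  filter_upwards [hΓ.add_smul_self u v 1, hΓ.add_smul_self u v (-1),
    hΓ.nonneg (u + (1 : ℝ) • v)] with x hadd hsub hnonneg
  rw [neg_one_smul, ← sub_eq_add_neg] at hsub
  linarith

theorem IsCarreDuChamp.form_mul (hΓ : 𝓔.IsCarreDuChamp Γ) {f g h fg : 𝓔.domain}
    (hf : MemLp f.1 ∞ μ) (hg : MemLp g.1 ∞ μ) (hh : MemLp h.1 ∞ μ)
    (hfg : fg.1 =ᵐ[μ] fun x => f.1 x * g.1 x) :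
    𝓔.form h fg = (∫ x, f.1 x * Γ g h x ∂μ) + ∫ x, g.1 x * Γ f h x ∂μ := by
  obtain ⟨fh, hfh, -⟩ := exists_mul hf hh
  obtain ⟨gh, hgh, -⟩ := exists_mul hg hh
  have hgf := hfg.trans (ae_of_all μ fun x => mul_comm (f.1 x) (g.1 x))
  have hhf := hfh.trans (ae_of_all μ fun x => mul_comm (f.1 x) (h.1 x))
  have hhg := hgh.trans (ae_of_all μ fun x => mul_comm (g.1 x) (h.1 x))
  have hdensity_f := hΓ.density g h f fg fh gh hg hh hf hgf hhf hgh
  have hdensity_g := hΓ.density f h g fg gh fh hf hh hg hfg hhg hfh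
  linarith [𝓔.symm fg h, 𝓔.symm fh g, 𝓔.symm gh f]

end CarreDuChamp

section Cutoff

variable {X : Type*} [TopologicalSpace X] [MeasurableSpace X] {μ : Measure X}
  {𝓔 : SymmDirichletForm μ}

theorem IsRegular.exists_cutoff [RegularSpace X] [LocallyCompactSpace X] (hreg : 𝓔.IsRegular)
    {K U : Set X} (hK : IsCompact K) (hU : IsOpen U) (hKU : K ⊆ U) :
    ∃ (h : 𝓔.domain) (ψ : X → ℝ), h.1 =ᵐ[μ] ψ ∧ (∀ x, ψ x ∈ Set.Icc 0 1) ∧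
      (∀ x ∈ K, ψ x = 1) ∧ tsupport ψ ⊆ U := by
  obtain ⟨φ, hφK, hφU, hφc, -⟩ := exists_continuous_one_zero_of_isCompact hK hU.isClosed_compl
    (Set.disjoint_compl_right_iff_subset.2 hKU)
  obtain ⟨v, ψ, hψc, -, hv, hclose⟩ := hreg.2 (fun x => 2 * φ x) (by fun_prop)
    (hφc.mul_left (f' := φ) (f := fun _ => (2 : ℝ))) (1 / 2) (by norm_num)
  refine ⟨𝓔.truncate 1 (v - 𝓔.truncate 2⁻¹ v), fun x => clip 1 (ψ x - clip 2⁻¹ (ψ x)), ?_,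
    fun x => ⟨clip_nonneg _ _, clip_le _ _⟩, fun x hx => ?_, ?_⟩
  · filter_upwards [𝓔.coeFn_truncate 1 (v - 𝓔.truncate 2⁻¹ v), 𝓔.coeFn_truncate 2⁻¹ v,
      𝓔.coeFn_domain_sub v (𝓔.truncate 2⁻¹ v), hv] with x h₁ h₂ h₃ h₄
    rw [h₁, h₃, h₂, h₄]
  · have hψx := (abs_lt.1 (hclose x)).2
    have hle := clip_le 2⁻¹ (ψ x)
    rw [hφK hx, Pi.one_apply] at hψx
    push_cast at hle
    exact clip_of_le (by push_cast; linarith)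
  · have hsupport : Function.support (fun x => clip 1 (ψ x - clip 2⁻¹ (ψ x)))
        ⊆ {x | 1 / 2 ≤ ψ x} := fun x hx => by
      by_contra! hlt
      refine hx (clip_of_nonpos (sub_nonpos.2 (le_clip ?_)))
      push_cast
      linarith [not_le.1 fun h : 1 / 2 ≤ ψ x => hlt h]
    refine (closure_minimal hsupport (isClosed_le continuous_const hψc)).trans fun x hx => ?_
    by_contra hxU
    have hψx := (abs_lt.1 (hclose x)).1
    have hx : 1 / 2 ≤ ψ x := hx
    rw [hφU hxU, Pi.zero_apply] at hψx
    linarith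

theorem essSupport_subset_tsupport [OpensMeasurableSpace X] {u ψ : X → ℝ}
    (h : ∀ᵐ x ∂μ, ψ x = 0 → u x = 0) : essSupport μ u ⊆ tsupport ψ := by
  intro x hx
  by_contra hxψ
  have hopen : IsOpen (tsupport ψ)ᶜ := (isClosed_tsupport ψ).isOpen_compl
  refine hx _ (hopen.mem_nhds hxψ) ((ae_restrict_iff' hopen.measurableSet).2 ?_)
  filter_upwards [h] with y hy hyψ
  exact hy (image_eq_zero_of_notMem_tsupport hyψ)

theorem ae_of_forall_compact_subset [LocallyCompactSpace X] [SecondCountableTopology X]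
    {p : X → Prop} {U : Set X} (hU : IsOpen U)
    (h : ∀ K, IsCompact K → K ⊆ U → ∀ᵐ x ∂μ, x ∈ K → p x) : ∀ᵐ x ∂μ, x ∈ U → p x := by
  rw [ae_iff]
  refine measure_null_of_locally_null _ fun x hx => ?_
  obtain ⟨K, hK, hxK, hKU⟩ := exists_compact_subset hU (Classical.not_imp.1 hx).1
  refine ⟨K ∩ {a | ¬(a ∈ U → p a)}, inter_mem (mem_nhdsWithin_of_mem_nhds
    (mem_interior_iff_mem_nhds.1 hxK)) self_mem_nhdsWithin, ?_⟩
  refine measure_mono_null ?_ (ae_iff.1 (h K hK hKU))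
  rintro y ⟨hyK, hy⟩ hp
  exact hy fun _ => hp hyK

end Cutoff

section Locality

variable {X : Type*} [TopologicalSpace X] [T2Space X] [LocallyCompactSpace X]
  [SecondCountableTopology X] [MeasurableSpace X] [OpensMeasurableSpace X] {μ : Measure X}
  {𝓔 : SymmDirichletForm μ} {Γ : 𝓔.domain →ₗ[ℝ] 𝓔.domain →ₗ[ℝ] Lp ℝ 1 μ}

theorem IsCarreDuChamp.eq_zero_of_const_of_memLp_top (hΓ : 𝓔.IsCarreDuChamp Γ)
    (hreg : 𝓔.IsRegular) (hloc : 𝓔.IsStronglyLocal) {v : 𝓔.domain} (hv : MemLp v.1 ∞ μ)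
    {U : Set X} (hU : IsOpen U) {c : ℝ} (hvc : ∀ᵐ x ∂μ, x ∈ U → v.1 x = c) :
    ∀ᵐ x ∂μ, x ∈ U → Γ v v x = 0 := by
  refine ae_of_forall_compact_subset hU fun K hK hKU => ?_
  obtain ⟨h, ψ, hψ, hψ01, hψK, hψU⟩ := hreg.exists_cutoff hK hU hKU
  have hh : MemLp h.1 ∞ μ := by
    refine memLp_top_of_bound (Lp.aestronglyMeasurable h.1) 1 ?_
    filter_upwards [hψ] with x hx
    rw [hx, Real.norm_of_nonneg (hψ01 x).1]
    exact (hψ01 x).2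
  obtain ⟨vh, hvh, -⟩ := exists_mul hv hh
  obtain ⟨vv, hvv, -⟩ := exists_mul hv hv
  have hform_vh : 𝓔.form v vh = 0 := by
    refine hloc v vh U c hU ((essSupport_subset_tsupport (ψ := ψ) ?_).trans hψU)
      ((ae_restrict_iff' hU.measurableSet).2 hvc)
    filter_upwards [hvh, hψ] with x h₁ h₂ h₃
    rw [h₁, h₂, h₃, mul_zero]
  have hform_vv : 𝓔.form vv h = 0 := by
    refine hloc vv h U (c * c) hU ((essSupport_subset_tsupport (ψ := ψ) ?_).trans hψU)
      ((ae_restrict_iff' hU.measurableSet).2 ?_)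
    · filter_upwards [hψ] with x h₁ h₂
      rw [h₁, h₂]
    · filter_upwards [hvv, hvc] with x h₁ h₂ hx
      rw [h₁, h₂ hx]
  have hint : ∫ x, h.1 x * Γ v v x ∂μ = 0 := by
    linarith [hΓ.density v v h vh vh vv hv hv hh hvh hvh hvv, 𝓔.symm vh v, 𝓔.symm h vv]
  rw [integral_eq_zero_iff_of_nonneg_ae ?_ (integrable_mul_carre Γ hh v v)] at hint
  · filter_upwards [hint, hψ] with x hx hψx hxK
    simpa only [hψx, hψK x hxK, one_mul, Pi.zero_apply] using hx
  · filter_upwards [hψ, hΓ.nonneg v] with x hψx hx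
    rw [hψx]
    exact mul_nonneg (hψ01 x).1 hx

/-- Bounded elements with the same constancy approximate `v` in energy. -/
theorem IsCarreDuChamp.eq_zero_of_const (hΓ : 𝓔.IsCarreDuChamp Γ) (hreg : 𝓔.IsRegular)
    (hloc : 𝓔.IsStronglyLocal) {v : 𝓔.domain} {U : Set X} (hU : IsOpen U) {c : ℝ}
    (hv : ∀ᵐ x ∂μ, x ∈ U → v.1 x = c) : ∀ᵐ x ∂μ, x ∈ U → Γ v v x = 0 := by
  let w : ℕ → 𝓔.domain := fun n => 𝓔.truncate n v - 𝓔.truncate n (-v)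
  have hzero : ∀ n, ∀ᵐ x ∂μ, x ∈ U → Γ (w n) (w n) x = 0 := fun n => by
    refine hΓ.eq_zero_of_const_of_memLp_top hreg hloc
      ((memLp_congr_ae (𝓔.coeFn_domain_sub _ _)).2
        ((𝓔.memLp_top_truncate n v).sub (𝓔.memLp_top_truncate n (-v)))) hU
      (c := clip n c - clip n (-c)) ?_
    filter_upwards [𝓔.coeFn_domain_sub (𝓔.truncate n v) (𝓔.truncate n (-v)),
      𝓔.coeFn_truncate n v, 𝓔.coeFn_truncate n (-v), 𝓔.coeFn_domain_neg v, hv]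
      with x h₁ h₂ h₃ h₄ h₅ hx
    rw [h₁, h₂, h₃, h₄, h₅ hx]
  have hle : ∀ n, ∫ x in U, Γ v v x ∂μ ≤ 2 * 𝓔.form (w n - v) (w n - v) := fun n =>
    calc ∫ x in U, Γ v v x ∂μ ≤ ∫ x in U, 2 * Γ (w n - v) (w n - v) x ∂μ := by
          refine setIntegral_mono_on_ae (integrable_carre Γ _ _).integrableOn
            ((integrable_carre Γ _ _).const_mul 2).integrableOn hU.measurableSet ?_
          filter_upwards [hΓ.sub_self_le (w n) (w n - v), hzero n] with x hsub hx hxU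
          rw [sub_sub_cancel, hx hxU] at hsub
          linarith
      _ ≤ ∫ x, 2 * Γ (w n - v) (w n - v) x ∂μ := by
          refine setIntegral_le_integral ((integrable_carre Γ _ _).const_mul 2) ?_
          filter_upwards [hΓ.nonneg (w n - v)] with x hx
          exact mul_nonneg two_pos.le hx
      _ = 2 * 𝓔.form (w n - v) (w n - v) := by rw [integral_const_mul, hΓ.form_eq]
  have hint : ∫ x in U, Γ v v x ∂μ = 0 :=
    le_antisymm (ge_of_tendsto' (((𝓔.tendsto_form_truncate_sub_truncate_neg v).const_mul 2).trans_eq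
      (by rw [mul_zero])) hle) (setIntegral_nonneg_of_ae (hΓ.nonneg v))
  rw [setIntegral_eq_zero_iff_of_nonneg_ae (ae_restrict_of_ae (hΓ.nonneg v))
    (integrable_carre Γ _ _).integrableOn] at hint
  exact (ae_restrict_iff' hU.measurableSet).1 hint

theorem IsCarreDuChamp.eq_sq_mul_of_eq_affine (hΓ : 𝓔.IsCarreDuChamp Γ) (hreg : 𝓔.IsRegular)
    (hloc : 𝓔.IsStronglyLocal) {q v : 𝓔.domain} {U : Set X} (hU : IsOpen U) {α s : ℝ}
    (h : ∀ᵐ x ∂μ, x ∈ U → q.1 x = α + s * v.1 x) :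
    ∀ᵐ x ∂μ, x ∈ U → Γ q q x = s ^ 2 * Γ v v x := by
  have hdiff : ∀ᵐ x ∂μ, x ∈ U → (q - s • v).1 x = α := by
    filter_upwards [h, 𝓔.coeFn_domain_sub q (s • v), 𝓔.coeFn_domain_smul s v] with x h₁ h₂ h₃ hx
    rw [h₂, h₃, h₁ hx, add_sub_cancel_right]
  filter_upwards [hΓ.eq_zero_of_const hreg hloc hU hdiff, hΓ.add_smul_self (q - s • v) v s,
    hΓ.sq_le (q - s • v) v] with x hzero hexpand hsq hx
  rw [hzero hx, zero_mul] at hsq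
  rw [sub_add_cancel, hzero hx, pow_eq_zero_iff two_ne_zero |>.1 (hsq.antisymm (sq_nonneg _))]
    at hexpand
  rw [hexpand]
  ring

omit [T2Space X] [LocallyCompactSpace X] [SecondCountableTopology X] in
theorem MemLoc.localRep_ae {ρ : X → ℝ} (hρ : 𝓔.MemLoc ρ) {V : Set X} (hV : IsOpen V)
    (hVc : IsCompact (closure V)) : ∀ᵐ x ∂μ, x ∈ V → (𝓔.localRep ρ V).1 x = ρ x :=
  (ae_restrict_iff' hV.measurableSet).1 (Classical.epsilon_spec (hρ.2 V hV hVc))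

theorem IsCarreDuChamp.eq_sq_mul_energyLoc (hΓ : 𝓔.IsCarreDuChamp Γ) (hreg : 𝓔.IsRegular)
    (hloc : 𝓔.IsStronglyLocal) {ρ : X → ℝ} (hρ : 𝓔.MemLoc ρ) {q : 𝓔.domain} {U : Set X}
    (hU : IsOpen U) {α s : ℝ} (h : ∀ᵐ x ∂μ, x ∈ U → q.1 x = α + s * ρ x) :
    ∀ᵐ x ∂μ, x ∈ U → Γ q q x = s ^ 2 * 𝓔.energyLoc Γ ρ x := by
  set K := CompactExhaustion.choice X
  let v : ℕ → 𝓔.domain := fun n => 𝓔.localRep ρ (interior (K (n + 1)))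
  have hstage : ∀ n, ∀ᵐ x ∂μ, x ∈ U ∩ interior (K (n + 1)) →
      Γ q q x = s ^ 2 * Γ (v n) (v n) x := fun n => by
    refine hΓ.eq_sq_mul_of_eq_affine hreg hloc (hU.inter isOpen_interior) (α := α) ?_
    filter_upwards [h, hρ.localRep_ae isOpen_interior
      ((K.isCompact (n + 1)).closure_of_subset interior_subset)] with x h₁ h₂ hx
    rw [h₁ hx.1, h₂ hx.2]
  filter_upwards [ae_all_iff.2 hstage] with x hx hxU
  exact hx (K.find x) ⟨hxU, K.subset_interior_succ _ (K.mem_find x)⟩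

omit [T2Space X] [OpensMeasurableSpace X] in
theorem IsCarreDuChamp.energyLoc_nonneg (hΓ : 𝓔.IsCarreDuChamp Γ) (ρ : X → ℝ) :
    ∀ᵐ x ∂μ, 0 ≤ 𝓔.energyLoc Γ ρ x := by
  filter_upwards [ae_all_iff.2 fun n : ℕ =>
    hΓ.nonneg (𝓔.localRep ρ (interior (CompactExhaustion.choice X (n + 1))))] with x hx
  exact hx _

end Locality

end SymmDirichletForm

section Ramp

/-- The piecewise affine function that is `1` up to `a`, `0` from `b` on, and affine in between. -/
noncomputable def ramp (a b t : ℝ) : ℝ := clip 1 ((b - t) / (b - a))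

variable {a b t : ℝ}

theorem ramp_mem_Icc (a b t : ℝ) : ramp a b t ∈ Set.Icc 0 1 := ⟨clip_nonneg _ _, clip_le _ _⟩

theorem ramp_of_le (hab : a < b) (ht : t ≤ a) : ramp a b t = 1 :=
  clip_of_le <| (one_le_div (sub_pos.2 hab)).2 (by linarith)

theorem ramp_of_ge (hab : a < b) (ht : b ≤ t) : ramp a b t = 0 :=
  clip_of_nonpos <| div_nonpos_of_nonpos_of_nonneg (by linarith) (by linarith)

theorem ramp_of_mem_Icc (ht : t ∈ Set.Icc a b) : ramp a b t = (b - t) / (b - a) :=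
  clip_of_mem_Icc ⟨div_nonneg (by linarith [ht.2]) (by linarith [ht.1, ht.2]),
    div_le_one_of_le₀ (by linarith [ht.1]) (by linarith [ht.1, ht.2])⟩

end Ramp

theorem exists_measure_level_eq_zero {X : Type*} [MeasurableSpace X] {μ : Measure X} [SFinite μ]
    {ρ : X → ℝ} (hρ : Measurable ρ) {a b : ℝ} (hab : a < b) :
    ∃ c ∈ Set.Ioo a b, ∀ᵐ x ∂μ, ρ x ≠ c := by
  obtain ⟨c, hc, hmem⟩ := ((Measure.countable_meas_level_set_pos (μ := μ) hρ).dense_compl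
    ℝ).exists_mem_open isOpen_Ioo (Set.nonempty_Ioo.2 hab)
  refine ⟨c, hmem, ?_⟩
  simpa only [ae_iff, not_not, Set.mem_compl_iff, Set.mem_ofPred_eq, not_lt, nonpos_iff_eq_zero]
    using hc

theorem exists_monotone_seq_mul_lt {a b : ℝ} (hab : a ≤ b) {f g h : ℝ → ℝ}
    (hf : ContinuousOn f (Set.Icc a b)) (hg : ContinuousOn g (Set.Icc a b))
    (hh : ContinuousOn h (Set.Icc a b)) (hlt : ∀ r ∈ Set.Icc a b, f r * g r < h r) :
    ∃ t : ℕ → ℝ, t 0 = a ∧ Monotone t ∧ (∀ n, t n ∈ Set.Icc a b) ∧ (∃ m, t m = b) ∧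
      ∀ n, ∀ r ∈ Set.Icc (t n) (t (n + 1)), ∀ s ∈ Set.Icc (t n) (t (n + 1)),
        f r * g s < h (t n) := by
  have hopen : IsOpen {z : Set.Icc a b × Set.Icc a b × Set.Icc a b |
      f z.1 * g z.2.1 < h z.2.2} :=
    isOpen_lt ((hf.domRestrict.comp continuous_fst).mul
      (hg.domRestrict.comp (continuous_fst.comp continuous_snd)))
      (hh.domRestrict.comp (continuous_snd.comp continuous_snd))
  have hnear : ∀ r : Set.Icc a b, ∃ U : Set (Set.Icc a b), IsOpen U ∧ r ∈ U ∧
      ∀ x ∈ U, ∀ y ∈ U, ∀ z ∈ U, f x * g y < h z := fun r => by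
    obtain ⟨U, V, hU, hV, hrU, hrV, hUV⟩ := isOpen_prod_iff.1 hopen r (r, r) (hlt r r.2)
    obtain ⟨V₁, V₂, hV₁, hV₂, hrV₁, hrV₂, hV₁₂⟩ := isOpen_prod_iff.1 hV r r hrV
    exact ⟨U ∩ (V₁ ∩ V₂), hU.inter (hV₁.inter hV₂), ⟨hrU, hrV₁, hrV₂⟩, fun x hx y hy z hz =>
      hUV (Set.mk_mem_prod hx.1 (hV₁₂ (Set.mk_mem_prod hy.2.1 hz.2.2)))⟩
  choose U hU hrU hUlt using hnear
  obtain ⟨t, ht0, htmono, ⟨m, htm⟩, hcover⟩ := exists_monotone_Icc_subset_open_cover_Icc hab hU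
    fun r _ => Set.mem_iUnion.2 ⟨r, hrU r⟩
  refine ⟨fun n => t n, ht0, fun i j hij => htmono hij, fun n => (t n).2, ⟨m, htm m le_rfl⟩,
    fun n r hr s hs => ?_⟩
  obtain ⟨i, hi⟩ := hcover n
  have hmem : ∀ x (hx : x ∈ Set.Icc (t n : ℝ) (t (n + 1))),
      ⟨x, (t n).2.1.trans hx.1, hx.2.trans (t (n + 1)).2.2⟩ ∈ U i := fun x hx => hi hx
  exact hUlt i _ (hmem r hr) _ (hmem s hs) _ (hi ⟨le_rfl, htmono n.le_succ⟩)

namespace SymmDirichletForm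

section Exhaustion

variable {X : Type*} [TopologicalSpace X] [MeasurableSpace X] {μ : Measure X}

/-- A continuous nonnegative function of `𝓕_loc` with relatively compact sublevel sets. It takes
the place of the distance from a point. -/
structure IsExhaustion (𝓔 : SymmDirichletForm μ) (ρ : X → ℝ) : Prop where
  memLoc : 𝓔.MemLoc ρ
  continuous : Continuous ρ
  nonneg : ∀ x, 0 ≤ ρ x
  isCompact_closure : ∀ r, IsCompact (closure {x | ρ x < r})

variable {𝓔 : SymmDirichletForm μ} {ρ : X → ℝ}

theorem IsExhaustion.isOpen_lt (hρ : 𝓔.IsExhaustion ρ) (r : ℝ) : IsOpen {x | ρ x < r} :=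
  _root_.isOpen_lt hρ.continuous continuous_const

theorem IsExhaustion.isOpen_gt (hρ : 𝓔.IsExhaustion ρ) (r : ℝ) : IsOpen {x | r < ρ x} :=
  _root_.isOpen_lt continuous_const hρ.continuous

theorem IsExhaustion.measure_lt_ne_top [IsFiniteMeasureOnCompacts μ] (hρ : 𝓔.IsExhaustion ρ)
    (r : ℝ) : μ {x | ρ x < r} ≠ ∞ :=
  (measure_mono subset_closure |>.trans_lt (hρ.isCompact_closure r).measure_lt_top).ne

theorem IsExhaustion.exists_posPart_sub [RegularSpace X] [LocallyCompactSpace X]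
    [OpensMeasurableSpace X] (hρ : 𝓔.IsExhaustion ρ) (hreg : 𝓔.IsRegular) {R : ℝ} (hR : 0 ≤ R) :
    ∃ τ : 𝓔.domain, τ.1 =ᵐ[μ] fun x => max (R - ρ x) 0 := by
  obtain ⟨h, ψ, hψ, hψ01, hψK, hψV⟩ := hreg.exists_cutoff (hρ.isCompact_closure R)
    (hρ.isOpen_lt (R + 1)) (closure_minimal (fun x (hx : ρ x < R) => hx.le)
      (isClosed_le hρ.continuous continuous_const) |>.trans fun x (hx : ρ x ≤ R) =>
        lt_of_le_of_lt hx (lt_add_one R))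
  obtain ⟨v, hv⟩ := 𝓔.exists_abs (𝓔.localRep ρ {x | ρ x < R + 1})
  refine ⟨𝓔.posPart (R • h - v), ?_⟩
  filter_upwards [𝓔.coeFn_posPart (R • h - v), 𝓔.coeFn_domain_sub (R • h) v,
    𝓔.coeFn_domain_smul R h, hψ, hv,
    hρ.memLoc.localRep_ae (hρ.isOpen_lt (R + 1)) (hρ.isCompact_closure (R + 1))]
    with x hpos hsub hsmul hhψ hvx hrep
  rw [hpos, hsub, hsmul, hhψ, hvx]
  rcases lt_or_ge (ρ x) R with hlt | hge
  · rw [hψK x (subset_closure hlt), hrep (hlt.trans (lt_add_one R)), abs_of_nonneg (hρ.nonneg x),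
      mul_one]
  rw [max_eq_right (sub_nonpos.2 hge), max_eq_right (sub_nonpos.2 ?_)]
  by_cases hxV : ρ x < R + 1
  · rw [hrep hxV, abs_of_nonneg (hρ.nonneg x)]
    exact (mul_le_of_le_one_right hR (hψ01 x).2).trans hge
  · rw [image_eq_zero_of_notMem_tsupport fun hx => hxV (hψV hx), mul_zero]
    exact abs_nonneg _

theorem IsExhaustion.exists_ramp [RegularSpace X] [LocallyCompactSpace X]
    [OpensMeasurableSpace X] (hρ : 𝓔.IsExhaustion ρ) (hreg : 𝓔.IsRegular) {a b : ℝ} (hab : a < b)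
    (hb : 0 ≤ b) : ∃ φ : 𝓔.domain, φ.1 =ᵐ[μ] fun x => ramp a b (ρ x) := by
  obtain ⟨τ, hτ⟩ := hρ.exists_posPart_sub hreg hb
  refine ⟨𝓔.truncate 1 ((b - a)⁻¹ • τ), ?_⟩
  filter_upwards [𝓔.coeFn_truncate 1 ((b - a)⁻¹ • τ), 𝓔.coeFn_domain_smul (b - a)⁻¹ τ, hτ]
    with x htrunc hsmul hτx
  rw [htrunc, hsmul, hτx, mul_max_of_nonneg _ _ (inv_nonneg.2 (sub_pos.2 hab).le), mul_zero,
    clip_max_zero, ramp, inv_mul_eq_div]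

theorem IsExhaustion.eventually_ae_of_isCompact (hρ : 𝓔.IsExhaustion ρ) {K : Set X}
    (hK : IsCompact K) {P : X → Prop} (h : ∀ᵐ x ∂μ, x ∉ K → P x) :
    ∀ᶠ R in atTop, ∀ᵐ x ∂μ, R ≤ ρ x → P x := by
  obtain ⟨C, hC⟩ := hK.bddAbove_image hρ.continuous.continuousOn
  filter_upwards [eventually_gt_atTop C] with R hR
  filter_upwards [h] with x hx hRx
  exact hx fun hxK => (hR.trans_le hRx).not_ge (hC (Set.mem_image_of_mem ρ hxK))

variable [T2Space X] [LocallyCompactSpace X] [SecondCountableTopology X] [OpensMeasurableSpace X]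
  {Γ : 𝓔.domain →ₗ[ℝ] 𝓔.domain →ₗ[ℝ] Lp ℝ 1 μ}

theorem IsExhaustion.carre_ramp (hρ : 𝓔.IsExhaustion ρ) (hΓ : 𝓔.IsCarreDuChamp Γ)
    (hreg : 𝓔.IsRegular) (hloc : 𝓔.IsStronglyLocal) {a b : ℝ} (hab : a < b)
    (ha : ∀ᵐ x ∂μ, ρ x ≠ a) (hb : ∀ᵐ x ∂μ, ρ x ≠ b) {φ : 𝓔.domain}
    (hφ : ∀ᵐ x ∂μ, φ.1 x = ramp a b (ρ x)) :
    ∀ᵐ x ∂μ, Γ φ φ x =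
      (ρ ⁻¹' Set.Ioo a b).indicator (fun x => (b - a)⁻¹ ^ 2 * 𝓔.energyLoc Γ ρ x) x := by
  have hbelow := hΓ.eq_zero_of_const hreg hloc (hρ.isOpen_lt a) (c := 1) <| hφ.mono fun x hx hlt =>
    hx.trans (ramp_of_le hab (le_of_lt hlt))
  have habove := hΓ.eq_zero_of_const hreg hloc (hρ.isOpen_gt b) (c := 0) <| hφ.mono fun x hx hgt =>
    hx.trans (ramp_of_ge hab (le_of_lt hgt))
  have hbetween := hΓ.eq_sq_mul_energyLoc hreg hloc hρ.memLoc
    (isOpen_Ioo.preimage hρ.continuous) (U := ρ ⁻¹' Set.Ioo a b) (α := b / (b - a))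
    (s := -(b - a)⁻¹) <| hφ.mono fun x hx hmem => by
      rw [hx, ramp_of_mem_Icc (Set.Ioo_subset_Icc_self hmem)]
      ring
  filter_upwards [ha, hb, hbelow, habove, hbetween] with x hxa hxb hlt hgt hmem
  by_cases hx : x ∈ ρ ⁻¹' Set.Ioo a b
  · rw [Set.indicator_of_mem hx, hmem hx, neg_sq]
  · rw [Set.indicator_of_notMem hx]
    rcases hxa.lt_or_gt with hxa | hxa
    · exact hlt hxa
    · exact hgt (hxb.lt_or_gt.resolve_left fun hxb => hx ⟨hxa, hxb⟩)

/-- The ramp may not be put exactly on `[a, b]`, whose endpoints may be charged levels of `ρ`;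
shrinking the interval to uncharged levels costs at most a factor `2` in the slope. -/
theorem IsExhaustion.exists_cutoff [SFinite μ] (hρ : 𝓔.IsExhaustion ρ)
    (hΓ : 𝓔.IsCarreDuChamp Γ) (hreg : 𝓔.IsRegular) (hloc : 𝓔.IsStronglyLocal) {a b : ℝ}
    (hab : a < b) (ha : 0 ≤ a) :
    ∃ φ : 𝓔.domain, ∃ c > a, (∀ᵐ x ∂μ, φ.1 x ∈ Set.Icc 0 1) ∧ (∀ᵐ x ∂μ, ρ x < c → φ.1 x = 1) ∧
      (∀ᵐ x ∂μ, b ≤ ρ x → φ.1 x = 0) ∧ ∀ᵐ x ∂μ, Γ φ φ x ≤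
        (ρ ⁻¹' Set.Ioo a b).indicator (fun x => (2 / (b - a)) ^ 2 * 𝓔.energyLoc Γ ρ x) x := by
  obtain ⟨c, hc, hlevel_c⟩ := exists_measure_level_eq_zero (μ := μ) hρ.memLoc.1
    (show a < a + (b - a) / 4 by linarith)
  obtain ⟨d, hd, hlevel_d⟩ := exists_measure_level_eq_zero (μ := μ) hρ.memLoc.1
    (show b - (b - a) / 4 < b by linarith)
  obtain ⟨hac, hca⟩ := hc
  obtain ⟨hbd, hdb⟩ := hd
  have hcd : c < d := by linarith
  have hslope : (d - c)⁻¹ ≤ 2 / (b - a) := by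
    rw [inv_eq_one_div, div_le_div_iff₀ (sub_pos.2 hcd) (sub_pos.2 hab)]
    linarith
  obtain ⟨φ, hφ⟩ := hρ.exists_ramp hreg hcd (by linarith)
  refine ⟨φ, c, hac, ?_, ?_, ?_, ?_⟩
  · filter_upwards [hφ] with x hx
    exact hx ▸ ramp_mem_Icc c d (ρ x)
  · filter_upwards [hφ] with x hx hlt
    exact hx.trans (ramp_of_le hcd hlt.le)
  · filter_upwards [hφ] with x hx hge
    exact hx.trans (ramp_of_ge hcd (hdb.le.trans hge))
  filter_upwards [hρ.carre_ramp hΓ hreg hloc hcd hlevel_c hlevel_d hφ, hΓ.energyLoc_nonneg ρ]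
    with x hx hnonneg
  rw [hx]
  by_cases hmem : x ∈ ρ ⁻¹' Set.Ioo c d
  · rw [Set.indicator_of_mem hmem,
      Set.indicator_of_mem (Set.preimage_mono (Set.Ioo_subset_Ioo hac.le hdb.le) hmem)]
    gcongr
  · rw [Set.indicator_of_notMem hmem]
    exact Set.indicator_apply_nonneg fun _ => mul_nonneg (sq_nonneg _) hnonneg

omit [T2Space X] [OpensMeasurableSpace X] in
theorem IsCarreDuChamp.form_le_of_carre_le [IsFiniteMeasureOnCompacts μ]
    (hΓ : 𝓔.IsCarreDuChamp Γ) (hρ : 𝓔.IsExhaustion ρ) {a b c B : ℝ} {φ : 𝓔.domain}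
    (hφ : ∀ᵐ x ∂μ, Γ φ φ x ≤
      (ρ ⁻¹' Set.Ioo a b).indicator (fun x => c ^ 2 * 𝓔.energyLoc Γ ρ x) x)
    (hB : ∀ᵐ x ∂μ, a < ρ x → ρ x < b → 𝓔.energyLoc Γ ρ x ≤ B) :
    𝓔.form φ φ ≤ c ^ 2 * B * μ.real (ρ ⁻¹' Set.Ioo a b) := by
  have hmeas : MeasurableSet (ρ ⁻¹' Set.Ioo a b) := hρ.memLoc.1 measurableSet_Ioo
  have hfin : μ (ρ ⁻¹' Set.Ioo a b) ≠ ∞ :=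
    ((measure_mono fun x hx => hx.2).trans_lt (hρ.measure_lt_ne_top b).lt_top).ne
  calc 𝓔.form φ φ = ∫ x, Γ φ φ x ∂μ := hΓ.form_eq φ φ
    _ ≤ ∫ x, (ρ ⁻¹' Set.Ioo a b).indicator (fun _ => c ^ 2 * B) x ∂μ := by
        refine integral_mono_ae (integrable_carre Γ φ φ)
          ((integrable_indicator_iff hmeas).2 (integrableOn_const hfin)) ?_
        filter_upwards [hφ, hB] with x hx hxB
        refine hx.trans (Set.indicator_le_indicator' fun hmem => ?_)
        gcongr
        exact hxB hmem.1 hmem.2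
    _ = c ^ 2 * B * μ.real (ρ ⁻¹' Set.Ioo a b) := by
        rw [integral_indicator_const _ hmeas, smul_eq_mul, mul_comm]

end Exhaustion

section Weight

variable {X : Type*} [MeasurableSpace X] {μ : Measure X} {𝓔 : SymmDirichletForm μ}

/-- The function `Y + q`, with values in `[1, Y]`, is a weight of logarithmic energy at most `Λ`,
i.e. `Γ(log w, log w) ≤ Λ` for `w = Y + q`. As constants need not lie in `𝓕`, the weight is
represented by its defect `q ∈ 𝓕` from its maximal value `Y`. -/
structure IsWeight (Γ : 𝓔.domain →ₗ[ℝ] 𝓔.domain →ₗ[ℝ] Lp ℝ 1 μ) (Λ Y : ℝ) (q : 𝓔.domain) :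
    Prop where
  rate_nonneg : 0 ≤ Λ
  one_le_max : 1 ≤ Y
  one_le : ∀ᵐ x ∂μ, 1 ≤ Y + q.1 x
  nonpos : ∀ᵐ x ∂μ, q.1 x ≤ 0
  carre_le : ∀ᵐ x ∂μ, Γ q q x ≤ Λ * (Y + q.1 x) ^ 2

/-- A weight that equals `1` where `ρ < R` and attains its maximum `Y` where `a < ρ`. -/
structure IsRadialWeight (Γ : 𝓔.domain →ₗ[ℝ] 𝓔.domain →ₗ[ℝ] Lp ℝ 1 μ) (ρ : X → ℝ)
    (Λ R a Y : ℝ) (q : 𝓔.domain) : Prop extends IsWeight Γ Λ Y q where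
  eq_one : ∀ᵐ x ∂μ, ρ x < R → Y + q.1 x = 1
  eq_max : ∀ᵐ x ∂μ, a < ρ x → q.1 x = 0

variable {Γ : 𝓔.domain →ₗ[ℝ] 𝓔.domain →ₗ[ℝ] Lp ℝ 1 μ} {ρ : X → ℝ} {Λ R a b Y Y' : ℝ}
  {q : 𝓔.domain}

theorem IsWeight.memLp_top (hq : IsWeight Γ Λ Y q) : MemLp q.1 ∞ μ := by
  refine memLp_top_of_bound (Lp.aestronglyMeasurable q.1) Y ?_
  filter_upwards [hq.one_le, hq.nonpos] with x hx hx0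
  rw [Real.norm_of_nonpos hx0]
  linarith

theorem isRadialWeight_zero (hΛ : 0 ≤ Λ) (R a : ℝ) : IsRadialWeight Γ ρ Λ R a 1 0 := by
  have hzero : ∀ᵐ x ∂μ, (0 : 𝓔.domain).1 x = 0 := Lp.coeFn_zero ℝ 2 μ
  refine ⟨⟨hΛ, le_rfl, ?_, ?_, ?_⟩, ?_, ?_⟩
  · filter_upwards [hzero] with x hx
    rw [hx, add_zero]
  · filter_upwards [hzero] with x hx using hx.le
  · filter_upwards [Lp.coeFn_zero ℝ 1 μ] with x hx
    rw [map_zero, hx, Pi.zero_apply]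
    positivity
  · filter_upwards [hzero] with x hx _
    rw [hx, add_zero]
  · filter_upwards [hzero] with x hx _ using hx

theorem coeFn_domain_sub_smul (u v : 𝓔.domain) (r : ℝ) :
    ∀ᵐ x ∂μ, (u - r • v).1 x = u.1 x - r * v.1 x := by
  filter_upwards [𝓔.coeFn_domain_sub u (r • v), 𝓔.coeFn_domain_smul r v] with x hsub hsmul
  rw [hsub, hsmul]

variable [TopologicalSpace X] [T2Space X] [LocallyCompactSpace X] [SecondCountableTopology X]
  [OpensMeasurableSpace X]

/-- The correction `r • φ` only varies where the weight has already reached its maximum. -/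
theorem IsRadialWeight.carre_sub_smul_le (hq : IsRadialWeight Γ ρ Λ R a Y q)
    (hρ : 𝓔.IsExhaustion ρ) (hΓ : 𝓔.IsCarreDuChamp Γ) (hreg : 𝓔.IsRegular)
    (hloc : 𝓔.IsStronglyLocal) {φ : 𝓔.domain} {c r s : ℝ} (hac : a < c) (hr : 0 ≤ r)
    (hφ01 : ∀ᵐ x ∂μ, φ.1 x ∈ Set.Icc 0 1) (hφ1 : ∀ᵐ x ∂μ, ρ x < c → φ.1 x = 1)
    (hφΓ : ∀ᵐ x ∂μ, Γ φ φ x ≤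
      (ρ ⁻¹' Set.Ioo a b).indicator (fun x => s ^ 2 * 𝓔.energyLoc Γ ρ x) x)
    (henergy : ∀ᵐ x ∂μ, ρ x ∈ Set.Ioo a b → (s * r) ^ 2 * 𝓔.energyLoc Γ ρ x ≤ Λ * Y ^ 2) :
    ∀ᵐ x ∂μ, Γ (q - r • φ) (q - r • φ) x ≤ Λ * (Y + r + (q - r • φ).1 x) ^ 2 := by
  have hinner := hΓ.eq_sq_mul_of_eq_affine hreg hloc (hρ.isOpen_lt c) (q := q - r • φ) (v := q)
    (α := -r) (s := 1) <| by
      filter_upwards [coeFn_domain_sub_smul q φ r, hφ1] with x hx hone hlt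
      rw [hx, hone hlt]
      ring
  have houter := hΓ.eq_sq_mul_of_eq_affine hreg hloc (hρ.isOpen_gt a) (q := q - r • φ) (v := φ)
    (α := 0) (s := -r) <| by
      filter_upwards [coeFn_domain_sub_smul q φ r, hq.eq_max] with x hx hmax hgt
      rw [hx, hmax hgt]
      ring
  filter_upwards [hinner, houter, coeFn_domain_sub_smul q φ r, hq.one_le, hq.carre_le, hφ01, hφΓ,
    henergy, hq.eq_max] with x hin hout hval hone hcarre h01 hφx hen hmax
  have hrate := hq.rate_nonneg
  have hsq : (Y + q.1 x) ^ 2 ≤ (Y + r + (q - r • φ).1 x) ^ 2 :=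
    pow_le_pow_left₀ (zero_le_one.trans hone) (by rw [hval]; nlinarith [h01.2]) 2
  rcases lt_or_ge (ρ x) c with hlt | hge
  · rw [hin hlt, one_pow, one_mul]
    exact hcarre.trans (mul_le_mul_of_nonneg_left hsq hrate)
  have hgt := hac.trans_le hge
  rw [hmax hgt, add_zero] at hsq
  rw [hout hgt, neg_sq]
  by_cases hmem : x ∈ ρ ⁻¹' Set.Ioo a b
  · rw [Set.indicator_of_mem hmem] at hφx
    calc r ^ 2 * Γ φ φ x ≤ r ^ 2 * (s ^ 2 * 𝓔.energyLoc Γ ρ x) := by gcongr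
      _ = (s * r) ^ 2 * 𝓔.energyLoc Γ ρ x := by ring
      _ ≤ Λ * Y ^ 2 := hen hmem
      _ ≤ Λ * (Y + r + (q - r • φ).1 x) ^ 2 := by gcongr
  · rw [Set.indicator_of_notMem hmem] at hφx
    exact (mul_nonpos_of_nonneg_of_nonpos (sq_nonneg r) hφx).trans (by positivity)

theorem IsRadialWeight.exists_extend [SFinite μ] (hq : IsRadialWeight Γ ρ Λ R a Y q)
    (hρ : 𝓔.IsExhaustion ρ) (hΓ : 𝓔.IsCarreDuChamp Γ) (hreg : 𝓔.IsRegular)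
    (hloc : 𝓔.IsStronglyLocal) (ha : 0 ≤ a) (hRa : R ≤ a) (hab : a < b) (hY : Y ≤ Y')
    (henergy : ∀ᵐ x ∂μ, ρ x ∈ Set.Ioo a b →
      (2 * ((Y' - Y) / (b - a))) ^ 2 * 𝓔.energyLoc Γ ρ x ≤ Λ * Y ^ 2) :
    ∃ q', IsRadialWeight Γ ρ Λ R b Y' q' := by
  obtain ⟨φ, c, hac, hφ01, hφ1, hφ0, hφΓ⟩ := hρ.exists_cutoff hΓ hreg hloc hab ha
  have hval := coeFn_domain_sub_smul q φ (Y' - Y)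
  have hcarre := hq.carre_sub_smul_le hρ hΓ hreg hloc hac (sub_nonneg.2 hY) hφ01 hφ1 hφΓ <| by
    filter_upwards [henergy] with x hx hmem
    rw [div_mul_eq_mul_div, mul_div_assoc]
    exact hx hmem
  rw [add_sub_cancel] at hcarre
  refine ⟨q - (Y' - Y) • φ, ⟨hq.rate_nonneg, hq.one_le_max.trans hY, ?_, ?_, hcarre⟩, ?_, ?_⟩
  · filter_upwards [hval, hφ01, hq.one_le] with x hx hmem hone
    rw [hx]
    nlinarith [hmem.2]
  · filter_upwards [hval, hq.nonpos, hφ01] with x hx hnonpos hmem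
    rw [hx]
    nlinarith [hmem.1]
  · filter_upwards [hval, hq.eq_one, hφ1] with x hx hone hφx hlt
    rw [hx, hφx ((hlt.trans_le hRa).trans hac)]
    linarith [hone hlt]
  · filter_upwards [hval, hq.eq_max, hφ0] with x hx hmax hφx hgt
    rw [hx, hmax (hab.trans hgt), hφx hgt.le]
    ring

theorem exists_isRadialWeight [SFinite μ] (hρ : 𝓔.IsExhaustion ρ) (hΓ : 𝓔.IsCarreDuChamp Γ)
    (hreg : 𝓔.IsRegular) (hloc : 𝓔.IsStronglyLocal) {W W' B : ℝ → ℝ} (hΛ : 0 ≤ Λ) (hR : 0 ≤ R)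
    (hRa : R ≤ a) (hW : ∀ r ∈ Set.Icc R a, HasDerivAt W (W' r) r)
    (hW' : ContinuousOn W' (Set.Icc R a)) (hW'_nonneg : ∀ r ∈ Set.Icc R a, 0 ≤ W' r)
    (hWR : W R = 1) (hB : ContinuousOn B (Set.Icc R a))
    (henergy : ∀ᵐ x ∂μ, ρ x ∈ Set.Icc R a → 𝓔.energyLoc Γ ρ x ≤ B (ρ x))
    (hlt : ∀ r ∈ Set.Icc R a, (2 * W' r) ^ 2 * B r < Λ * W r ^ 2) :
    ∃ q, IsRadialWeight Γ ρ Λ R a (W a) q := by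
  have hWc : ContinuousOn W (Set.Icc R a) := fun r hr =>
    (hW r hr).continuousAt.continuousWithinAt
  obtain ⟨t, ht0, htmono, htmem, ⟨m, htm⟩, htlt⟩ := exists_monotone_seq_mul_lt hRa
    ((hW'.const_mul 2).pow 2) hB ((hWc.pow 2).const_mul Λ) hlt
  suffices hweight : ∀ n, ∃ q, IsRadialWeight Γ ρ Λ R (t n) (W (t n)) q by
    simpa only [htm] using hweight m
  intro n
  induction n with
  | zero => exact ⟨0, by simpa only [ht0, hWR] using isRadialWeight_zero hΛ R R⟩
  | succ n ih =>
    obtain ⟨q, hq⟩ := ih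
    rcases (htmono n.le_succ).eq_or_lt with heq | hlt_succ
    · exact ⟨q, heq ▸ hq⟩
    have hsub : Set.Icc (t n) (t (n + 1)) ⊆ Set.Icc R a :=
      Set.Icc_subset_Icc (htmem n).1 (htmem (n + 1)).2
    obtain ⟨ξ, hξ, hslope⟩ := exists_hasDerivAt_eq_slope W W' hlt_succ (hWc.mono hsub)
      fun r hr => hW r (hsub (Set.Ioo_subset_Icc_self hr))
    have hWmono : W (t n) ≤ W (t (n + 1)) := by
      have hslope_nonneg := hslope ▸ hW'_nonneg ξ (hsub (Set.Ioo_subset_Icc_self hξ))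
      rwa [le_div_iff₀ (sub_pos.2 hlt_succ), zero_mul, sub_nonneg] at hslope_nonneg
    refine hq.exists_extend hρ hΓ hreg hloc (hR.trans (htmem n).1) (htmem n).1 hlt_succ hWmono ?_
    filter_upwards [henergy] with x hx hmem
    have hmem' := Set.Ioo_subset_Icc_self hmem
    rw [← hslope]
    exact (mul_le_mul_of_nonneg_left (hx (hsub hmem')) (sq_nonneg _)).trans
      (htlt n ξ (Set.Ioo_subset_Icc_self hξ) _ hmem').le

theorem exists_isRadialWeight_exp [SFinite μ] (hρ : 𝓔.IsExhaustion ρ)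
    (hΓ : 𝓔.IsCarreDuChamp Γ) (hreg : 𝓔.IsRegular) (hloc : 𝓔.IsStronglyLocal)
    {g g' B : ℝ → ℝ} {Λ R a : ℝ} (hΛ : 0 ≤ Λ) (hR : 0 ≤ R) (hRa : R ≤ a)
    (hg : ∀ r ∈ Set.Icc R a, HasDerivAt g (g' r) r) (hg' : ContinuousOn g' (Set.Icc R a))
    (hg'_nonneg : ∀ r ∈ Set.Icc R a, 0 ≤ g' r) (hgR : g R = 0)
    (hB : ContinuousOn B (Set.Icc R a))
    (hE : ∀ᵐ x ∂μ, ρ x ∈ Set.Icc R a → 𝓔.energyLoc Γ ρ x ≤ B (ρ x))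
    (hlt : ∀ r ∈ Set.Icc R a, (2 * g' r) ^ 2 * B r < Λ) :
    ∃ q, IsRadialWeight Γ ρ Λ R a (Real.exp (g a)) q := by
  refine exists_isRadialWeight hρ hΓ hreg hloc (W := fun r => Real.exp (g r)) hΛ hR hRa
    (fun r hr => (hg r hr).exp)
    ((Real.continuous_exp.comp_continuousOn fun r hr =>
      (hg r hr).continuousAt.continuousWithinAt).mul hg')
    (fun r hr => mul_nonneg (Real.exp_pos _).le (hg'_nonneg r hr))
    (by rw [hgR, Real.exp_zero]) hB hE fun r hr => ?_
  calc (2 * (Real.exp (g r) * g' r)) ^ 2 * B r = (2 * g' r) ^ 2 * B r * Real.exp (g r) ^ 2 := by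
        ring
    _ < Λ * Real.exp (g r) ^ 2 := by
        gcongr
        exact hlt r hr

end Weight

end SymmDirichletForm

theorem two_mul_abs_le_add_of_sq_le_mul {a b c : ℝ} (ha : 0 ≤ a) (hb : 0 ≤ b)
    (h : c ^ 2 ≤ a * b) : 2 * |c| ≤ a + b := by
  refine le_of_sq_le_sq ?_ (add_nonneg ha hb)
  calc (2 * |c|) ^ 2 = 4 * c ^ 2 := by rw [mul_pow, sq_abs]; norm_num
    _ ≤ 4 * a * b := by linarith
    _ ≤ (a + b) ^ 2 := four_mul_le_sq_add a b

namespace SymmDirichletForm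

section WeightedEstimates

variable {X : Type*} [MeasurableSpace X] {μ : Measure X} {𝓔 : SymmDirichletForm μ}
  {Γ : 𝓔.domain →ₗ[ℝ] 𝓔.domain →ₗ[ℝ] Lp ℝ 1 μ} {Λ Y η : ℝ} {q u U φ : 𝓔.domain}

/-- Multiplication by the weight `Y + q` on `L²`. -/
noncomputable def IsWeight.mulL (hq : IsWeight Γ Λ Y q) : Lp ℝ 2 μ →L[ℝ] Lp ℝ 2 μ :=
  Y • ContinuousLinearMap.id ℝ _ +
    (ContinuousLinearMap.mul ℝ ℝ).holderL μ ∞ 2 2 hq.memLp_top.toLp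

theorem IsWeight.coeFn_mulL (hq : IsWeight Γ Λ Y q) (f : Lp ℝ 2 μ) :
    ∀ᵐ x ∂μ, hq.mulL f x = (Y + q.1 x) * f x := by
  filter_upwards [Lp.coeFn_add (Y • f)
      ((ContinuousLinearMap.mul ℝ ℝ).holder 2 hq.memLp_top.toLp f), Lp.coeFn_smul Y f,
    (ContinuousLinearMap.mul ℝ ℝ).coeFn_holder (r := 2) hq.memLp_top.toLp f,
    hq.memLp_top.coeFn_toLp] with x hadd hsmul hmul hx
  rw [add_mul, ← hx]
  exact hadd.trans (congr_arg₂ (· + ·) hsmul hmul)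

theorem IsWeight.mulL_mem_domain (hq : IsWeight Γ Λ Y q) (hu : MemLp u.1 ∞ μ) :
    hq.mulL u.1 ∈ 𝓔.domain := by
  obtain ⟨p, hp, -⟩ := exists_mul hq.memLp_top hu
  suffices h : hq.mulL u.1 = (Y • u + p).1 from h ▸ (Y • u + p).2
  refine Lp.ext ?_
  filter_upwards [hq.coeFn_mulL u.1, 𝓔.coeFn_domain_add (Y • u) p, 𝓔.coeFn_domain_smul Y u, hp]
    with x hmul hadd hsmul hpx
  rw [hmul, hadd, hsmul, hpx]
  ring

theorem IsWeight.inner_mulL_self (hq : IsWeight Γ Λ Y q) (f : Lp ℝ 2 μ) :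
    inner ℝ f (hq.mulL f) = ∫ x, (Y + q.1 x) * f x ^ 2 ∂μ := by
  rw [inner_Lp_two_eq_integral]
  refine integral_congr_ae ?_
  filter_upwards [hq.coeFn_mulL f] with x hx
  rw [hx]
  ring

theorem IsWeight.integrable_mul_sq (hq : IsWeight Γ Λ Y q) (f : Lp ℝ 2 μ) :
    Integrable (fun x => (Y + q.1 x) * f x ^ 2) μ := by
  refine (integrable_mul_Lp_two f (hq.mulL f)).congr ?_
  filter_upwards [hq.coeFn_mulL f] with x hx
  rw [hx]
  ring

theorem IsWeight.integrable_mul_carre (hq : IsWeight Γ Λ Y q) (u : 𝓔.domain) :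
    Integrable (fun x => (Y + q.1 x) * Γ u u x) μ := by
  simp only [add_mul]
  exact ((integrable_carre Γ u u).const_mul Y).add
    (SymmDirichletForm.integrable_mul_carre Γ hq.memLp_top u u)

theorem IsWeight.form_mul_eq (hq : IsWeight Γ Λ Y q) (hΓ : 𝓔.IsCarreDuChamp Γ)
    (hu : MemLp u.1 ∞ μ) (hU : U.1 = hq.mulL u.1) :
    𝓔.form u U = (∫ x, (Y + q.1 x) * Γ u u x ∂μ) + ∫ x, u.1 x * Γ q u x ∂μ := by
  have hpU : (U - Y • u).1 =ᵐ[μ] fun x => q.1 x * u.1 x := by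
    filter_upwards [𝓔.coeFn_domain_sub U (Y • u), 𝓔.coeFn_domain_smul Y u, hq.coeFn_mulL u.1]
      with x hsub hsmul hmul
    rw [hsub, hsmul, hU, hmul]
    ring
  rw [← sub_add_cancel U (Y • u), map_add, map_smul, smul_eq_mul,
    hΓ.form_mul hq.memLp_top hu hu hpU, hΓ.form_eq u u]
  simp only [add_mul]
  rw [integral_add ((integrable_carre Γ u u).const_mul Y)
    (SymmDirichletForm.integrable_mul_carre Γ hq.memLp_top u u), integral_const_mul]
  ring

theorem IsWeight.two_mul_abs_mul_carre_le (hq : IsWeight Γ Λ Y q) (hΓ : 𝓔.IsCarreDuChamp Γ)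
    (u : 𝓔.domain) :
    ∀ᵐ x ∂μ, 2 * |u.1 x * Γ q u x| ≤
      (Y + q.1 x) * Γ u u x + Λ * ((Y + q.1 x) * u.1 x ^ 2) := by
  filter_upwards [hΓ.sq_le q u, hΓ.nonneg u, hq.carre_le, hq.one_le] with x hsq hu hcarre hone
  have hrate := hq.rate_nonneg
  refine two_mul_abs_le_add_of_sq_le_mul (by positivity) (by positivity) ?_
  calc (u.1 x * Γ q u x) ^ 2 = u.1 x ^ 2 * Γ q u x ^ 2 := mul_pow _ _ _
    _ ≤ u.1 x ^ 2 * (Λ * (Y + q.1 x) ^ 2 * Γ u u x) := by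
        gcongr
        exact hsq.trans (mul_le_mul_of_nonneg_right hcarre hu)
    _ = (Y + q.1 x) * Γ u u x * (Λ * ((Y + q.1 x) * u.1 x ^ 2)) := by ring

theorem IsWeight.integral_mul_carre_le (hq : IsWeight Γ Λ Y q) (hΓ : 𝓔.IsCarreDuChamp Γ)
    (hu : MemLp u.1 ∞ μ) (hU : U.1 = hq.mulL u.1) :
    ∫ x, (Y + q.1 x) * Γ u u x ∂μ ≤ 2 * 𝓔.form u U + Λ * inner ℝ u.1 (hq.mulL u.1) := by
  have hcross : -(2 * ∫ x, u.1 x * Γ q u x ∂μ) ≤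
      (∫ x, (Y + q.1 x) * Γ u u x ∂μ) + Λ * inner ℝ u.1 (hq.mulL u.1) := by
    rw [hq.inner_mulL_self, ← integral_const_mul, ← integral_const_mul, ← integral_neg,
      ← integral_add (hq.integrable_mul_carre u) ((hq.integrable_mul_sq u.1).const_mul Λ)]
    refine integral_mono_ae ((SymmDirichletForm.integrable_mul_carre Γ hu q u).const_mul 2).neg
      ((hq.integrable_mul_carre u).add ((hq.integrable_mul_sq u.1).const_mul Λ)) ?_
    filter_upwards [hq.two_mul_abs_mul_carre_le hΓ u] with x hx
    exact (by linarith [neg_abs_le (u.1 x * Γ q u x)] : -(2 * (u.1 x * Γ q u x)) ≤ _).trans hx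
  rw [hq.form_mul_eq hΓ hu hU]
  linarith

theorem IsWeight.abs_form_le (hq : IsWeight Γ Λ Y q) (hΓ : 𝓔.IsCarreDuChamp Γ)
    (hφ : ∀ᵐ x ∂μ, Γ φ φ x = 0 ∨ q.1 x = 0) (hη : 0 < η) (u : 𝓔.domain) :
    |𝓔.form u φ| ≤ η / 2 * (∫ x, (Y + q.1 x) * Γ u u x ∂μ) + 𝓔.form φ φ / (2 * η * Y) := by
  have hY : 0 < Y := one_pos.trans_le hq.one_le_max
  have hpointwise : ∀ᵐ x ∂μ, 2 * |Γ u φ x| ≤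
      η * ((Y + q.1 x) * Γ u u x) + (η * Y)⁻¹ * Γ φ φ x := by
    filter_upwards [hΓ.sq_le u φ, hΓ.nonneg u, hΓ.nonneg φ, hφ, hq.one_le]
      with x hsq hu hφx hcases hone
    refine two_mul_abs_le_add_of_sq_le_mul (by positivity) (by positivity) (hsq.trans_eq ?_)
    rcases hcases with hzero | hzero
    · rw [hzero, mul_zero, mul_zero, mul_zero]
    · rw [hzero, add_zero]
      field_simp
  have hint := integral_mono_ae ((integrable_carre Γ u φ).abs.const_mul 2)
    (((hq.integrable_mul_carre u).const_mul η).add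
      ((integrable_carre Γ φ φ).const_mul (η * Y)⁻¹)) hpointwise
  rw [integral_const_mul, integral_add' ((hq.integrable_mul_carre u).const_mul η)
    ((integrable_carre Γ φ φ).const_mul _), integral_const_mul, integral_const_mul,
    ← hΓ.form_eq] at hint
  calc |𝓔.form u φ| ≤ ∫ x, |Γ u φ x| ∂μ := hΓ.form_eq u φ ▸ abs_integral_le_integral_abs
    _ ≤ (η * (∫ x, (Y + q.1 x) * Γ u u x ∂μ) + (η * Y)⁻¹ * 𝓔.form φ φ) / 2 := by linarith
    _ = _ := by field_simp

end WeightedEstimates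

end SymmDirichletForm

namespace SymmDirichletForm

variable {X : Type*} [MeasurableSpace X] {μ : Measure X} {𝓔 : SymmDirichletForm μ}

section Solution

variable {u v w z : Lp ℝ 2 μ} {U V W Z : ℝ → Lp ℝ 2 μ} {t : ℝ}

theorem IsGenerator.inner_eq (hu : 𝓔.IsGenerator u w) (hv : 𝓔.IsGenerator v z) :
    inner ℝ w v = inner ℝ u z := by
  obtain ⟨hu, hw⟩ := hu
  obtain ⟨hv, hz⟩ := hv
  have hsymm := 𝓔.symm ⟨u, hu⟩ ⟨v, hv⟩
  rwa [hw, hz, neg_inj, real_inner_comm u z] at hsymm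

theorem IsGenerator.inner_sub_clipLp_nonpos (hu : 𝓔.IsGenerator u w) (c : ℝ≥0) :
    inner ℝ (u - clipLp c u) w ≤ 0 := by
  obtain ⟨hu, hw⟩ := hu
  have hnonneg := 𝓔.form_sub_truncate_nonneg c ⟨u, hu⟩
  rwa [hw, neg_nonneg, real_inner_comm] at hnonneg

/-- `U` is a solution, with derivative `W`, of the heat equation `∂U/∂s = L U` on `[0, ∞)`. -/
structure IsHeatSolution (𝓔 : SymmDirichletForm μ) (U W : ℝ → Lp ℝ 2 μ) : Prop where
  hasDerivAt : ∀ s, 0 ≤ s → HasDerivAt U (W s) s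
  isGenerator : ∀ s, 0 ≤ s → 𝓔.IsGenerator (U s) (W s)

theorem IsHeatSolution.continuousOn (hU : 𝓔.IsHeatSolution U W) : ContinuousOn U (Set.Ici 0) :=
  fun s hs => (hU.hasDerivAt s hs).continuousAt.continuousWithinAt

theorem IsHeatSolution.inner_eq (hU : 𝓔.IsHeatSolution U W) (hV : 𝓔.IsHeatSolution V Z)
    (ht : 0 ≤ t) : inner ℝ (U t) (V 0) = inner ℝ (U 0) (V t) := by
  have hderiv : ∀ s ∈ Set.Icc 0 t, HasDerivAt (fun s => inner ℝ (U (t - s)) (V s)) 0 s := by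
    intro s hs
    have hts : 0 ≤ t - s := sub_nonneg.2 hs.2
    have hinner := ((hU.hasDerivAt _ hts).scomp s ((hasDerivAt_id s).const_sub t)).inner ℝ
      (hV.hasDerivAt s hs.1)
    rwa [Function.comp_apply, neg_one_smul, inner_neg_left,
      (hU.isGenerator _ hts).inner_eq (hV.isGenerator s hs.1), add_neg_cancel] at hinner
  have hconst := constant_of_has_deriv_right_zero
    (fun s hs => (hderiv s hs).continuousAt.continuousWithinAt)
    (fun s hs => (hderiv s (Set.Ico_subset_Icc_self hs)).hasDerivWithinAt) t ⟨ht, le_rfl⟩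
  simpa only [sub_self, sub_zero] using hconst.symm

/-- Since `clipLp c (U s)` is a competitor for the distance of `U z` from the range of `clipLp c`,
only the derivative of `z ↦ ‖U z - clipLp c (U s)‖²` is needed. -/
theorem IsHeatSolution.norm_sub_clipLp_le (hU : 𝓔.IsHeatSolution U W) (c : ℝ≥0) (ht : 0 ≤ t) :
    ‖U t - clipLp c (U t)‖ ≤ ‖U 0 - clipLp c (U 0)‖ := by
  have hcont : ContinuousOn U (Set.Icc 0 t) := hU.continuousOn.mono fun s hs => hs.1
  refine le_of_sq_le_sq ?_ (norm_nonneg _)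
  refine image_le_of_liminf_slope_right_le_deriv_boundary (a := 0) (b := t)
    (f := fun s => ‖U s - clipLp c (U s)‖ ^ 2) (B' := fun _ => 0)
    ((hcont.sub ((continuous_clipLp c).comp_continuousOn hcont)).norm.pow 2) le_rfl
    continuousOn_const (fun s _ => hasDerivWithinAt_const _ _ _) (fun s hs r hr => ?_) ⟨ht, le_rfl⟩
  have hderiv := ((hU.hasDerivAt s hs.1).sub_const (clipLp c (U s))).norm_sq
  have hslope := (hasDerivAt_iff_tendsto_slope.1 hderiv).mono_left
    (nhdsWithin_mono s fun z (hz : s < z) => hz.ne')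
  have hlt : 2 * inner ℝ (U s - clipLp c (U s)) (W s) < r := by
    linarith [(hU.isGenerator s hs.1).inner_sub_clipLp_nonpos c]
  refine Eventually.frequently ?_
  filter_upwards [hslope.eventually (gt_mem_nhds hlt), self_mem_nhdsWithin] with z hz hsz
  refine lt_of_le_of_lt ?_ hz
  have hzs : 0 < z - s := sub_pos.2 hsz
  rw [slope_def_field, slope_def_field]
  gcongr
  exact _root_.norm_sub_clipLp_le c _ _

end Solution

/-- The average of the orbit of `f` over `[s, s + h]`; the orbit is extended by `f` to negative
times. -/
noncomputable def avgOrbit (T : ℝ → Lp ℝ 2 μ →L[ℝ] Lp ℝ 2 μ) (f : Lp ℝ 2 μ) (h s : ℝ) :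
    Lp ℝ 2 μ :=
  h⁻¹ • ∫ r in s..(s + h), T (max r 0) f

namespace IsSemigroup

variable {T : ℝ → Lp ℝ 2 μ →L[ℝ] Lp ℝ 2 μ} {f g : Lp ℝ 2 μ} {c : ℝ≥0} {h s t : ℝ}

theorem norm_apply_le (hT : 𝓔.IsSemigroup T) (ht : 0 ≤ t) (f : Lp ℝ 2 μ) : ‖T t f‖ ≤ ‖f‖ :=
  ((T t).le_of_opNorm_le (hT.contraction t ht) f).trans_eq (one_mul _)

theorem apply_add (hT : 𝓔.IsSemigroup T) (hs : 0 ≤ s) (ht : 0 ≤ t) (f : Lp ℝ 2 μ) :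
    T (s + t) f = T s (T t f) := by
  rw [hT.add s t hs ht, ContinuousLinearMap.comp_apply]

theorem tendsto_apply (hT : 𝓔.IsSemigroup T) (f : Lp ℝ 2 μ) :
    Tendsto (fun t => T t f) (𝓝[≥] 0) (𝓝 f) := by
  rw [← Set.Ioi_insert, nhdsWithin_insert, tendsto_sup]
  refine ⟨?_, hT.continuous f⟩
  simpa only [hT.zero, ContinuousLinearMap.id_apply] using
    tendsto_pure_nhds (fun t => T t f) (0 : ℝ)

theorem dist_apply_le (hT : 𝓔.IsSemigroup T) (f : Lp ℝ 2 μ) (hs : 0 ≤ s) (ht : 0 ≤ t) :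
    dist (T s f) (T t f) ≤ dist (T |s - t| f) f := by
  wlog hst : t ≤ s generalizing s t
  · rw [dist_comm, abs_sub_comm]
    exact this ht hs (le_of_not_ge hst)
  have hadd := hT.apply_add ht (sub_nonneg.2 hst) f
  rw [add_sub_cancel] at hadd
  rw [hadd, abs_of_nonneg (sub_nonneg.2 hst), dist_eq_norm, dist_eq_norm, ← map_sub]
  exact hT.norm_apply_le ht _

theorem continuous_apply_max (hT : 𝓔.IsSemigroup T) (f : Lp ℝ 2 μ) :
    Continuous fun s => T (max s 0) f := by
  refine continuous_iff_continuousAt.2 fun s => tendsto_iff_dist_tendsto_zero.2 ?_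
  have habs : Tendsto (fun r => |max r 0 - max s 0|) (𝓝 s) (𝓝[≥] 0) :=
    tendsto_nhdsWithin_iff.2 ⟨(Continuous.tendsto' (by fun_prop) s 0 (by simp)),
      Eventually.of_forall fun r => Set.mem_Ici.2 (abs_nonneg _)⟩
  exact squeeze_zero (fun r => dist_nonneg)
    (fun r => hT.dist_apply_le f (le_max_right r 0) (le_max_right s 0))
    (tendsto_iff_dist_tendsto_zero.1 ((hT.tendsto_apply f).comp habs))

theorem hasDerivAt_avgOrbit (hT : 𝓔.IsSemigroup T) (f : Lp ℝ 2 μ) (h s : ℝ) :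
    HasDerivAt (avgOrbit T f h) (h⁻¹ • (T (max (s + h) 0) f - T (max s 0) f)) s := by
  have hcont := hT.continuous_apply_max f
  have hright := (hcont.integral_hasStrictDerivAt 0 (s + h)).hasDerivAt.comp_add_const s h
  have hleft := (hcont.integral_hasStrictDerivAt 0 s).hasDerivAt
  refine ((hright.sub hleft).const_smul h⁻¹).congr_of_eventuallyEq
    (Eventually.of_forall fun r => ?_)
  simp only [avgOrbit, Pi.smul_apply, Pi.sub_apply]
  rw [intervalIntegral.integral_interval_sub_left (hcont.intervalIntegrable _ _)
    (hcont.intervalIntegrable _ _)]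

theorem apply_avgOrbit (hT : 𝓔.IsSemigroup T) (f : Lp ℝ 2 μ) (hh : 0 ≤ h) (hs : 0 ≤ s)
    (ht : 0 ≤ t) : T t (avgOrbit T f h s) = avgOrbit T f h (s + t) := by
  have hshift : ∫ r in (s + t)..(s + t + h), T (max r 0) f =
      ∫ r in s..(s + h), T (max (r + t) 0) f := by
    rw [intervalIntegral.integral_comp_add_right fun r => T (max r 0) f, add_right_comm]
  rw [avgOrbit, avgOrbit, map_smul, hshift,
    ← (T t).intervalIntegral_comp_comm ((hT.continuous_apply_max f).intervalIntegrable _ _)]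
  congr 1
  refine intervalIntegral.integral_congr fun r hr => ?_
  rw [Set.uIcc_of_le (by linarith)] at hr
  have hr0 : 0 ≤ r := hs.trans hr.1
  simp only [max_eq_left hr0, max_eq_left (add_nonneg hr0 ht)]
  rw [add_comm r t, hT.apply_add ht hr0]

theorem isHeatSolution_avgOrbit (hT : 𝓔.IsSemigroup T) (f : Lp ℝ 2 μ) (hh : 0 ≤ h) :
    𝓔.IsHeatSolution (avgOrbit T f h)
      fun s => h⁻¹ • (T (max (s + h) 0) f - T (max s 0) f) := by
  refine ⟨fun s _ => hT.hasDerivAt_avgOrbit f h s, fun s hs => (hT.generator _ _).1 ?_⟩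
  refine (hT.hasDerivAt_avgOrbit f h s).tendsto_slope_zero_right.congr' ?_
  filter_upwards [self_mem_nhdsWithin] with t ht
  rw [hT.apply_avgOrbit f hh hs (le_of_lt ht)]

theorem tendsto_avgOrbit_zero (hT : 𝓔.IsSemigroup T) (f : Lp ℝ 2 μ) :
    Tendsto (fun h => avgOrbit T f h 0) (𝓝[>] 0) (𝓝 f) := by
  have hslope := ((hT.continuous_apply_max f).integral_hasStrictDerivAt 0
    0).hasDerivAt.tendsto_slope_zero_right
  simpa only [avgOrbit, intervalIntegral.integral_same, sub_zero, max_self, hT.zero,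
    ContinuousLinearMap.id_apply] using hslope

theorem tendsto_avgOrbit (hT : 𝓔.IsSemigroup T) (f : Lp ℝ 2 μ) (ht : 0 ≤ t) :
    Tendsto (fun h => avgOrbit T f h t) (𝓝[>] 0) (𝓝 (T t f)) := by
  refine (((T t).continuous.tendsto f).comp (hT.tendsto_avgOrbit_zero f)).congr' ?_
  filter_upwards [self_mem_nhdsWithin] with h hh
  rw [Function.comp_apply, hT.apply_avgOrbit f (le_of_lt hh) le_rfl ht, zero_add]

theorem inner_apply_left (hT : 𝓔.IsSemigroup T) (ht : 0 ≤ t) (f g : Lp ℝ 2 μ) :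
    inner ℝ (T t f) g = inner ℝ f (T t g) := by
  refine tendsto_nhds_unique ((hT.tendsto_avgOrbit f ht).inner (hT.tendsto_avgOrbit_zero g))
    (((hT.tendsto_avgOrbit_zero f).inner (hT.tendsto_avgOrbit g ht)).congr' ?_)
  filter_upwards [self_mem_nhdsWithin] with h hh
  exact ((hT.isHeatSolution_avgOrbit f (le_of_lt hh)).inner_eq
    (hT.isHeatSolution_avgOrbit g (le_of_lt hh)) ht).symm

theorem norm_sub_clipLp_apply_le (hT : 𝓔.IsSemigroup T) (ht : 0 ≤ t) (c : ℝ≥0) (f : Lp ℝ 2 μ) :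
    ‖T t f - clipLp c (T t f)‖ ≤ ‖f - clipLp c f‖ := by
  have hlim : ∀ s, 0 ≤ s → Tendsto
      (fun h => ‖avgOrbit T f h s - clipLp c (avgOrbit T f h s)‖) (𝓝[>] 0)
      (𝓝 ‖T s f - clipLp c (T s f)‖) := fun s hs =>
    ((continuous_id.sub (continuous_clipLp c)).norm.tendsto _).comp (hT.tendsto_avgOrbit f hs)
  have hlim_zero := hlim 0 le_rfl
  rw [hT.zero] at hlim_zero
  refine le_of_tendsto_of_tendsto (hlim t ht) hlim_zero ?_
  filter_upwards [self_mem_nhdsWithin] with h hh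
  exact (hT.isHeatSolution_avgOrbit f (le_of_lt hh)).norm_sub_clipLp_le c ht

theorem clipLp_apply_clipLp (hT : 𝓔.IsSemigroup T) (ht : 0 ≤ t) (c : ℝ≥0) (f : Lp ℝ 2 μ) :
    clipLp c (T t (clipLp c f)) = T t (clipLp c f) := by
  have hle := hT.norm_sub_clipLp_apply_le ht c (clipLp c f)
  rw [clipLp_clipLp, sub_self, norm_zero, norm_le_zero_iff, sub_eq_zero] at hle
  exact hle.symm

theorem apply_nonneg (hT : 𝓔.IsSemigroup T) (ht : 0 ≤ t) (hf : 0 ≤ f) : 0 ≤ T t f := by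
  have hlim := tendsto_clipLp_natCast f
  rw [show Lp.posPart f = f from Lp.ext ?_] at hlim
  · refine ge_of_tendsto' (((T t).continuous.tendsto f).comp hlim) fun n => ?_
    rw [Function.comp_apply, ← hT.clipLp_apply_clipLp ht]
    exact clipLp_nonneg _ _
  · filter_upwards [Lp.coeFn_posPart f, (Lp.coeFn_nonneg f).2 hf] with x hpos hx
    exact hpos.trans (max_eq_left hx)

theorem apply_mono (hT : 𝓔.IsSemigroup T) (ht : 0 ≤ t) (hfg : f ≤ g) : T t f ≤ T t g := by
  rw [← sub_nonneg, ← map_sub]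
  exact hT.apply_nonneg ht (sub_nonneg.2 hfg)

theorem apply_le (hT : 𝓔.IsSemigroup T) (ht : 0 ≤ t) (hf : ∀ᵐ x ∂μ, f x ≤ c) :
    ∀ᵐ x ∂μ, T t f x ≤ c := by
  have hle : f ≤ clipLp c f := by
    rw [← Lp.coeFn_le]
    filter_upwards [hf, coeFn_clipLp c f] with x hx hclip
    exact hclip ▸ le_clip hx
  filter_upwards [(Lp.coeFn_le _ _).2 (hT.apply_mono ht hle),
    coeFn_clipLp c (T t (clipLp c f))] with x hx hclip
  rw [hT.clipLp_apply_clipLp ht] at hclip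
  exact hx.trans (hclip.trans_le (clip_le c _))

theorem abs_apply_le (hT : 𝓔.IsSemigroup T) (ht : 0 ≤ t) (hf : ∀ᵐ x ∂μ, |f x| ≤ c) :
    ∀ᵐ x ∂μ, |T t f x| ≤ c := by
  have hneg := hT.apply_le ht (f := -f) (c := c) <| by
    filter_upwards [hf, Lp.coeFn_neg f] with x hx hneg
    exact hneg.trans_le ((neg_le_abs _).trans hx)
  rw [map_neg] at hneg
  filter_upwards [hneg, Lp.coeFn_neg (T t f),
    hT.apply_le ht (hf.mono fun x hx => (le_abs_self _).trans hx)] with x hx hneg_apply hle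
  rw [hneg_apply, Pi.neg_apply] at hx
  exact abs_le'.2 ⟨hle, hx⟩

theorem abs_avgOrbit_le (hT : 𝓔.IsSemigroup T) (hh : 0 < h) (s : ℝ)
    (hf : ∀ᵐ x ∂μ, |f x| ≤ c) : ∀ᵐ x ∂μ, |avgOrbit T f h s x| ≤ c := by
  have hmem : (⨍ r in s..(s + h), T (max r 0) f) ∈
      {g : Lp ℝ 2 μ | ∀ᵐ x ∂μ, g x ∈ Set.Icc (-c : ℝ) c} := by
    refine (convex_ae_mem (convex_Icc _ _)).set_average_mem (isClosed_ae_mem isClosed_Icc) ?_ ?_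
      (Eventually.of_forall fun r => ?_)
      ((hT.continuous_apply_max f).intervalIntegrable s (s + h)).def'
    · rw [Set.uIoc_of_le (by linarith), Real.volume_Ioc, add_sub_cancel_left]
      simpa using hh
    · rw [Set.uIoc_of_le (by linarith), Real.volume_Ioc]
      exact ENNReal.ofReal_ne_top
    · filter_upwards [hT.abs_apply_le (le_max_right r 0) hf] with x hx using abs_le.1 hx
  rw [interval_average_eq, add_sub_cancel_left] at hmem
  filter_upwards [hmem] with x hx using abs_le.2 hx

end IsSemigroup

variable {Γ : 𝓔.domain →ₗ[ℝ] 𝓔.domain →ₗ[ℝ] Lp ℝ 1 μ} {Λ Y η s t : ℝ} {q φ : 𝓔.domain}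

namespace IsWeight

theorem inner_mulL_comm (hq : IsWeight Γ Λ Y q) (f g : Lp ℝ 2 μ) :
    inner ℝ f (hq.mulL g) = inner ℝ g (hq.mulL f) := by
  rw [inner_Lp_two_eq_integral, inner_Lp_two_eq_integral]
  refine integral_congr_ae ?_
  filter_upwards [hq.coeFn_mulL f, hq.coeFn_mulL g] with x hf hg
  rw [hf, hg]
  ring

theorem inner_mulL_self_nonneg (hq : IsWeight Γ Λ Y q) (f : Lp ℝ 2 μ) :
    0 ≤ inner ℝ f (hq.mulL f) := by
  rw [hq.inner_mulL_self]
  refine integral_nonneg_of_ae ?_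
  filter_upwards [hq.one_le] with x hx
  exact mul_nonneg (zero_le_one.trans hx) (sq_nonneg _)

theorem inner_mulL_self_eq_norm_sq (hq : IsWeight Γ Λ Y q) {f : Lp ℝ 2 μ}
    (hf : ∀ᵐ x ∂μ, f x = 0 ∨ Y + q.1 x = 1) : inner ℝ f (hq.mulL f) = ‖f‖ ^ 2 := by
  rw [hq.inner_mulL_self, norm_sq_Lp_two_eq_integral]
  refine integral_congr_ae ?_
  filter_upwards [hf] with x hx
  rcases hx with hx | hx <;> simp [hx]

theorem inner_add_mul_le (hq : IsWeight Γ Λ Y q) (hΓ : 𝓔.IsCarreDuChamp Γ)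
    (hφ : ∀ᵐ x ∂μ, Γ φ φ x = 0 ∨ q.1 x = 0) (hη : 0 < η) {u w : Lp ℝ 2 μ} (hu : MemLp u ∞ μ)
    (hw : 𝓔.IsGenerator u w) {θ : ℝ} (hθ : 1 ≤ θ) :
    inner ℝ w φ.1 + η / 2 * θ * (2 * inner ℝ w (hq.mulL u) - Λ * inner ℝ u (hq.mulL u)) ≤
      𝓔.form φ φ / (2 * η * Y) := by
  obtain ⟨hmem, hw⟩ := hw
  have henergy_nonneg : 0 ≤ ∫ x, (Y + q.1 x) * Γ ⟨u, hmem⟩ ⟨u, hmem⟩ x ∂μ := by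
    refine integral_nonneg_of_ae ?_
    filter_upwards [hq.one_le, hΓ.nonneg ⟨u, hmem⟩] with x hx hcarre
    exact mul_nonneg (zero_le_one.trans hx) hcarre
  have hweighted := hq.integral_mul_carre_le hΓ (u := ⟨u, hmem⟩) hu
    (U := ⟨_, hq.mulL_mem_domain (u := ⟨u, hmem⟩) hu⟩) rfl
  have hcutoff := hq.abs_form_le hΓ hφ hη ⟨u, hmem⟩
  rw [hw] at hweighted
  rw [hw, abs_neg] at hcutoff
  set D := ∫ x, (Y + q.1 x) * Γ ⟨u, hmem⟩ ⟨u, hmem⟩ x ∂μ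
  calc inner ℝ w φ.1 + η / 2 * θ * (2 * inner ℝ w (hq.mulL u) - Λ * inner ℝ u (hq.mulL u))
      ≤ |inner ℝ w φ.1| + η / 2 * θ * -D := by
        gcongr
        · exact le_abs_self _
        · linarith
    _ ≤ |inner ℝ w φ.1| + η / 2 * -D := by nlinarith [mul_nonneg hη.le henergy_nonneg]
    _ ≤ 𝓔.form φ φ / (2 * η * Y) := by linarith

end IsWeight

namespace IsHeatSolution

variable {U W : ℝ → Lp ℝ 2 μ}

theorem hasDerivAt_inner_mulL (hU : 𝓔.IsHeatSolution U W) (hq : IsWeight Γ Λ Y q)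
    (hs : 0 ≤ s) :
    HasDerivAt (fun s => inner ℝ (U s) (hq.mulL (U s))) (2 * inner ℝ (W s) (hq.mulL (U s))) s := by
  refine ((hU.hasDerivAt s hs).inner ℝ
    (hq.mulL.hasFDerivAt.comp_hasDerivAt s (hU.hasDerivAt s hs))).congr_deriv ?_
  rw [hq.inner_mulL_comm (U s) (W s), Function.comp_apply, two_mul]

theorem hasDerivAt_inner_add_exp_mul (hU : 𝓔.IsHeatSolution U W) (hq : IsWeight Γ Λ Y q)
    (φ : 𝓔.domain) (η t : ℝ) (hs : 0 ≤ s) :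
    HasDerivAt
      (fun s => inner ℝ (U s) φ.1 +
        η / 2 * Real.exp (Λ * (t - s)) * inner ℝ (U s) (hq.mulL (U s)))
      (inner ℝ (W s) φ.1 + η / 2 * Real.exp (Λ * (t - s)) *
        (2 * inner ℝ (W s) (hq.mulL (U s)) - Λ * inner ℝ (U s) (hq.mulL (U s)))) s := by
  have hexp := ((((hasDerivAt_id s).const_sub t).const_mul Λ).exp).const_mul (η / 2)
  have hinner := (hU.hasDerivAt s hs).inner ℝ (hasDerivAt_const s φ.1)
  refine (hinner.add (hexp.mul (hU.hasDerivAt_inner_mulL hq hs))).congr_deriv ?_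
  rw [inner_zero_right, id_eq]
  ring

theorem inner_le (hU : 𝓔.IsHeatSolution U W) (hbdd : ∀ s, 0 ≤ s → MemLp (U s) ∞ μ)
    (hq : IsWeight Γ Λ Y q) (hΓ : 𝓔.IsCarreDuChamp Γ)
    (hφ : ∀ᵐ x ∂μ, Γ φ φ x = 0 ∨ q.1 x = 0) (hη : 0 < η) (ht : 0 ≤ t) :
    inner ℝ (U t) φ.1 ≤ inner ℝ (U 0) φ.1 +
      η / 2 * Real.exp (Λ * t) * inner ℝ (U 0) (hq.mulL (U 0)) +
      𝓔.form φ φ / (2 * η * Y) * t := by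
  have hderiv := fun s hs => hU.hasDerivAt_inner_add_exp_mul hq φ η t (s := s) hs
  have hgrowth := (convex_Icc 0 t).image_sub_le_mul_sub_of_deriv_le
    (fun s hs => (hderiv s hs.1).continuousAt.continuousWithinAt)
    (fun s hs => (hderiv s (interior_subset hs).1).differentiableAt.differentiableWithinAt)
    (C := 𝓔.form φ φ / (2 * η * Y)) (fun s hs => ?_) 0 ⟨le_rfl, ht⟩ t ⟨ht, le_rfl⟩ ht
  · simp only [sub_self, mul_zero, Real.exp_zero, mul_one, sub_zero] at hgrowth
    have hnonneg := mul_nonneg hη.le (hq.inner_mulL_self_nonneg (U t))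
    linarith
  · obtain ⟨hs0, hst⟩ := interior_subset hs
    rw [(hderiv s hs0).deriv]
    exact hq.inner_add_mul_le hΓ hφ hη (hbdd s hs0) (hU.isGenerator s hs0)
      (Real.one_le_exp (mul_nonneg hq.rate_nonneg (sub_nonneg.2 hst)))

end IsHeatSolution

namespace IsSemigroup

variable {T : ℝ → Lp ℝ 2 μ →L[ℝ] Lp ℝ 2 μ} {f : Lp ℝ 2 μ} {c : ℝ≥0}

theorem inner_le (hT : 𝓔.IsSemigroup T) (hq : IsWeight Γ Λ Y q) (hΓ : 𝓔.IsCarreDuChamp Γ)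
    (hφ : ∀ᵐ x ∂μ, Γ φ φ x = 0 ∨ q.1 x = 0) (hfc : ∀ᵐ x ∂μ, |f x| ≤ c)
    (hf : ∀ᵐ x ∂μ, f x = 0 ∨ Y + q.1 x = 1) (hη : 0 < η) (ht : 0 ≤ t) :
    inner ℝ (T t f) φ.1 ≤ inner ℝ f φ.1 + η / 2 * Real.exp (Λ * t) * ‖f‖ ^ 2 +
      𝓔.form φ φ / (2 * η * Y) * t := by
  have hzero := hT.tendsto_avgOrbit_zero f
  rw [← hq.inner_mulL_self_eq_norm_sq hf]
  refine le_of_tendsto_of_tendsto ((hT.tendsto_avgOrbit f ht).inner tendsto_const_nhds)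
    (((hzero.inner tendsto_const_nhds).add ((hzero.inner
      ((hq.mulL.continuous.tendsto f).comp hzero)).const_mul _)).add_const _) ?_
  filter_upwards [self_mem_nhdsWithin] with h hh
  exact (hT.isHeatSolution_avgOrbit f (le_of_lt hh)).inner_le
    (fun s _ => memLp_top_of_bound (Lp.aestronglyMeasurable _) c (hT.abs_avgOrbit_le hh s hfc))
    hq hΓ hφ hη ht

/-- The integrated maximum principle for the weight `Y + q`, tested against `φ`. -/
theorem inner_sub_sq_le (hT : 𝓔.IsSemigroup T) (hq : IsWeight Γ Λ Y q)
    (hΓ : 𝓔.IsCarreDuChamp Γ) (hφ : ∀ᵐ x ∂μ, Γ φ φ x = 0 ∨ q.1 x = 0)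
    (hfc : ∀ᵐ x ∂μ, |f x| ≤ c) (hf : ∀ᵐ x ∂μ, f x = 0 ∨ Y + q.1 x = 1) (ht : 0 ≤ t) :
    inner ℝ (T t f - f) φ.1 ^ 2 ≤ Real.exp (Λ * t) * ‖f‖ ^ 2 * (𝓔.form φ φ / Y * t) := by
  have hform : 0 ≤ 𝓔.form φ φ / Y * t :=
    mul_nonneg (div_nonneg (𝓔.nonneg φ) (zero_le_one.trans hq.one_le_max)) ht
  have hbound : ∀ ψ : 𝓔.domain, (∀ᵐ x ∂μ, Γ ψ ψ x = 0 ∨ q.1 x = 0) → ∀ η > 0,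
      0 ≤ Real.exp (Λ * t) * ‖f‖ ^ 2 * (η * η) + -(2 * inner ℝ (T t f - f) ψ.1) * η +
        𝓔.form ψ ψ / Y * t := by
    intro ψ hψ η hη
    have hle := mul_le_mul_of_nonneg_left (hT.inner_le hq hΓ hψ hfc hf hη ht) hη.le
    have hcancel : η * (𝓔.form ψ ψ / (2 * η * Y) * t) = 𝓔.form ψ ψ / Y * t / 2 := by
      field_simp
    rw [mul_add, hcancel] at hle
    rw [inner_sub_left]
    linarith
  have hdiscrim := discrim_le_zero (a := Real.exp (Λ * t) * ‖f‖ ^ 2)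
    (b := -(2 * inner ℝ (T t f - f) φ.1)) (c := 𝓔.form φ φ / Y * t) fun η => by
      rcases lt_trichotomy η 0 with hη | rfl | hη
      · simpa using hbound (-φ) (by simpa using hφ) (-η) (neg_pos.2 hη)
      · simpa using hform
      · exact hbound φ hφ η hη
  rw [discrim] at hdiscrim
  linarith

end IsSemigroup

end SymmDirichletForm

section PreservesOne

variable {X : Type*} [MeasurableSpace X] {μ : Measure X}

/-- `S 1 = 1` a.e., where `S 1 = lim S f_n` a.e. for `f_n ∈ L²` with `f_n ↗ 1` a.e. -/
def PreservesOne (S : Lp ℝ 2 μ →L[ℝ] Lp ℝ 2 μ) : Prop :=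
  ∀ f : ℕ → Lp ℝ 2 μ, (∀ᵐ x ∂μ, Monotone fun n => f n x) →
    (∀ᵐ x ∂μ, Tendsto (fun n => f n x) atTop (𝓝 1)) →
    ∀ᵐ x ∂μ, Tendsto (fun n => S (f n) x) atTop (𝓝 1)

theorem preservesOne_id : PreservesOne (ContinuousLinearMap.id ℝ (Lp ℝ 2 μ)) :=
  fun _ _ hlim => hlim

theorem ae_monotone_coeFn_iff {f : ℕ → Lp ℝ 2 μ} :
    (∀ᵐ x ∂μ, Monotone fun n => f n x) ↔ Monotone f := by
  refine ⟨fun hmono m n hmn => ?_, fun hmono => ?_⟩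
  · rw [← Lp.coeFn_le]
    filter_upwards [hmono] with x hx using hx hmn
  · have hsucc := ae_all_iff.2 fun n : ℕ => (Lp.coeFn_le _ _).2 (hmono n.le_succ)
    filter_upwards [hsucc] with x hx using monotone_nat_of_le_succ hx

theorem PreservesOne.comp {S S' : Lp ℝ 2 μ →L[ℝ] Lp ℝ 2 μ} (hS : PreservesOne S)
    (hS' : PreservesOne S') (hmono : Monotone S') : PreservesOne (S.comp S') := fun f hf hlim =>
  hS (fun n => S' (f n))
    (ae_monotone_coeFn_iff.2 (hmono.comp (ae_monotone_coeFn_iff.1 hf))) (hS' f hf hlim)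

end PreservesOne

namespace SymmDirichletForm.IsSemigroup

variable {X : Type*} [MeasurableSpace X] {μ : Measure X} {𝓔 : SymmDirichletForm μ}
  {T : ℝ → Lp ℝ 2 μ →L[ℝ] Lp ℝ 2 μ} {t : ℝ}

theorem preservesOne_nat_mul (hT : 𝓔.IsSemigroup T) (ht : 0 ≤ t) (h : PreservesOne (T t))
    (n : ℕ) : PreservesOne (T (n * t)) := by
  induction n with
  | zero => simpa only [Nat.cast_zero, zero_mul, hT.zero] using preservesOne_id
  | succ n ih =>
    rw [Nat.cast_succ, add_one_mul, hT.add _ _ (by positivity) ht]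
    exact ih.comp h fun _ _ => hT.apply_mono ht

theorem isConservative_of_forall_le (hT : 𝓔.IsSemigroup T) {t₀ : ℝ} (ht₀ : 0 < t₀)
    (h : ∀ t, 0 < t → t ≤ t₀ → PreservesOne (T t)) : IsConservative T := by
  intro t ht f _
  obtain ⟨n, hn⟩ := exists_nat_gt (t / t₀)
  have hn_pos : (0 : ℝ) < n := (div_pos ht ht₀).trans hn
  have hle : t / n ≤ t₀ := (div_le_comm₀ ht₀ hn_pos).1 hn.le
  have hone := hT.preservesOne_nat_mul (div_pos ht hn_pos).le (h _ (div_pos ht hn_pos) hle) n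
  rw [mul_div_cancel₀ t hn_pos.ne'] at hone
  exact hone f

theorem setIntegral_apply_eq (hT : 𝓔.IsSemigroup T) (ht : 0 ≤ t) {s : Set X}
    (hs : MeasurableSet s) (hμs : μ s ≠ ∞) (f : Lp ℝ 2 μ) :
    ∫ x in s, T t f x ∂μ = ∫ x, f x * T t (indicatorConstLp 2 hs hμs (1 : ℝ)) x ∂μ := by
  rw [← L2.inner_indicatorConstLp_one (𝕜 := ℝ) hs hμs (T t f), real_inner_comm,
    hT.inner_apply_left ht, inner_Lp_two_eq_integral]

theorem integrable_apply [SigmaFinite μ] (hT : 𝓔.IsSemigroup T) (ht : 0 ≤ t) {f : Lp ℝ 2 μ}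
    (hf : 0 ≤ f) (hfi : Integrable f μ) : Integrable (T t f) μ := by
  have hf_ae : ∀ᵐ x ∂μ, 0 ≤ f x := (Lp.coeFn_nonneg f).2 hf
  have hTf_ae : ∀ᵐ x ∂μ, 0 ≤ T t f x := (Lp.coeFn_nonneg _).2 (hT.apply_nonneg ht hf)
  refine integrable_of_forall_fin_meas_le (ENNReal.ofReal (∫ x, f x ∂μ)) ENNReal.ofReal_lt_top
    (Lp.aestronglyMeasurable _) fun s hs hμs => ?_
  have hle_one := hT.apply_le ht (f := indicatorConstLp 2 hs hμs (1 : ℝ)) (c := 1) <| by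
    filter_upwards [indicatorConstLp_coeFn (p := 2) (hs := hs) (hμs := hμs) (c := (1 : ℝ))]
      with x hx
    exact hx.trans_le (Set.indicator_le_self' (fun _ _ => zero_le_one) x)
  rw [← ofReal_integral_norm_eq_lintegral_enorm
    (integrableOn_Lp_of_measure_ne_top _ fact_one_le_two_ennreal.out hμs)]
  refine ENNReal.ofReal_le_ofReal ?_
  calc ∫ x in s, ‖T t f x‖ ∂μ = ∫ x in s, T t f x ∂μ :=
        integral_congr_ae (ae_restrict_of_ae (hTf_ae.mono fun x => Real.norm_of_nonneg))
    _ = ∫ x, f x * T t (indicatorConstLp 2 hs hμs (1 : ℝ)) x ∂μ :=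
        hT.setIntegral_apply_eq ht hs hμs f
    _ ≤ ∫ x, f x ∂μ := by
        refine integral_mono_ae (integrable_mul_Lp_two _ _) hfi ?_
        filter_upwards [hf_ae, hle_one] with x hx hx_one
        exact mul_le_of_le_one_right hx hx_one

/-- By symmetry `∫_s T_t f_n dμ = ∫ f_n T_t 1_s dμ`, which tends to `μ(s)`. -/
theorem tendsto_setIntegral_apply [SigmaFinite μ] (hT : 𝓔.IsSemigroup T) (ht : 0 ≤ t) {s : Set X}
    (hs : MeasurableSet s) (hμs : μ s ≠ ∞) {f : ℕ → Lp ℝ 2 μ} (hf : Monotone f)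
    (hlim : ∀ᵐ x ∂μ, Tendsto (fun n => f n x) atTop (𝓝 1)) :
    Tendsto (fun n => ∫ x in s, T t (f n) x ∂μ) atTop
      (𝓝 (∫ x, T t (indicatorConstLp 2 hs hμs (1 : ℝ)) x ∂μ)) := by
  have hone_nonneg : 0 ≤ indicatorConstLp 2 hs hμs (1 : ℝ) := by
    rw [← Lp.coeFn_nonneg]
    filter_upwards [indicatorConstLp_coeFn (p := 2) (hs := hs) (hμs := hμs) (c := (1 : ℝ))]
      with x hx
    exact (Set.indicator_nonneg (fun _ _ => zero_le_one) x).trans_eq hx.symm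
  simp_rw [hT.setIntegral_apply_eq ht hs hμs]
  refine integral_tendsto_of_tendsto_of_monotone (fun n => integrable_mul_Lp_two _ _)
    (hT.integrable_apply ht hone_nonneg (integrable_indicatorConstLp hs hμs _)) ?_ ?_
  · filter_upwards [ae_monotone_coeFn_iff.2 hf,
      (Lp.coeFn_nonneg _).2 (hT.apply_nonneg ht hone_nonneg)] with x hx hnonneg
    exact hx.mul_const hnonneg
  · filter_upwards [hlim] with x hx
    simpa only [one_mul] using hx.mul_const _

theorem preservesOne_of_integral_eq [SigmaFinite μ] (hT : 𝓔.IsSemigroup T) (ht : 0 ≤ t)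
    {s : ℕ → Set X} (hs : ∀ k, MeasurableSet (s k)) (hμs : ∀ k, μ (s k) ≠ ∞)
    (hunion : ⋃ k, s k = Set.univ)
    (h : ∀ k, ∫ x, T t (indicatorConstLp 2 (hs k) (hμs k) (1 : ℝ)) x ∂μ = μ.real (s k)) :
    PreservesOne (T t) := by
  intro f hf hlim
  have hmono := ae_monotone_coeFn_iff.1 hf
  have hle_one : ∀ᵐ x ∂μ, ∀ n, T t (f n) x ≤ 1 := ae_all_iff.2 fun n =>
    hT.apply_le ht (c := 1) <| by
      filter_upwards [hf, hlim] with x hx hxlim using hx.ge_of_tendsto hxlim n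
  suffices hrestrict : ∀ k, ∀ᵐ x ∂μ.restrict (s k), Tendsto (fun n => T t (f n) x) atTop (𝓝 1) by
    rwa [← ae_restrict_iUnion_iff, hunion, Measure.restrict_univ] at hrestrict
  intro k
  refine tendsto_of_integral_tendsto_of_monotone (fun n =>
    integrableOn_Lp_of_measure_ne_top _ fact_one_le_two_ennreal.out (hμs k))
    (integrableOn_const (hμs k)) ?_
    (ae_restrict_of_ae (ae_monotone_coeFn_iff.2 fun m n hmn => hT.apply_mono ht (hmono hmn)))
    (ae_restrict_of_ae hle_one)
  rw [setIntegral_const, smul_eq_mul, mul_one, ← h k]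
  exact hT.tendsto_setIntegral_apply ht (hs k) (hμs k) hmono hlim

end SymmDirichletForm.IsSemigroup

namespace SymmDirichletForm

variable {X : Type*} [MeasurableSpace X] {μ : Measure X} {𝓔 : SymmDirichletForm μ}
  {Γ : 𝓔.domain →ₗ[ℝ] 𝓔.domain →ₗ[ℝ] Lp ℝ 1 μ} {T : ℝ → Lp ℝ 2 μ →L[ℝ] Lp ℝ 2 μ} {t : ℝ}

theorem IsSemigroup.integral_apply_eq (hT : 𝓔.IsSemigroup T) (hΓ : 𝓔.IsCarreDuChamp Γ)
    (ht : 0 ≤ t) {f : Lp ℝ 2 μ} {c : ℝ≥0} (hfc : ∀ᵐ x ∂μ, |f x| ≤ c) (hfi : Integrable f μ)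
    (hTfi : Integrable (T t f) μ) {Λ Y : ℕ → ℝ} {φ : ℕ → 𝓔.domain}
    (hq : ∀ᶠ n in atTop, ∃ q, IsWeight Γ (Λ n) (Y n) q ∧
      (∀ᵐ x ∂μ, f x = 0 ∨ Y n + q.1 x = 1) ∧ ∀ᵐ x ∂μ, Γ (φ n) (φ n) x = 0 ∨ q.1 x = 0)
    (hφ : ∀ᶠ n in atTop, ∀ᵐ x ∂μ, (φ n).1 x ∈ Set.Icc 0 1)
    (hφ_lim : ∀ᵐ x ∂μ, Tendsto (fun n => (φ n).1 x) atTop (𝓝 1))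
    (hlim : Tendsto (fun n => Real.exp (Λ n * t) * 𝓔.form (φ n) (φ n) / Y n) atTop (𝓝 0)) :
    ∫ x, T t f x ∂μ = ∫ x, f x ∂μ := by
  have hsub := Lp.coeFn_sub (T t f) f
  have hdiff_integrable : Integrable (T t f - f : Lp ℝ 2 μ) μ := (hTfi.sub hfi).congr hsub.symm
  have hinner_integral : Tendsto (fun n => inner ℝ (T t f - f) (φ n).1) atTop
      (𝓝 (∫ x, (T t f - f : Lp ℝ 2 μ) x ∂μ)) := by
    simp_rw [inner_Lp_two_eq_integral]
    refine tendsto_integral_filter_of_dominated_convergence _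
      (Eventually.of_forall fun n => (integrable_mul_Lp_two _ _).aestronglyMeasurable)
      (hφ.mono fun n hn => ?_) hdiff_integrable.norm ?_
    · filter_upwards [hn] with x hx
      rw [norm_mul, Real.norm_of_nonneg hx.1]
      exact mul_le_of_le_one_right (norm_nonneg _) hx.2
    · filter_upwards [hφ_lim] with x hx
      simpa only [mul_one] using hx.const_mul _
  have hinner_zero : Tendsto (fun n => inner ℝ (T t f - f) (φ n).1 ^ 2) atTop (𝓝 0) := by
    have hbound := hlim.const_mul (‖f‖ ^ 2 * t)
    rw [mul_zero] at hbound
    refine squeeze_zero' (Eventually.of_forall fun n => sq_nonneg _) (hq.mono fun n hn => ?_) hbound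
    obtain ⟨q, hq, hfq, hφq⟩ := hn
    exact (hT.inner_sub_sq_le hq hΓ hφq hfc hfq ht).trans_eq (by ring)
  have hzero := pow_eq_zero_iff two_ne_zero |>.1
    (tendsto_nhds_unique (hinner_integral.pow 2) hinner_zero)
  rw [integral_congr_ae hsub] at hzero
  exact sub_eq_zero.1 ((integral_sub hTfi hfi).symm.trans hzero)

variable [TopologicalSpace X] [T2Space X] [LocallyCompactSpace X] [SecondCountableTopology X]
  [OpensMeasurableSpace X] [IsFiniteMeasureOnCompacts μ] {ρ : X → ℝ} {b V : ℕ → ℝ}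

theorem IsExhaustion.exists_annular_cutoff (hρ : 𝓔.IsExhaustion ρ) (hΓ : 𝓔.IsCarreDuChamp Γ)
    (hreg : 𝓔.IsRegular) (hloc : 𝓔.IsStronglyLocal)
    (hb : ∀ᶠ n : ℕ in atTop, ∀ᵐ x ∂μ, 2 * n < ρ x → ρ x < 4 * n → 𝓔.energyLoc Γ ρ x ≤ b n) :
    ∃ φ : ℕ → 𝓔.domain, (∀ᶠ n in atTop, ∀ᵐ x ∂μ, (φ n).1 x ∈ Set.Icc 0 1) ∧
      (∀ᵐ x ∂μ, Tendsto (fun n => (φ n).1 x) atTop (𝓝 1)) ∧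
      (∀ᶠ n : ℕ in atTop, ∀ᵐ x ∂μ, Γ (φ n) (φ n) x = 0 ∨ 2 * n < ρ x) ∧
      ∀ᶠ n : ℕ in atTop, 𝓔.form (φ n) (φ n) ≤
        b n / n ^ 2 * μ.real (ρ ⁻¹' Set.Ioo (2 * n) (4 * n)) := by
  choose! φ c hc hφ hφ_one _ hφ_carre using fun (n : ℕ) (hn : 0 < n) =>
    hρ.exists_cutoff hΓ hreg hloc (a := 2 * n) (b := 4 * n)
      (mul_lt_mul_of_pos_right (by norm_num) (Nat.cast_pos.2 hn)) (by positivity)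
  refine ⟨φ, (eventually_gt_atTop 0).mono hφ, ?_, ?_, ?_⟩
  · have hone : ∀ᵐ x ∂μ, ∀ n, 0 < n → ρ x < c n → (φ n).1 x = 1 :=
      ae_all_iff.2 fun n => eventually_imp_distrib_left.2 (hφ_one n)
    filter_upwards [hone] with x hx
    refine tendsto_const_nhds.congr' ?_
    obtain ⟨N, hN⟩ := exists_nat_ge (ρ x)
    filter_upwards [eventually_ge_atTop N, eventually_gt_atTop 0] with n hNn hn
    have hNn' : (N : ℝ) ≤ n := Nat.cast_le.2 hNn
    exact (hx n hn (by linarith [hc n hn])).symm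
  · filter_upwards [eventually_gt_atTop 0] with n hn
    filter_upwards [hφ_carre n hn, hΓ.nonneg (φ n)] with x hx hnonneg
    refine (lt_or_ge (2 * (n : ℝ)) (ρ x)).symm.imp_left fun hle => le_antisymm ?_ hnonneg
    exact hx.trans_eq (Set.indicator_of_notMem (fun hmem => hmem.1.not_ge hle) _)
  · filter_upwards [eventually_gt_atTop 0, hb] with n hn hbn
    refine (hΓ.form_le_of_carre_le hρ (hφ_carre n hn) hbn).trans_eq ?_
    congr 1
    field_simp
    ring

theorem IsSemigroup.preservesOne_of_isRadialWeight (hT : 𝓔.IsSemigroup T)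
    (hρ : 𝓔.IsExhaustion ρ) (hΓ : 𝓔.IsCarreDuChamp Γ) (hreg : 𝓔.IsRegular)
    (hloc : 𝓔.IsStronglyLocal) (ht : 0 ≤ t)
    (hb : ∀ᶠ n : ℕ in atTop, ∀ᵐ x ∂μ, 2 * n < ρ x → ρ x < 4 * n → 𝓔.energyLoc Γ ρ x ≤ b n)
    (hb_nonneg : ∀ n, 0 ≤ b n)
    (hV : ∀ᶠ n : ℕ in atTop, μ.real (ρ ⁻¹' Set.Ioo (2 * n) (4 * n)) ≤ V n)
    (hq : ∀ᶠ R in atTop, ∃ Λ Y : ℕ → ℝ,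
      (∀ᶠ n : ℕ in atTop, ∃ q, IsRadialWeight Γ ρ (Λ n) R (2 * n) (Y n) q) ∧
      Tendsto (fun n => Real.exp (Λ n * t) * (b n / n ^ 2 * V n) / Y n) atTop (𝓝 0)) :
    PreservesOne (T t) := by
  obtain ⟨φ, hφ, hφ_lim, hφ_carre, hφ_form⟩ := hρ.exists_annular_cutoff hΓ hreg hloc hb
  refine hT.preservesOne_of_integral_eq ht (s := fun k : ℕ => {x | ρ x < k})
    (fun k => (hρ.isOpen_lt k).measurableSet) (fun k => hρ.measure_lt_ne_top k)
    (Set.iUnion_eq_univ_iff.2 fun x => exists_nat_gt (ρ x)) fun k => ?_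
  have hs := (hρ.isOpen_lt k).measurableSet
  have hμs := hρ.measure_lt_ne_top k
  have hone := indicatorConstLp_coeFn (p := 2) (hs := hs) (hμs := hμs) (c := (1 : ℝ))
  have hone_mem : ∀ᵐ x ∂μ, indicatorConstLp 2 hs hμs (1 : ℝ) x ∈ Set.Icc 0 1 := by
    filter_upwards [hone] with x hx
    rw [hx]
    exact ⟨Set.indicator_nonneg (fun _ _ => zero_le_one) x,
      Set.indicator_le_self' (fun _ _ => zero_le_one) x⟩
  have hone_integrable := integrable_indicatorConstLp (p := 2) hs hμs (1 : ℝ)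
  obtain ⟨R, ⟨Λ, Y, hq, hlim⟩, hkR⟩ := (hq.and (eventually_ge_atTop (k : ℝ))).exists
  rw [hT.integral_apply_eq hΓ ht (φ := φ) (Λ := Λ) (Y := Y) (c := 1)
    (hone_mem.mono fun x hx => (abs_of_nonneg hx.1).trans_le hx.2) hone_integrable
    (hT.integrable_apply ht ((Lp.coeFn_nonneg _).1 (hone_mem.mono fun x hx => hx.1))
      hone_integrable) ?_ hφ hφ_lim ?_]
  · rw [integral_congr_ae hone, integral_indicator_const _ hs, smul_eq_mul, mul_one]
  · filter_upwards [hq, hφ_carre] with n ⟨q, hq⟩ hφ_carre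
    refine ⟨q, hq.toIsWeight, ?_, ?_⟩
    · filter_upwards [hone, hq.eq_one] with x hx hq_one
      rw [hx, Set.indicator_apply_eq_zero]
      by_cases hxk : ρ x < k
      · exact Or.inr (hq_one (lt_of_lt_of_le hxk hkR))
      · exact Or.inl fun hmem => absurd hmem hxk
    · filter_upwards [hφ_carre, hq.eq_max] with x hx hq_max using hx.imp_right hq_max
  · refine squeeze_zero' (hq.mono fun n ⟨q, hq⟩ => ?_) ?_ hlim
    · have := hq.one_le_max
      have := 𝓔.nonneg (φ n)
      positivity
    · filter_upwards [hq, hφ_form, hV] with n ⟨q, hq⟩ hform hV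
      have := hq.one_le_max
      have := hb_nonneg n
      gcongr
      exact hform.trans (by gcongr)

end SymmDirichletForm

theorem tendsto_exp_mul_sq_div_exp {M N R t : ℝ} (hM : 0 ≤ M)
    (ht : 8 * M * (N + 1) ^ 2 * t ≤ 1) :
    Tendsto (fun n : ℕ => Real.exp (8 * M * ((N + 1) * n) ^ 2 * t) *
      (M / n ^ 2 * Real.exp (2 * N * (n : ℝ) ^ 2)) / Real.exp ((N + 1) * n * (2 * n - R)))
      atTop (𝓝 0) := by
  have hlim : Tendsto (fun n : ℕ => M * Real.exp (-n)) atTop (𝓝 0) := by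
    simpa only [mul_zero, Function.comp_apply] using ((Real.tendsto_exp_neg_atTop_nhds_zero.comp
      tendsto_natCast_atTop_atTop).const_mul M)
  refine squeeze_zero' (Eventually.of_forall fun n => by positivity) ?_ hlim
  filter_upwards [tendsto_natCast_atTop_atTop.eventually_ge_atTop ((N + 1) * R + 1),
    eventually_ge_atTop 1] with n hn hn_one
  have hn_one' : (1 : ℝ) ≤ n := Nat.one_le_cast.2 hn_one
  have hexp : 8 * M * ((N + 1) * n) ^ 2 * t + 2 * N * (n : ℝ) ^ 2 - (N + 1) * n * (2 * n - R) ≤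
      -n := by
    have hrate := mul_le_mul_of_nonneg_right ht (sq_nonneg (n : ℝ))
    have hlarge := mul_le_mul_of_nonneg_left hn (zero_le_one.trans hn_one')
    linarith
  calc _ = M / n ^ 2 * Real.exp (8 * M * ((N + 1) * n) ^ 2 * t + 2 * N * (n : ℝ) ^ 2 -
        (N + 1) * n * (2 * n - R)) := by
        rw [Real.exp_sub, Real.exp_add]
        ring
    _ ≤ M * Real.exp (-n) := by
        gcongr
        exact div_le_self hM (one_le_pow₀ hn_one')

namespace SymmDirichletForm

variable {X : Type*} [TopologicalSpace X] [T2Space X] [LocallyCompactSpace X]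
  [SecondCountableTopology X] [MeasurableSpace X] [OpensMeasurableSpace X] {μ : Measure X}
  [IsFiniteMeasureOnCompacts μ] {𝓔 : SymmDirichletForm μ}
  {Γ : 𝓔.domain →ₗ[ℝ] 𝓔.domain →ₗ[ℝ] Lp ℝ 1 μ} {T : ℝ → Lp ℝ 2 μ →L[ℝ] Lp ℝ 2 μ} {ρ : X → ℝ}
  {M N : ℝ}

theorem IsSemigroup.isConservative_of_energy_le (hT : 𝓔.IsSemigroup T)
    (hρ : 𝓔.IsExhaustion ρ) (hΓ : 𝓔.IsCarreDuChamp Γ) (hreg : 𝓔.IsRegular)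
    (hloc : 𝓔.IsStronglyLocal) (hM : 0 < M) (hN : 0 < N)
    (hE : ∀ᶠ R in atTop, ∀ᵐ x ∂μ, R ≤ ρ x → 𝓔.energyLoc Γ ρ x ≤ M)
    (hV : ∀ᶠ n : ℕ in atTop, μ.real (ρ ⁻¹' Set.Ioo (2 * n) (4 * n)) ≤
      Real.exp (2 * N * (n : ℝ) ^ 2)) : IsConservative T := by
  refine hT.isConservative_of_forall_le (t₀ := (8 * M * (N + 1) ^ 2)⁻¹) (by positivity)
    fun t ht htle => hT.preservesOne_of_isRadialWeight hρ hΓ hreg hloc ht.le (b := fun _ => M) ?_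
      (fun _ => hM.le) hV ?_
  · obtain ⟨R, hR⟩ := hE.exists
    filter_upwards [tendsto_natCast_atTop_atTop.eventually_ge_atTop R] with n hn
    filter_upwards [hR] with x hx hnx _
    exact hx (by linarith [n.cast_nonneg (α := ℝ)])
  filter_upwards [hE, eventually_ge_atTop 0] with R hER hR
  refine ⟨_, _, ?_, tendsto_exp_mul_sq_div_exp (N := N) (R := R) hM.le ?_⟩
  · filter_upwards [tendsto_natCast_atTop_atTop.eventually_ge_atTop R,
      eventually_gt_atTop 0] with n hRn hn
    have hn' : (0 : ℝ) < n := Nat.cast_pos.2 hn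
    refine exists_isRadialWeight_exp hρ hΓ hreg hloc (g := fun r => (N + 1) * n * (r - R))
      (g' := fun _ => (N + 1) * n) (B := fun _ => M) (by positivity) hR (by linarith)
      (fun r _ => ?_) continuousOn_const (fun _ _ => by positivity) (by simp) continuousOn_const
      (hER.mono fun x hx hmem => hx hmem.1) fun r _ => ?_
    · simpa only [mul_one] using ((hasDerivAt_id' r).sub_const R).const_mul ((N + 1) * (n : ℝ))
    · have : 0 < M * ((N + 1) * n) ^ 2 := by positivity
      linarith
  · exact (mul_le_mul_of_nonneg_left htle (by positivity)).trans_eq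
      (mul_inv_cancel₀ (by positivity))

end SymmDirichletForm

theorem sq_mul_log_rpow_le {r s β : ℝ} (hr : 0 ≤ r) (hs : 1 ≤ s) (hrs : r ≤ 4 * s) (hβ : 0 ≤ β)
    (hβ_le : β ≤ 2) :
    (r + 1) ^ 2 * Real.log (r + 1) ^ β ≤ 100 * s ^ 2 * Real.log (2 * s + 1) ^ 2 := by
  have hlog_half : 1 ≤ 2 * Real.log (2 * s + 1) := by
    have hinv : (2 * s + 1)⁻¹ ≤ 2⁻¹ := inv_anti₀ two_pos (by linarith)
    linarith [Real.one_sub_inv_le_log_of_pos (x := 2 * s + 1) (by linarith)]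
  have hlog_le : Real.log (r + 1) ≤ 2 * Real.log (2 * s + 1) := by
    calc Real.log (r + 1) ≤ Real.log ((2 * s + 1) ^ 2) :=
          Real.log_le_log (by linarith) (by nlinarith)
      _ = 2 * Real.log (2 * s + 1) := by simp only [Real.log_pow, Nat.cast_ofNat]
  have hrpow_le : Real.log (r + 1) ^ β ≤ (2 * Real.log (2 * s + 1)) ^ 2 := by
    calc Real.log (r + 1) ^ β ≤ (2 * Real.log (2 * s + 1)) ^ β :=
          Real.rpow_le_rpow (Real.log_nonneg (by linarith)) hlog_le hβ
      _ ≤ (2 * Real.log (2 * s + 1)) ^ (2 : ℝ) :=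
          Real.rpow_le_rpow_of_exponent_le hlog_half hβ_le
      _ = (2 * Real.log (2 * s + 1)) ^ 2 := Real.rpow_two _
  calc (r + 1) ^ 2 * Real.log (r + 1) ^ β ≤ (5 * s) ^ 2 * (2 * Real.log (2 * s + 1)) ^ 2 := by
        gcongr
        · exact Real.rpow_nonneg (Real.log_nonneg (by linarith)) β
        · linarith
    _ = 100 * s ^ 2 * Real.log (2 * s + 1) ^ 2 := by ring

theorem tendsto_log_two_mul_add_one_atTop :
    Tendsto (fun n : ℕ => Real.log (2 * n + 1)) atTop atTop :=
  Real.tendsto_log_atTop.comp <| tendsto_atTop_add_const_right _ _ <|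
    tendsto_natCast_atTop_atTop.const_mul_atTop two_pos

theorem tendsto_sq_mul_exp_neg_rpow {p : ℝ} (hp : 0 < p) :
    Tendsto (fun x : ℝ => x ^ 2 * Real.exp (-x ^ p)) atTop (𝓝 0) := by
  refine ((tendsto_rpow_mul_exp_neg_mul_atTop_nhds_zero (2 / p) 1 one_pos).comp
    (tendsto_rpow_atTop hp)).congr' ?_
  filter_upwards [eventually_ge_atTop 0] with x hx
  simp only [Function.comp_apply]
  rw [← Real.rpow_mul hx, mul_div_cancel₀ _ hp.ne', Real.rpow_two, neg_one_mul]

theorem tendsto_exp_mul_log_sq_div_exp {M N c t p : ℝ} (hM : 0 ≤ M) (hN : 0 ≤ N) (hp : 0 < p)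
    (ht : 8 * M * (4 * N + 4) ^ 2 * t ≤ 1) :
    Tendsto (fun n : ℕ => Real.exp (8 * M * (4 * N + 4) ^ 2 * Real.log (2 * n + 1) ^ p * t) *
      (M * (100 * n ^ 2 * Real.log (2 * n + 1) ^ 2) / n ^ 2 *
        Real.exp (2 * N * Real.log (n + 1) ^ p)) /
      Real.exp ((4 * N + 4) * Real.log (2 * n + 1) ^ (p - 1) * (Real.log (2 * n + 1) - c)))
      atTop (𝓝 0) := by
  have hlim : Tendsto (fun n : ℕ => M * 100 *
      (Real.log (2 * n + 1) ^ 2 * Real.exp (-Real.log (2 * n + 1) ^ p))) atTop (𝓝 0) := by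
    simpa only [mul_zero, Function.comp_apply] using
      ((tendsto_sq_mul_exp_neg_rpow hp).comp tendsto_log_two_mul_add_one_atTop).const_mul (M * 100)
  refine squeeze_zero' (Eventually.of_forall fun n => by positivity) ?_ hlim
  filter_upwards [tendsto_log_two_mul_add_one_atTop.eventually_ge_atTop (2 * c),
    tendsto_log_two_mul_add_one_atTop.eventually_gt_atTop 0, eventually_gt_atTop 0]
    with n hcn hlog_pos hn
  have hn' : (0 : ℝ) < n := Nat.cast_pos.2 hn
  have hlog_le : Real.log (n + 1) ^ p ≤ Real.log (2 * n + 1) ^ p := by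
    gcongr
    · exact Real.log_nonneg (by linarith)
    · linarith
  set L := Real.log (2 * n + 1)
  have hpow : L ^ (p - 1) * L = L ^ p := by
    rw [← Real.rpow_add_one hlog_pos.ne', sub_add_cancel]
  have hexp : 8 * M * (4 * N + 4) ^ 2 * L ^ p * t + 2 * N * Real.log (n + 1) ^ p -
      (4 * N + 4) * L ^ (p - 1) * (L - c) ≤ -L ^ p := by
    have hrate := mul_le_mul_of_nonneg_right ht (Real.rpow_nonneg hlog_pos.le p)
    have hvolume := mul_le_mul_of_nonneg_left hlog_le hN
    have hlarge : (4 * N + 4) * L ^ (p - 1) * (2 * c) ≤ (4 * N + 4) * L ^ (p - 1) * L := by gcongr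
    linear_combination hrate + 2 * hvolume + hlarge / 2 - (2 * N + 2) * hpow
  calc _ = M * 100 * (L ^ 2 * Real.exp (8 * M * (4 * N + 4) ^ 2 * L ^ p * t +
        2 * N * Real.log (n + 1) ^ p - (4 * N + 4) * L ^ (p - 1) * (L - c))) := by
        rw [Real.exp_sub, Real.exp_add]
        field_simp
    _ ≤ M * 100 * (L ^ 2 * Real.exp (-L ^ p)) := by gcongr

theorem tendsto_mul_log_rpow_div_exp {M N C c : ℝ} (hM : 0 ≤ M) (hN : 0 ≤ N) (hC : 0 ≤ C) :
    Tendsto (fun n : ℕ => C * (M * (100 * n ^ 2 * Real.log (2 * n + 1) ^ 2) / n ^ 2 *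
      Real.log (n + 1) ^ (2 * N)) /
      Real.exp ((2 * N + 3) * (Real.log (Real.log (2 * n + 1)) - c))) atTop (𝓝 0) := by
  have hlim : Tendsto (fun n : ℕ => C * M * 100 * Real.exp ((2 * N + 3) * c) *
      (Real.log (2 * n + 1))⁻¹) atTop (𝓝 0) := by
    simpa only [mul_zero, Function.comp_apply] using
      (tendsto_inv_atTop_zero.comp tendsto_log_two_mul_add_one_atTop).const_mul
        (C * M * 100 * Real.exp ((2 * N + 3) * c))
  have hlog_nonneg (n : ℕ) : 0 ≤ Real.log (n + 1) :=
    Real.log_nonneg (by linarith [n.cast_nonneg (α := ℝ)])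
  refine squeeze_zero' (Eventually.of_forall fun n => ?_) ?_ hlim
  · have := Real.rpow_nonneg (hlog_nonneg n) (2 * N)
    positivity
  filter_upwards [tendsto_log_two_mul_add_one_atTop.eventually_gt_atTop 0,
    eventually_gt_atTop 0] with n hlog_pos hn
  have hn' : (0 : ℝ) < n := Nat.cast_pos.2 hn
  have hlog_le : Real.log (n + 1) ^ (2 * N) ≤ Real.log (2 * n + 1) ^ (2 * N) := by
    gcongr
    · exact hlog_nonneg n
    · linarith
  set L := Real.log (2 * n + 1)
  have hexp : Real.exp ((2 * N + 3) * (Real.log L - c)) =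
      L ^ (2 * N) * L ^ 3 / Real.exp ((2 * N + 3) * c) := by
    rw [mul_sub, Real.exp_sub, mul_comm _ (Real.log L), ← Real.rpow_def_of_pos hlog_pos,
      Real.rpow_add hlog_pos, Real.rpow_ofNat]
  rw [hexp]
  calc _ ≤ C * (M * (100 * n ^ 2 * L ^ 2) / n ^ 2 * L ^ (2 * N)) /
        (L ^ (2 * N) * L ^ 3 / Real.exp ((2 * N + 3) * c)) := by gcongr
    _ = C * M * 100 * Real.exp ((2 * N + 3) * c) * L⁻¹ := by
        have := Real.rpow_pos_of_pos hlog_pos (2 * N)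
        field_simp

namespace SymmDirichletForm

variable {X : Type*} [TopologicalSpace X] [T2Space X] [LocallyCompactSpace X]
  [SecondCountableTopology X] [MeasurableSpace X] [OpensMeasurableSpace X] {μ : Measure X}
  {𝓔 : SymmDirichletForm μ}
  {Γ : 𝓔.domain →ₗ[ℝ] 𝓔.domain →ₗ[ℝ] Lp ℝ 1 μ} {T : ℝ → Lp ℝ 2 μ →L[ℝ] Lp ℝ 2 μ} {ρ : X → ℝ}
  {M β R : ℝ}

omit [T2Space X] [OpensMeasurableSpace X] in
theorem IsExhaustion.eventually_energyLoc_le_annulus (hρ : 𝓔.IsExhaustion ρ) (hM : 0 ≤ M)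
    (hβ : 0 ≤ β) (hβ_le : β ≤ 2)
    (hE : ∀ᵐ x ∂μ, R ≤ ρ x → 𝓔.energyLoc Γ ρ x ≤ M * (ρ x + 1) ^ 2 * Real.log (ρ x + 1) ^ β) :
    ∀ᶠ n : ℕ in atTop, ∀ᵐ x ∂μ, 2 * n < ρ x → ρ x < 4 * n →
      𝓔.energyLoc Γ ρ x ≤ M * (100 * n ^ 2 * Real.log (2 * n + 1) ^ 2) := by
  filter_upwards [tendsto_natCast_atTop_atTop.eventually_ge_atTop R, eventually_ge_atTop 1]
    with n hRn hn
  filter_upwards [hE] with x hx hnx hxn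
  refine (hx (by linarith [n.cast_nonneg (α := ℝ)])).trans ?_
  rw [mul_assoc]
  exact mul_le_mul_of_nonneg_left
    (sq_mul_log_rpow_le (hρ.nonneg x) (Nat.one_le_cast.2 hn) hxn.le hβ hβ_le) hM

theorem exists_isRadialWeight_exp_log [SFinite μ] (hρ : 𝓔.IsExhaustion ρ)
    (hΓ : 𝓔.IsCarreDuChamp Γ) (hreg : 𝓔.IsRegular) (hloc : 𝓔.IsStronglyLocal) (hM : 0 < M)
    (hβ : 0 ≤ β) {A a : ℝ} (hA : 0 < A) (hR : 0 < R) (hRa : R ≤ a)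
    (hE : ∀ᵐ x ∂μ, R ≤ ρ x → 𝓔.energyLoc Γ ρ x ≤ M * (ρ x + 1) ^ 2 * Real.log (ρ x + 1) ^ β) :
    ∃ q, IsRadialWeight Γ ρ (8 * M * A ^ 2 * Real.log (a + 1) ^ (2 - β)) R a
      (Real.exp (A * Real.log (a + 1) ^ (2 - β - 1) * (Real.log (a + 1) - Real.log (R + 1))))
      q := by
  have hL : 0 < Real.log (a + 1) := Real.log_pos (by linarith)
  set α := A * Real.log (a + 1) ^ (2 - β - 1) with hα_def
  have hα : 0 < α := by positivity
  have hα_sq : α ^ 2 * Real.log (a + 1) ^ β = A ^ 2 * Real.log (a + 1) ^ (2 - β) := by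
    rw [hα_def, mul_pow, mul_assoc, ← Real.rpow_mul_natCast hL.le, ← Real.rpow_add hL]
    congr 2
    push_cast
    ring
  have hpos {r : ℝ} (hr : r ∈ Set.Icc R a) : 0 < r + 1 := by linarith [hr.1]
  refine exists_isRadialWeight_exp hρ hΓ hreg hloc (Λ := 8 * M * A ^ 2 * _)
    (g := fun r => α * (Real.log (r + 1) - Real.log (R + 1))) (g' := fun r => α * (1 / (r + 1)))
    (B := fun r => M * (r + 1) ^ 2 * Real.log (r + 1) ^ β) (by positivity) hR.le hRa
    (fun r hr => ((((hasDerivAt_id' r).add_const 1).log (hpos hr).ne').sub_const _).const_mul α)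
    ?_ (fun r hr => by have := hpos hr; positivity) (by simp) ?_
    (hE.mono fun x hx hmem => hx hmem.1) fun r hr => ?_
  · exact continuousOn_const.mul (continuousOn_const.div (by fun_prop) fun r hr => (hpos hr).ne')
  · exact (by fun_prop : Continuous fun r : ℝ => M * (r + 1) ^ 2).continuousOn.mul
      (((by fun_prop : Continuous fun r : ℝ => r + 1).continuousOn.log
        fun r hr => (hpos hr).ne').rpow_const fun _ _ => Or.inr hβ)
  · have hr_pos := hpos hr
    calc (2 * (α * (1 / (r + 1)))) ^ 2 * (M * (r + 1) ^ 2 * Real.log (r + 1) ^ β) =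
          4 * M * (α ^ 2 * Real.log (r + 1) ^ β) := by field_simp; ring
      _ ≤ 4 * M * (α ^ 2 * Real.log (a + 1) ^ β) := by
          gcongr
          · exact Real.log_nonneg (by linarith [hr.1])
          · exact hr.2
      _ < 8 * M * A ^ 2 * Real.log (a + 1) ^ (2 - β) := by
          rw [hα_sq]
          have : 0 < M * (A ^ 2 * Real.log (a + 1) ^ (2 - β)) := by positivity
          linarith

theorem exists_isRadialWeight_exp_log_log [SFinite μ] (hρ : 𝓔.IsExhaustion ρ)
    (hΓ : 𝓔.IsCarreDuChamp Γ) (hreg : 𝓔.IsRegular) (hloc : 𝓔.IsStronglyLocal) (hM : 0 < M)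
    {A a : ℝ} (hA : 0 < A) (hR : 0 < R) (hRa : R ≤ a)
    (hE : ∀ᵐ x ∂μ, R ≤ ρ x →
      𝓔.energyLoc Γ ρ x ≤ M * (ρ x + 1) ^ 2 * Real.log (ρ x + 1) ^ (2 : ℝ)) :
    ∃ q, IsRadialWeight Γ ρ (8 * M * A ^ 2) R a
      (Real.exp (A * (Real.log (Real.log (a + 1)) - Real.log (Real.log (R + 1))))) q := by
  have hpos {r : ℝ} (hr : r ∈ Set.Icc R a) : 0 < r + 1 := by linarith [hr.1]
  have hlog_pos {r : ℝ} (hr : r ∈ Set.Icc R a) : 0 < Real.log (r + 1) :=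
    Real.log_pos (by linarith [hr.1])
  have hlog_cont : ContinuousOn (fun r => Real.log (r + 1)) (Set.Icc R a) :=
    (by fun_prop : Continuous fun r : ℝ => r + 1).continuousOn.log fun r hr => (hpos hr).ne'
  refine exists_isRadialWeight_exp hρ hΓ hreg hloc
    (g := fun r => A * (Real.log (Real.log (r + 1)) - Real.log (Real.log (R + 1))))
    (g' := fun r => A * (1 / (r + 1) / Real.log (r + 1)))
    (B := fun r => M * (r + 1) ^ 2 * Real.log (r + 1) ^ 2) (by positivity) hR.le hRa
    (fun r hr => (((((hasDerivAt_id' r).add_const 1).log (hpos hr).ne').log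
      (hlog_pos hr).ne').sub_const _).const_mul A)
    ?_ (fun r hr => by have := hpos hr; have := hlog_pos hr; positivity) (by simp) ?_
    (hE.mono fun x hx hmem => by simpa only [Real.rpow_two] using hx hmem.1) fun r hr => ?_
  · exact continuousOn_const.mul ((continuousOn_const.div (by fun_prop)
      fun r hr => (hpos hr).ne').div hlog_cont fun r hr => (hlog_pos hr).ne')
  · exact (by fun_prop : Continuous fun r : ℝ => M * (r + 1) ^ 2).continuousOn.mul
      (hlog_cont.pow 2)
  · have hr_pos := hpos hr
    have hlogr_pos := hlog_pos hr
    calc _ = 4 * (M * A ^ 2) := by field_simp; ring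
      _ < 8 * M * A ^ 2 := by
          have : 0 < M * A ^ 2 := by positivity
          linarith

variable [IsFiniteMeasureOnCompacts μ] {N : ℝ}

theorem IsSemigroup.isConservative_of_energy_le_sq_mul_log_rpow (hT : 𝓔.IsSemigroup T)
    (hρ : 𝓔.IsExhaustion ρ) (hΓ : 𝓔.IsCarreDuChamp Γ) (hreg : 𝓔.IsRegular)
    (hloc : 𝓔.IsStronglyLocal) (hM : 0 < M) (hN : 0 < N) (hβ : 0 ≤ β) (hβ_lt : β < 2)
    (hE : ∀ᶠ R in atTop, ∀ᵐ x ∂μ, R ≤ ρ x →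
      𝓔.energyLoc Γ ρ x ≤ M * (ρ x + 1) ^ 2 * Real.log (ρ x + 1) ^ β)
    (hV : ∀ᶠ n : ℕ in atTop, μ.real (ρ ⁻¹' Set.Ioo (2 * n) (4 * n)) ≤
      Real.exp (2 * N * Real.log (n + 1) ^ (2 - β))) : IsConservative T := by
  obtain ⟨R₀, hR₀⟩ := hE.exists
  refine hT.isConservative_of_forall_le (t₀ := (8 * M * (4 * N + 4) ^ 2)⁻¹) (by positivity)
    fun t ht htle => hT.preservesOne_of_isRadialWeight hρ hΓ hreg hloc ht.le
      (hρ.eventually_energyLoc_le_annulus hM.le hβ hβ_lt.le hR₀) (fun n => by positivity) hV ?_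
  filter_upwards [hE, eventually_gt_atTop 0] with R hER hR
  refine ⟨_, _, ?_, tendsto_exp_mul_log_sq_div_exp (c := Real.log (R + 1)) hM.le hN.le
    (sub_pos.2 hβ_lt) ?_⟩
  · filter_upwards [tendsto_natCast_atTop_atTop.eventually_ge_atTop R] with n hRn
    exact exists_isRadialWeight_exp_log hρ hΓ hreg hloc hM hβ (by positivity) hR
      (by linarith) hER
  · exact (mul_le_mul_of_nonneg_left htle (by positivity)).trans_eq
      (mul_inv_cancel₀ (by positivity))

theorem IsSemigroup.isConservative_of_energy_le_sq_mul_log_sq (hT : 𝓔.IsSemigroup T)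
    (hρ : 𝓔.IsExhaustion ρ) (hΓ : 𝓔.IsCarreDuChamp Γ) (hreg : 𝓔.IsRegular)
    (hloc : 𝓔.IsStronglyLocal) (hM : 0 < M) (hN : 0 < N)
    (hE : ∀ᶠ R in atTop, ∀ᵐ x ∂μ, R ≤ ρ x →
      𝓔.energyLoc Γ ρ x ≤ M * (ρ x + 1) ^ 2 * Real.log (ρ x + 1) ^ (2 : ℝ))
    (hV : ∀ᶠ n : ℕ in atTop, μ.real (ρ ⁻¹' Set.Ioo (2 * n) (4 * n)) ≤
      Real.log (n + 1) ^ (2 * N)) : IsConservative T := by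
  obtain ⟨R₀, hR₀⟩ := hE.exists
  refine hT.isConservative_of_forall_le one_pos
    fun t ht _ => hT.preservesOne_of_isRadialWeight hρ hΓ hreg hloc ht.le
      (hρ.eventually_energyLoc_le_annulus hM.le zero_le_two le_rfl hR₀)
      (fun n => by positivity) hV ?_
  filter_upwards [hE, eventually_gt_atTop 0] with R hER hR
  refine ⟨_, _, ?_, tendsto_mul_log_rpow_div_exp (c := Real.log (Real.log (R + 1))) hM.le hN.le
    (Real.exp_pos (8 * M * (2 * N + 3) ^ 2 * t)).le⟩
  filter_upwards [tendsto_natCast_atTop_atTop.eventually_ge_atTop R] with n hRn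
  exact exists_isRadialWeight_exp_log_log hρ hΓ hreg hloc hM (by positivity) hR (by linarith) hER

end SymmDirichletForm

theorem measureReal_preimage_Ioo_le {X : Type*} [MeasurableSpace X] {μ : Measure X} {ρ : X → ℝ}
    {a b V : ℝ} (hV : 0 ≤ V) (h : μ ({x | ρ x < b} \ {x | ρ x < a}) ≤ ENNReal.ofReal V) :
    μ.real (ρ ⁻¹' Set.Ioo a b) ≤ V :=
  ENNReal.toReal_le_of_le_ofReal hV <|
    (measure_mono fun _ hx => ⟨hx.2, not_lt_of_gt hx.1⟩ :
      μ (ρ ⁻¹' Set.Ioo a b) ≤ μ ({x | ρ x < b} \ {x | ρ x < a})).trans h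

theorem mainTheorem3_general {X : Type*} [TopologicalSpace X] [T2Space X]
    [LocallyCompactSpace X] [SecondCountableTopology X] [MeasurableSpace X]
    [OpensMeasurableSpace X] {μ : Measure X} [IsFiniteMeasureOnCompacts μ]
    {𝓔 : SymmDirichletForm μ} (hreg : 𝓔.IsRegular) (hloc : 𝓔.IsStronglyLocal)
    {Γ : 𝓔.domain →ₗ[ℝ] 𝓔.domain →ₗ[ℝ] Lp ℝ 1 μ} (hΓ : 𝓔.IsCarreDuChamp Γ)
    {T : ℝ → Lp ℝ 2 μ →L[ℝ] Lp ℝ 2 μ} (hT : 𝓔.IsSemigroup T)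
    {ρ : X → ℝ} (hρ : 𝓔.IsExhaustion ρ) :
    (∀ (M N β : ℝ) (K : Set X), 0 < M → 0 < N → 0 ≤ β → β ≤ 2 → IsCompact K →
      (∀ᵐ x ∂μ, x ∉ K → 𝓔.energyLoc Γ ρ x ≤ M * (ρ x + 1) ^ 2 * Real.log (ρ x + 1) ^ β) →
      (β < 2 → ∀ᶠ n : ℕ in atTop, μ ({x | ρ x < 4 * n} \ {x | ρ x < 2 * n})
        ≤ ENNReal.ofReal (Real.exp (2 * N * Real.log (n + 1) ^ (2 - β)))) →
      (β = 2 → ∀ᶠ n : ℕ in atTop, μ ({x | ρ x < 4 * n} \ {x | ρ x < 2 * n})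
        ≤ ENNReal.ofReal (Real.log (n + 1) ^ (2 * N))) →
      IsConservative T) ∧
    (∀ (M N : ℝ) (K : Set X), 0 < M → 0 < N → IsCompact K →
      (∀ᵐ x ∂μ, x ∉ K → 𝓔.energyLoc Γ ρ x ≤ M) →
      (∀ᶠ n : ℕ in atTop, μ ({x | ρ x < 4 * n} \ {x | ρ x < 2 * n})
        ≤ ENNReal.ofReal (Real.exp (2 * N * (n : ℝ) ^ 2))) →
      IsConservative T) := by
  refine ⟨fun M N β K hM hN hβ hβ_le hK hE hV_lt hV_eq => ?_, fun M N K hM hN hK hE hV => ?_⟩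
  · obtain hβ_lt | rfl := hβ_le.lt_or_eq
    · exact hT.isConservative_of_energy_le_sq_mul_log_rpow hρ hΓ hreg hloc hM hN hβ hβ_lt
        (hρ.eventually_ae_of_isCompact hK hE)
        ((hV_lt hβ_lt).mono fun n => measureReal_preimage_Ioo_le (by positivity))
    · exact hT.isConservative_of_energy_le_sq_mul_log_sq hρ hΓ hreg hloc hM hN
        (hρ.eventually_ae_of_isCompact hK hE)
        ((hV_eq rfl).mono fun n => measureReal_preimage_Ioo_le
          (Real.rpow_nonneg (Real.log_nonneg (by linarith [n.cast_nonneg (α := ℝ)])) _))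
  · exact hT.isConservative_of_energy_le hρ hΓ hreg hloc hM hN
      (hρ.eventually_ae_of_isCompact hK hE)
      (hV.mono fun n => measureReal_preimage_Ioo_le (by positivity))

theorem SymmDirichletForm.isExhaustion_dist {X : Type*} [PseudoMetricSpace X] [MeasurableSpace X]
    {μ : Measure X} {𝓔 : SymmDirichletForm μ} {x₀ : X} (hd : 𝓔.MemLoc fun x => dist x x₀)
    (hball : ∀ r > 0, IsCompact (closure (Metric.ball x₀ r))) :
    𝓔.IsExhaustion fun x => dist x x₀ where
  memLoc := hd
  continuous := by fun_prop
  nonneg _ := dist_nonneg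
  isCompact_closure r := by
    obtain hr | hr := lt_or_ge 0 r
    · exact hball r hr
    · change IsCompact (closure (Metric.ball x₀ r))
      rw [Metric.ball_eq_empty.2 hr, closure_empty]
      exact isCompact_empty

theorem mainTheorem3 {X : Type*} [MetricSpace X] [LocallyCompactSpace X]
    [SecondCountableTopology X] [MeasurableSpace X] [BorelSpace X]
    (μ : Measure X) [IsFiniteMeasureOnCompacts μ] [μ.IsOpenPosMeasure]
    (𝓔 : SymmDirichletForm μ) (hreg : 𝓔.IsRegular) (hloc : 𝓔.IsStronglyLocal)
    (Γ : 𝓔.domain →ₗ[ℝ] 𝓔.domain →ₗ[ℝ] Lp ℝ 1 μ) (hΓ : 𝓔.IsCarreDuChamp Γ)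
    (T : ℝ → Lp ℝ 2 μ →L[ℝ] Lp ℝ 2 μ) (hT : 𝓔.IsSemigroup T)
    (x₀ : X) (hd : 𝓔.MemLoc fun x => dist x x₀)
    (hball : ∀ r > 0, IsCompact (closure (Metric.ball x₀ r)))
    (K₀ : Set X) (hK₀ : IsCompact K₀)
    (hbdd : ∀ V : Set X, IsOpen V → IsCompact (closure V) → closure V ⊆ K₀ᶜ →
      ∃ C : ℝ, ∀ᵐ x ∂μ, x ∈ V → |𝓔.energyLoc Γ (fun y => dist y x₀) x| ≤ C) :
    (∀ (M N β : ℝ) (K : Set X), 0 < M → 0 < N → 0 ≤ β → β ≤ 2 → IsCompact K → K₀ ⊆ K →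
      (∀ᵐ x ∂μ, x ∉ K → 𝓔.energyLoc Γ (fun y => dist y x₀) x
        ≤ M * (dist x x₀ + 1) ^ 2 * Real.log (dist x x₀ + 1) ^ β) →
      (β < 2 → ∀ᶠ n : ℕ in atTop, μ (Metric.ball x₀ (4 * n) \ Metric.ball x₀ (2 * n))
        ≤ ENNReal.ofReal (Real.exp (2 * N * Real.log (n + 1) ^ (2 - β)))) →
      (β = 2 → ∀ᶠ n : ℕ in atTop, μ (Metric.ball x₀ (4 * n) \ Metric.ball x₀ (2 * n))
        ≤ ENNReal.ofReal (Real.log (n + 1) ^ (2 * N))) →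
      IsConservative T) ∧
    (∀ (M N : ℝ) (K : Set X), 0 < M → 0 < N → IsCompact K → K₀ ⊆ K →
      (∀ᵐ x ∂μ, x ∉ K → 𝓔.energyLoc Γ (fun y => dist y x₀) x ≤ M) →
      (∀ᶠ n : ℕ in atTop, μ (Metric.ball x₀ (4 * n) \ Metric.ball x₀ (2 * n))
        ≤ ENNReal.ofReal (Real.exp (2 * N * (n : ℝ) ^ 2))) →
      IsConservative T) := by
  have general := mainTheorem3_general hreg hloc hΓ hT
    (SymmDirichletForm.isExhaustion_dist hd hball)
  exact ⟨fun M N β K hM hN hβ hβ_le hK _ => general.1 M N β K hM hN hβ hβ_le hK,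
    fun M N K hM hN hK _ => general.2 M N K hM hN hK⟩
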